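/- Let $M$ be a smooth (Hausdorff, second countable) manifold of dimension $2n\ge 4$, let $\omega$ be a symplectic form on $M$, and let $\nabla$ be a smooth symplectic connection on $(M,\omega)$, that is, a torsion-free affine connection with $\nabla\omega=0$. Let $R(X,Y)Z=\nabla_X\nabla_YZ-\nabla_Y\nabla_XZ-\nabla_{[X,Y]}Z$ be its curvature and $r(X,Y)=\operatorname{tr}\bigl(Z\mapsto R(X,Z)Y\bigr)$ its Ricci tensor. Suppose that $\nabla$ is of Ricci type, i.e. for all $x\in M$ and $X,Y,Z,T\in T_xM$ $$ \omega(R(X,Y)Z,T)=-\frac{1}{2(n+1)}\Bigl[2\omega(X,Y)\,r(Z,T)+\omega(X,Z)\,r(Y,T)+\omega(X,T)\,r(Y,Z)-\omega(Y,Z)\,r(X,T)-\omega(Y,T)\,r(X,Z)\Bigr]. $$ Then $\nabla$ is of type S: for every $p\in M$ there is an open neighborhood $V$ of $0$ in $T_pM$, star-shaped about $0$, with $V=-V$ and contained in the domain of the exponential map $\exp_p$ of $\nabla$, such that $\exp_p$ restricts to a diffeomorphism from $V$ onto an open set $U\subseteq M$, and such that the local geodesic symmetry $s_p:U\to U$,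 $s_p(\exp_p(X))=\exp_p(-X)$ for $X\in V$, satisfies $s_p^*(\omega|_U)=\omega|_U$. -/

import Mathlib

open Bundle Set Filter Topology
open scoped Manifold ContDiff

noncomputable section

namespace SymplecticConnection

variable {E : Type*} [NormedAddCommGroup E] [NormedSpace ℝ E]
  {M : Type*} [TopologicalSpace M] [ChartedSpace E M]

/-! ### Symplectic forms -/

/-- `Ω` is a symplectic form on `M`: a smooth, alternating, nondegenerate field of bilinear forms
which is closed. Closedness `dΩ = 0` is expressed by the invariant formula
`dΩ(X,Y,Z) = X Ω(Y,Z) + Y Ω(Z,X) + Z Ω(X,Y) - Ω([X,Y],Z) - Ω([Y,Z],X) - Ω([Z,X],Y)`. -/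
structure IsSymplecticForm [IsManifold 𝓘(ℝ, E) ∞ M]
    (Ω : Π x : M, TangentSpace 𝓘(ℝ, E) x →L[ℝ] TangentSpace 𝓘(ℝ, E) x →L[ℝ] ℝ) : Prop where
  contMDiff : ContMDiff 𝓘(ℝ, E) (𝓘(ℝ, E).prod 𝓘(ℝ, E →L[ℝ] E →L[ℝ] ℝ)) ∞
    (fun x ↦ TotalSpace.mk' (E →L[ℝ] E →L[ℝ] ℝ)
      (E := fun x : M ↦ TangentSpace 𝓘(ℝ, E) x →L[ℝ] TangentSpace 𝓘(ℝ, E) x →L[ℝ] ℝ) x (Ω x))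
  alternating : ∀ (x : M) (v : TangentSpace 𝓘(ℝ, E) x), Ω x v v = 0
  nondegenerate : ∀ (x : M) (v : TangentSpace 𝓘(ℝ, E) x), (∀ w, Ω x v w = 0) → v = 0
  closed : ∀ X Y Z : Π x : M, TangentSpace 𝓘(ℝ, E) x,
    CMDiff ∞ (T% X) → CMDiff ∞ (T% Y) → CMDiff ∞ (T% Z) → ∀ x : M,
      d% (fun y ↦ Ω y (Y y) (Z y)) x (X x) + d% (fun y ↦ Ω y (Z y) (X y)) x (Y x)
        + d% (fun y ↦ Ω y (X y) (Y y)) x (Z x)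
        - Ω x (VectorField.mlieBracket 𝓘(ℝ, E) X Y x) (Z x)
        - Ω x (VectorField.mlieBracket 𝓘(ℝ, E) Y Z x) (X x)
        - Ω x (VectorField.mlieBracket 𝓘(ℝ, E) Z X x) (Y x) = 0

/-- The symplectic form `Ω` is parallel: `X Ω(Y,Z) = Ω(∇_X Y, Z) + Ω(Y, ∇_X Z)`, where
`cov Y x v` is the value at `x` of the covariant derivative of `Y` in the direction `v`. -/
def IsParallel [IsManifold 𝓘(ℝ, E) ∞ M]
    (cov : CovariantDerivative 𝓘(ℝ, E) E (TangentSpace 𝓘(ℝ, E) : M → Type _))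
    (Ω : Π x : M, TangentSpace 𝓘(ℝ, E) x →L[ℝ] TangentSpace 𝓘(ℝ, E) x →L[ℝ] ℝ) : Prop :=
  ∀ Y Z : Π x : M, TangentSpace 𝓘(ℝ, E) x, CMDiff ∞ (T% Y) → CMDiff ∞ (T% Z) →
    ∀ (x : M) (v : TangentSpace 𝓘(ℝ, E) x),
      d% (fun y ↦ Ω y (Y y) (Z y)) x v = Ω x (cov Y x v) (Z x) + Ω x (Y x) (cov Z x v)

/-- `(M, Ω, ∇)` is a Fedosov manifold: `Ω` is a symplectic form on `M` and `∇` is a smooth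
torsion-free affine connection with `∇Ω = 0`. -/
structure IsFedosov [FiniteDimensional ℝ E] [IsManifold 𝓘(ℝ, E) ∞ M]
    (cov : CovariantDerivative 𝓘(ℝ, E) E (TangentSpace 𝓘(ℝ, E) : M → Type _))
    [CovariantDerivative.ContMDiffCovariantDerivative cov ∞]
    (Ω : Π x : M, TangentSpace 𝓘(ℝ, E) x →L[ℝ] TangentSpace 𝓘(ℝ, E) x →L[ℝ] ℝ) : Prop where
  symplectic : IsSymplecticForm Ω
  torsion_free : cov.torsion = 0
  parallel : IsParallel cov Ω

/-! ### Curvature -/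

/-- The curvature on vector fields, `R(X,Y)Z = ∇_X ∇_Y Z - ∇_Y ∇_X Z - ∇_[X,Y] Z`. -/
def curvatureField [IsManifold 𝓘(ℝ, E) ∞ M]
    (cov : CovariantDerivative 𝓘(ℝ, E) E (TangentSpace 𝓘(ℝ, E) : M → Type _))
    (X Y Z : Π x : M, TangentSpace 𝓘(ℝ, E) x) (x : M) : TangentSpace 𝓘(ℝ, E) x :=
  cov (fun y ↦ cov Z y (Y y)) x (X x) - cov (fun y ↦ cov Z y (X y)) x (Y x)
    - cov Z x (VectorField.mlieBracket 𝓘(ℝ, E) X Y x)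

/-- The vector field on the domain of the preferred chart at `x` whose coordinates in the tangent
bundle trivialization at `x` are constant, equal to `c` (and zero outside of that domain). -/
def constField [IsManifold 𝓘(ℝ, E) ∞ M] (x : M) (c : E) (y : M) : TangentSpace 𝓘(ℝ, E) y :=
  (trivializationAt E (TangentSpace 𝓘(ℝ, E) : M → Type _) x).symmL ℝ y c

/-- The coordinates of a tangent vector at `x` in the tangent bundle trivialization at `x`. -/
def coord [IsManifold 𝓘(ℝ, E) ∞ M] (x : M) : TangentSpace 𝓘(ℝ, E) x →L[ℝ] E :=
  (trivializationAt E (TangentSpace 𝓘(ℝ, E) : M → Type _) x).continuousLinearMapAt ℝ x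

lemma constField_coord [IsManifold 𝓘(ℝ, E) ∞ M] (x : M) (v : TangentSpace 𝓘(ℝ, E) x) :
    constField x (coord x v) x = v :=
  (trivializationAt E (TangentSpace 𝓘(ℝ, E) : M → Type _) x).symmL_continuousLinearMapAt
    (FiberBundle.mem_baseSet_trivializationAt' x) v

lemma constField_add [IsManifold 𝓘(ℝ, E) ∞ M] (x : M) (c d : E) :
    constField x (c + d) = constField x c + constField x d := by
  funext y; simp [constField]

lemma constField_smul [IsManifold 𝓘(ℝ, E) ∞ M] (x : M) (a : ℝ) (c : E) :
    constField x (a • c) = a • constField x c := by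
  funext y; simp [constField]

lemma contMDiffOn_constField [IsManifold 𝓘(ℝ, E) ∞ M] (x : M) (c : E) :
    CMDiff[(trivializationAt E (TangentSpace 𝓘(ℝ, E) : M → Type _) x).baseSet] ∞
      (T% (constField x c)) := by
  intro y hy
  rw [(trivializationAt E (TangentSpace 𝓘(ℝ, E) : M → Type _) x).contMDiffWithinAt_section _ hy]
  refine (contMDiffWithinAt_const (c := c)).congr_of_mem (fun z hz ↦ ?_) hy
  have hl := (trivializationAt E (TangentSpace 𝓘(ℝ, E) : M → Type _) x).symmL_apply (R := ℝ) hz c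
  simp only [constField, hl]
  exact congrArg Prod.snd
    ((trivializationAt E (TangentSpace 𝓘(ℝ, E) : M → Type _) x).apply_mk_symm hz c)

lemma contMDiffAt_constField [IsManifold 𝓘(ℝ, E) ∞ M] (x : M) (c : E) :
    CMDiffAt ∞ (T% (constField x c)) x :=
  (contMDiffOn_constField x c).contMDiffAt
    ((trivializationAt E (TangentSpace 𝓘(ℝ, E) : M → Type _) x).open_baseSet.mem_nhds
      (FiberBundle.mem_baseSet_trivializationAt' x))

/-- If the connection is smooth, then covariant derivatives of the fields `constField` are
differentiable. -/
lemma mdifferentiableAt_cov [FiniteDimensional ℝ E] [T2Space M] [IsManifold 𝓘(ℝ, E) ∞ M]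
    (cov : CovariantDerivative 𝓘(ℝ, E) E (TangentSpace 𝓘(ℝ, E) : M → Type _))
    [h : CovariantDerivative.ContMDiffCovariantDerivative cov ∞] (x : M) (c d : E) :
    MDiffAt (T% (fun y ↦ cov (constField x d) y (constField x c y))) x := by
  set t := trivializationAt E (TangentSpace 𝓘(ℝ, E) : M → Type _) x
  have ht : t.baseSet ∈ 𝓝 x :=
    t.open_baseSet.mem_nhds (FiberBundle.mem_baseSet_trivializationAt' x)
  obtain ⟨f, -, hf⟩ := (SmoothBumpFunction.nhds_basis_tsupport (I := 𝓘(ℝ, E)) x).mem_iff.1 ht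
  have hZ : CMDiff ∞ (T% ((f : M → ℝ) • constField x d)) :=
    f.contMDiff.contMDiffOn.smul_section_of_tsupport t.open_baseSet hf (contMDiffOn_constField x d)
  have h1 := (h.contMDiff.contMDiff (σ := (f : M → ℝ) • constField x d)
    hZ.contMDiffOn).contMDiffAt (x := x) univ_mem
  have h2 := (h1.of_le (m := 1) (by simp)).clm_bundle_apply
    ((contMDiffAt_constField x c).of_le (m := 1) (by simp))
  have h3 := h2.mdifferentiableAt one_ne_zero
  refine h3.congr_of_eventuallyEq ?_
  have hf1 : ∀ᶠ z in 𝓝 x, f z = 1 := f.eventuallyEq_one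
  filter_upwards [hf1.eventually_nhds, ht] with y hy hyt
  have hd : MDiffAt (T% (constField x d)) y :=
    ((contMDiffOn_constField x d).contMDiffAt (t.open_baseSet.mem_nhds hyt)).mdifferentiableAt
      (by simp)
  have : cov (constField x d) y = cov ((f : M → ℝ) • constField x d) y := by
    refine cov.isCovariantDerivativeOnUniv.congr_of_eventuallyEq hd
      (hZ.mdifferentiable (by simp) y) univ_mem ?_
    filter_upwards [hy] with z hz
    simp [hz]
  simp [this]

/-- The curvature tensor `R_x(u,v)w` at a point, computed with extensions of `u`, `v`, `w` to
vector fields that are smooth near `x`. -/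
def curvature [IsManifold 𝓘(ℝ, E) ∞ M]
    (cov : CovariantDerivative 𝓘(ℝ, E) E (TangentSpace 𝓘(ℝ, E) : M → Type _))
    (x : M) (u v w : TangentSpace 𝓘(ℝ, E) x) : TangentSpace 𝓘(ℝ, E) x :=
  curvatureField cov (constField x (coord x u)) (constField x (coord x v))
    (constField x (coord x w)) x

/-- The linear map `v ↦ R_x(u,v)w`. -/
def curvatureEndo [FiniteDimensional ℝ E] [T2Space M] [IsManifold 𝓘(ℝ, E) ∞ M]
    (cov : CovariantDerivative 𝓘(ℝ, E) E (TangentSpace 𝓘(ℝ, E) : M → Type _))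
    [CovariantDerivative.ContMDiffCovariantDerivative cov ∞]
    (x : M) (u w : TangentSpace 𝓘(ℝ, E) x) :
    TangentSpace 𝓘(ℝ, E) x →ₗ[ℝ] TangentSpace 𝓘(ℝ, E) x where
  toFun v := curvature cov x u v w
  map_add' v v' := by
    have hd (c : E) : MDiffAt (T% (constField x c)) x :=
      (contMDiffAt_constField x c).mdifferentiableAt (by simp)
    have h1 : cov (fun y ↦ cov (constField x (coord x w)) y (constField x (coord x (v + v')) y)) x =
        cov (fun y ↦ cov (constField x (coord x w)) y (constField x (coord x v) y)) x
        + cov (fun y ↦ cov (constField x (coord x w)) y (constField x (coord x v') y)) x := by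
      rw [← cov.isCovariantDerivativeOnUniv.add (mdifferentiableAt_cov cov x _ _)
        (mdifferentiableAt_cov cov x _ _)]
      congr 1
      funext y
      simp [constField_add]
    simp only [curvature, curvatureField, h1]
    simp only [map_add, constField_add, Pi.add_apply, add_apply]
    rw [VectorField.mlieBracket_add_right (hd _) (hd _)]
    simp only [map_add]
    abel
  map_smul' a v := by
    have hd (c : E) : MDiffAt (T% (constField x c)) x :=
      (contMDiffAt_constField x c).mdifferentiableAt (by simp)
    have h1 : cov (fun y ↦ cov (constField x (coord x w)) y (constField x (coord x (a • v)) y)) x =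
        a • cov (fun y ↦ cov (constField x (coord x w)) y (constField x (coord x v) y)) x := by
      rw [← cov.isCovariantDerivativeOnUniv.smul_const a (mdifferentiableAt_cov cov x _ _)]
      congr 1
      funext y
      simp [constField_smul]
    simp only [curvature, curvatureField, h1]
    simp only [map_smul, constField_smul, Pi.smul_apply, smul_apply]
    rw [VectorField.mlieBracket_const_smul_right (hd _)]
    simp only [map_smul, RingHom.id_apply, smul_sub]

/-- The Ricci tensor `r_x(u,w) = tr (v ↦ R_x(u,v)w)`. -/
def ricci [FiniteDimensional ℝ E] [T2Space M] [IsManifold 𝓘(ℝ, E) ∞ M]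
    (cov : CovariantDerivative 𝓘(ℝ, E) E (TangentSpace 𝓘(ℝ, E) : M → Type _))
    [CovariantDerivative.ContMDiffCovariantDerivative cov ∞]
    (x : M) (u w : TangentSpace 𝓘(ℝ, E) x) : ℝ :=
  LinearMap.trace ℝ (TangentSpace 𝓘(ℝ, E) x) (curvatureEndo cov x u w)

/-- The Ricci part `E_x` of the covariant curvature tensor `Ω(R(u,v)w, z)`. With
`dim M = 2n`, the factor below is `-1 / (2(n+1))`. -/
def ricciPart [FiniteDimensional ℝ E] [T2Space M] [IsManifold 𝓘(ℝ, E) ∞ M]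
    (cov : CovariantDerivative 𝓘(ℝ, E) E (TangentSpace 𝓘(ℝ, E) : M → Type _))
    [CovariantDerivative.ContMDiffCovariantDerivative cov ∞]
    (Ω : Π x : M, TangentSpace 𝓘(ℝ, E) x →L[ℝ] TangentSpace 𝓘(ℝ, E) x →L[ℝ] ℝ)
    (x : M) (u v w z : TangentSpace 𝓘(ℝ, E) x) : ℝ :=
  -(1 / ((Module.finrank ℝ E : ℝ) + 2)) *
    (2 * Ω x u v * ricci cov x w z + Ω x u w * ricci cov x v z + Ω x u z * ricci cov x v w
      - Ω x v w * ricci cov x u z - Ω x v z * ricci cov x u w)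

/-- The symplectic connection `∇` on `(M, Ω)` is of Ricci type: the covariant curvature tensor
`Ω(R(u,v)w, z)` equals its Ricci part. -/
def IsRicciType [FiniteDimensional ℝ E] [T2Space M] [IsManifold 𝓘(ℝ, E) ∞ M]
    (cov : CovariantDerivative 𝓘(ℝ, E) E (TangentSpace 𝓘(ℝ, E) : M → Type _))
    [CovariantDerivative.ContMDiffCovariantDerivative cov ∞]
    (Ω : Π x : M, TangentSpace 𝓘(ℝ, E) x →L[ℝ] TangentSpace 𝓘(ℝ, E) x →L[ℝ] ℝ) : Prop :=
  ∀ (x : M) (u v w z : TangentSpace 𝓘(ℝ, E) x),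
    Ω x (curvature cov x u v w) z = ricciPart cov Ω x u v w z

/-! ### Geodesics and the exponential map -/

/-- The velocity `γ'(t)` of a curve. -/
def velocity (γ : ℝ → M) (t : ℝ) : TangentSpace 𝓘(ℝ, E) (γ t) :=
  mfderiv 𝓘(ℝ, ℝ) 𝓘(ℝ, E) γ t (1 : ℝ)

/-- The covariant derivative `(DV/dt)(t)` of a vector field `V` along the curve `γ`. If
`V = ∑ cⁱ eᵢ` in the frame `eᵢ` of `TM` given by the trivialization at `γ t`, then
`DV/dt = ∑ (cⁱ)' eᵢ + ∑ cⁱ ∇_{γ'} eᵢ`. -/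
def covAlong [IsManifold 𝓘(ℝ, E) ∞ M]
    (cov : CovariantDerivative 𝓘(ℝ, E) E (TangentSpace 𝓘(ℝ, E) : M → Type _))
    (γ : ℝ → M) (V : Π t : ℝ, TangentSpace 𝓘(ℝ, E) (γ t)) (t : ℝ) :
    TangentSpace 𝓘(ℝ, E) (γ t) :=
  let c : ℝ → E := fun s ↦
    (trivializationAt E (TangentSpace 𝓘(ℝ, E) : M → Type _) (γ t)).continuousLinearMapAt ℝ
      (γ s) (V s)
  constField (γ t) (deriv c t) (γ t) + cov (constField (γ t) (c t)) (γ t) (velocity γ t)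

/-- The curve `γ`, smooth on the open set `J`, is a geodesic there: `∇_{γ'} γ' = 0`. -/
def IsGeodesicOn [IsManifold 𝓘(ℝ, E) ∞ M]
    (cov : CovariantDerivative 𝓘(ℝ, E) E (TangentSpace 𝓘(ℝ, E) : M → Type _))
    (γ : ℝ → M) (J : Set ℝ) : Prop :=
  ContMDiffOn 𝓘(ℝ, ℝ) 𝓘(ℝ, E) ∞ γ J ∧ ∀ t ∈ J, covAlong cov γ (velocity γ) t = 0

/-- There is a geodesic, defined on an open interval containing `[0,1]`, that starts at `p` with
velocity `v` and that is at `q` at time `1`. -/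
def GeodesicReaches [IsManifold 𝓘(ℝ, E) ∞ M]
    (cov : CovariantDerivative 𝓘(ℝ, E) E (TangentSpace 𝓘(ℝ, E) : M → Type _))
    (p : M) (v : TangentSpace 𝓘(ℝ, E) p) (q : M) : Prop :=
  ∃ (γ : ℝ → M) (a b : ℝ), a < 0 ∧ 1 < b ∧ IsGeodesicOn cov γ (Ioo a b) ∧
    (⟨γ 0, velocity γ 0⟩ : TangentBundle 𝓘(ℝ, E) M) = ⟨p, v⟩ ∧ γ 1 = q

/-- The domain of the exponential map at `p`. -/
def expDomain [IsManifold 𝓘(ℝ, E) ∞ M]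
    (cov : CovariantDerivative 𝓘(ℝ, E) E (TangentSpace 𝓘(ℝ, E) : M → Type _))
    (p : M) : Set (TangentSpace 𝓘(ℝ, E) p) :=
  {v | ∃ q, GeodesicReaches cov p v q}

open Classical in
/-- The exponential map at `p` (with value `p` outside of its domain). By uniqueness of geodesics,
the endpoint does not depend on the choice. -/
def expMap [IsManifold 𝓘(ℝ, E) ∞ M]
    (cov : CovariantDerivative 𝓘(ℝ, E) E (TangentSpace 𝓘(ℝ, E) : M → Type _))
    (p : M) (v : TangentSpace 𝓘(ℝ, E) p) : M :=
  if h : ∃ q, GeodesicReaches cov p v q then h.choose else p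

/-! ### Geodesic symmetries and connections of type S -/

/-- `Φ` is the restriction of the exponential map at `p` to a symmetric, star-shaped, open
neighborhood `Φ.source` of `0` in `T_p M`, and it is a diffeomorphism onto its open image
`Φ.target`. In other words, `Φ.target` is a symmetric normal neighborhood of `p`. Here `T_p M` is
identified with the model vector space `E`, to which it is equal by definition. -/
structure IsSymmetricNormal [IsManifold 𝓘(ℝ, E) ∞ M]
    (cov : CovariantDerivative 𝓘(ℝ, E) E (TangentSpace 𝓘(ℝ, E) : M → Type _))
    (p : M) (Φ : PartialDiffeomorph 𝓘(ℝ, E) 𝓘(ℝ, E) E M ∞) : Prop where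
  zero_mem : (0 : E) ∈ Φ.source
  starConvex : StarConvex ℝ (0 : E) Φ.source
  neg_mem : ∀ v ∈ Φ.source, -v ∈ Φ.source
  source_subset : Φ.source ⊆ expDomain cov p
  eq_exp : ∀ v ∈ Φ.source, Φ v = expMap cov p v

/-- The local geodesic symmetry `exp_p(v) ↦ exp_p(-v)` on the symmetric normal neighborhood
`Φ.target`. -/
def geodesicSymmetry (Φ : PartialDiffeomorph 𝓘(ℝ, E) 𝓘(ℝ, E) E M ∞) (q : M) : M :=
  Φ (-Φ.symm q)

/-- The connection is of type S: around each point `p` there is a symmetric normal neighborhood on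
which the local geodesic symmetry `s` centered at `p` satisfies `s^* Ω = Ω`. -/
def IsSType [IsManifold 𝓘(ℝ, E) ∞ M]
    (cov : CovariantDerivative 𝓘(ℝ, E) E (TangentSpace 𝓘(ℝ, E) : M → Type _))
    (Ω : Π x : M, TangentSpace 𝓘(ℝ, E) x →L[ℝ] TangentSpace 𝓘(ℝ, E) x →L[ℝ] ℝ) : Prop :=
  ∀ p : M, ∃ Φ : PartialDiffeomorph 𝓘(ℝ, E) 𝓘(ℝ, E) E M ∞, IsSymmetricNormal cov p Φ ∧
    ∀ q ∈ Φ.target, ∀ u v : TangentSpace 𝓘(ℝ, E) q,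
      Ω (geodesicSymmetry Φ q) (mfderiv 𝓘(ℝ, E) 𝓘(ℝ, E) (geodesicSymmetry Φ) q u)
        (mfderiv 𝓘(ℝ, E) 𝓘(ℝ, E) (geodesicSymmetry Φ) q v) = Ω q u v

end SymplecticConnection

end

/-! Fix p, read everything in the preferred chart at p, and put c = 1/(2n+2). If γ_v is the geodesic
from p with velocity v, then varying v in the direction w gives a Jacobi field J along γ_v with J(0)
= 0 and J(1) = (d exp_p)_v w. Since γ_v(-1) = γ_{-v}(1), also J(-1) = -(d exp_p)_{-v} w. The
geodesic symmetry therefore preserves ω as soon as t ↦ ω(J, K) is even for any two Jacobi fields J,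
K along the same geodesic that vanish at 0. This is `form_jacobi_even`, and `form_exp_even` is its
translation to exp_p.

With X = γ', the Jacobi equation is J'' = R(X, J)X, and the Ricci-type condition expands it to
ω(R(X,J)X, T) = -c [3 ω(X,J) r(X,T) + ω(X,T) r(X,J) - r(X,X) ω(J,T)]. What makes this tractable is a
consequence of the second Bianchi identity in dimension at least 4: (∇_v r)(v, ·) = β ω(v, ·) for
some scalar β depending on v (`eq_zero_of_secondBianchi`, `exists_covForm_eq`). Hence a = r(X,X) is
constant along geodesics, and ω(X,J)'' = 4ca ω(X,J). Moreover r(X, R(X,J)X) = 0 by pure algebra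
(`ricci_jacobi`).

The function β along the geodesic remains unknown, but it only meets the products ω(X,J) r(X,K) -
ω(X,K) r(X,J) and their variants with covariant derivatives J', K' through antisymmetric
expressions. Those vanish, because the Wronskian of ω(X,J) and ω(X,K) is constant and zero at t = 0.
Together with ω(J,K), its derivative and ω(J',K'), these products form a linear system with constant
coefficients that is compatible with t ↦ -t, and uniqueness gives the parity
(`even_of_jacobi_system`).

The analytic input is smooth dependence of geodesics on initial velocities. `exists_smooth_flow`
derives it from the implicit function theorem on the Banach space of continuous curves on [-1,1].
The inverse function theorem then yields normal neighborhoods, and `isRicciTypeOn` transfers the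
geometric hypotheses to Christoffel symbols. -/

noncomputable section

set_option maxSynthPendingDepth 3

/-! ### Superposition operators on spaces of continuous functions -/

namespace ContinuousMap

variable {K : Type*} [TopologicalSpace K]

/-- The superposition operator `z ↦ f ∘ z`. -/
def superposition {E F : Type*} [TopologicalSpace E] [TopologicalSpace F] (f : C(E, F))
    (z : C(K, E)) : C(K, F) := f.comp z

@[simp]
lemma superposition_apply {E F : Type*} [TopologicalSpace E] [TopologicalSpace F] (f : C(E, F))
    (z : C(K, E)) (k : K) : superposition f z k = f (z k) := rfl

variable [CompactSpace K]

/-- The pointwise application of a bilinear map to continuous functions. -/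
def pointwiseBilin {G E F : Type*} [NormedAddCommGroup G] [NormedSpace ℝ G]
    [NormedAddCommGroup E] [NormedSpace ℝ E] [NormedAddCommGroup F] [NormedSpace ℝ F]
    (B : G →L[ℝ] E →L[ℝ] F) : C(K, G) →L[ℝ] C(K, E) →L[ℝ] C(K, F) :=
  LinearMap.mkContinuous₂
    (LinearMap.mk₂ ℝ (fun (A : C(K, G)) (h : C(K, E)) ↦
        (⟨fun k ↦ B (A k) (h k), (B.continuous.comp A.continuous).clm_apply h.continuous⟩ :
          C(K, F)))
      (fun _ _ _ ↦ by ext; simp) (fun _ _ _ ↦ by ext; simp)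
      (fun _ _ _ ↦ by ext; simp) (fun _ _ _ ↦ by ext; simp)) ‖B‖
    (fun A h ↦ by
      rw [ContinuousMap.norm_le _ (by positivity)]
      intro k
      refine (B.le_opNorm₂ _ _).trans ?_
      gcongr
      · exact A.norm_coe_le_norm k
      · exact h.norm_coe_le_norm k)

/-- Pointwise evaluation `(A, h) ↦ (k ↦ A k (h k))` of operator-valued continuous functions. -/
def pointwiseEval (E F : Type*) [NormedAddCommGroup E] [NormedSpace ℝ E]
    [NormedAddCommGroup F] [NormedSpace ℝ F] :
    C(K, E →L[ℝ] F) →L[ℝ] C(K, E) →L[ℝ] C(K, F) :=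
  pointwiseBilin (.id ℝ (E →L[ℝ] F))

lemma pointwiseEval_apply {E F : Type*} [NormedAddCommGroup E] [NormedSpace ℝ E]
    [NormedAddCommGroup F] [NormedSpace ℝ F] (A : C(K, E →L[ℝ] F)) (h : C(K, E)) (k : K) :
    pointwiseEval E F A h k = A k (h k) := rfl

/-- The remainder has to be small uniformly in k. This works because f' is uniformly close to its
values along the compact range of z, so one radius δ serves the mean value inequality at every z k.
-/
lemma hasFDerivAt_superposition {E F : Type*} [NormedAddCommGroup E] [NormedSpace ℝ E]
    [NormedAddCommGroup F] [NormedSpace ℝ F] (f : C(E, F)) (f' : C(E, E →L[ℝ] F))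
    (hf : ∀ x, HasFDerivAt f (f' x) x) (z : C(K, E)) :
    HasFDerivAt (superposition f) (pointwiseEval E F (superposition f' z)) z := by
  rw [hasFDerivAt_iff_isLittleO_nhds_zero, Asymptotics.isLittleO_iff]
  intro c hc
  -- Only one of the two points is confined to the compact range; the other is any point near it, so
  -- local compactness of E is not needed.
  have hu := (isCompact_range z.continuous).uniformContinuousAt_of_continuousAt f'
    (fun a _ ↦ f'.continuous.continuousAt) (Metric.dist_mem_uniformity hc)
  obtain ⟨δ, hδ, h⟩ := Metric.mem_uniformity_dist.1 hu
  filter_upwards [Metric.ball_mem_nhds (0 : C(K, E)) hδ] with w hw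
  rw [ContinuousMap.norm_le _ (by positivity)]
  intro k
  have hwk : ‖w k‖ ≤ ‖w‖ := w.norm_coe_le_norm k
  have hw' : ‖w‖ < δ := by simpa using hw
  have hmv := (convex_ball (z k) δ).norm_image_sub_le_of_norm_hasFDerivWithin_le'
    (f := f) (f' := f') (φ := f' (z k)) (C := c) (x := z k) (y := z k + w k)
    (fun x _ ↦ (hf x).hasFDerivWithinAt)
    (fun x hx ↦ by
      have := h (a := z k) (b := x) (by rwa [dist_comm]) (mem_range_self k)
      rw [← dist_eq_norm, dist_comm]
      exact le_of_lt this) (Metric.mem_ball_self hδ)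
    (by simpa using hwk.trans_lt hw')
  simp only [add_sub_cancel_left] at hmv
  simpa [pointwiseEval_apply] using hmv.trans (mul_le_mul_of_nonneg_left hwk hc.le)

-- The derivative of a superposition operator is again one, for f', followed by a continuous linear
-- map. The induction therefore changes the target from F to E →L[ℝ] F; keeping E and F in one
-- universe lets the induction hypothesis apply to it.
universe u in
lemma contDiff_superposition_nat {E : Type u} [NormedAddCommGroup E] [NormedSpace ℝ E] (n : ℕ) :
    ∀ {F : Type u} [NormedAddCommGroup F] [NormedSpace ℝ F] (f : C(E, F)),
      ContDiff ℝ ∞ f → ContDiff ℝ n (superposition (K := K) f) := by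
  induction n with
  | zero =>
    intro F _ _ f hf
    simp only [CharP.cast_eq_zero, contDiff_zero]
    exact ContinuousMap.continuous_postcomp f
  | succ n ih =>
    intro F _ _ f hf
    have hf' : ContDiff ℝ ∞ (fderiv ℝ f) := hf.fderiv_right (by simp)
    let f' : C(E, E →L[ℝ] F) := ⟨fderiv ℝ f, hf'.continuous⟩
    have hd := hasFDerivAt_superposition (K := K) f f'
      (fun x ↦ (hf.differentiable (by simp) x).hasFDerivAt)
    push_cast
    rw [contDiff_succ_iff_fderiv]
    refine ⟨fun z ↦ (hd z).differentiableAt, by simp, ?_⟩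
    rw [funext fun z ↦ (hd z).fderiv]
    exact (pointwiseEval E F).contDiff.comp (ih f' hf')

universe u in
lemma contDiff_superposition {E F : Type u} [NormedAddCommGroup E] [NormedSpace ℝ E]
    [NormedAddCommGroup F] [NormedSpace ℝ F] (f : C(E, F)) (hf : ContDiff ℝ ∞ f) :
    ContDiff ℝ ∞ (superposition (K := K) f) :=
  contDiff_infty.2 fun n ↦ contDiff_superposition_nat n f hf

end ContinuousMap

/-! ### Smoothness of implicit functions near a point -/

/-- `ContDiffAt ℝ ∞` at one point does not spread to a neighborhood, since the neighborhood may
shrink with the order. Instead, at each nearby x the theorem is applied afresh at (x, ψ x), where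
the partial derivative is still invertible. -/
lemma ContDiffAt.eventually_contDiffAt_implicitFunction
    {E₁ E₂ F : Type*} [NormedAddCommGroup E₁] [NormedSpace ℝ E₁] [CompleteSpace E₁]
    [NormedAddCommGroup E₂] [NormedSpace ℝ E₂] [CompleteSpace E₂]
    [NormedAddCommGroup F] [NormedSpace ℝ F] [CompleteSpace F]
    {f : E₁ × E₂ → F} (hf : ContDiff ℝ ∞ f) (u : E₁ × E₂)
    (hi : (fderiv ℝ f u ∘L .inr ℝ E₁ E₂).IsInvertible) :
    ∀ᶠ x in 𝓝 u.1, ContDiffAt ℝ ∞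
      ((hf.contDiffAt (x := u)).implicitFunction (by simp) hi) x := by
  have hnh : {A : E₂ →L[ℝ] F | A.IsInvertible} ∈ 𝓝 (fderiv ℝ f u ∘L .inr ℝ E₁ E₂) := by
    obtain ⟨e, he⟩ := id hi
    rw [← he]
    exact ContinuousLinearEquiv.nhds e
  set ψ := (hf.contDiffAt (x := u)).implicitFunction (by simp) hi with hψ
  have hψu : ψ u.1 = u.2 := (hf.contDiffAt (x := u)).implicitFunction_apply_self (by simp) hi
  have hψd : ContDiffAt ℝ ∞ ψ u.1 := (hf.contDiffAt (x := u)).contDiffAt_implicitFunction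
    (by simp) hi
  have h1 : ∀ᶠ x in 𝓝 u.1, ContDiffAt ℝ 1 ψ x :=
    (hψd.of_le (m := 1) (by simp)).eventually (by simp)
  have h2 : ∀ᶠ x in 𝓝 u.1, f (x, ψ x) = f u :=
    (hf.contDiffAt (x := u)).eventually_apply_implicitFunction (by simp) hi
  have h3 : ∀ᶠ x in 𝓝 u.1, (fderiv ℝ f (x, ψ x) ∘L .inr ℝ E₁ E₂).IsInvertible := by
    have hc : ContinuousAt (fun x ↦ fderiv ℝ f (x, ψ x) ∘L .inr ℝ E₁ E₂) u.1 := by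
      have hc1 : ContinuousAt (fun x ↦ fderiv ℝ f (x, ψ x)) u.1 :=
        (hf.continuous_fderiv (by simp)).continuousAt.comp
          (continuousAt_id.prodMk hψd.continuousAt)
      exact hc1.clm_comp continuousAt_const
    exact hc.eventually_mem (by simpa only [hψu, Prod.mk.eta] using hnh)
  filter_upwards [h1, h2, h3, h2.eventually_nhds] with x hx1 hx2 hx3 hx4
  -- By local uniqueness, the implicit function based at (x, ψ x) coincides with ψ near x.
  have hiff := (hf.contDiffAt (x := (x, ψ x))).eventually_apply_eq_iff_implicitFunction
    (by simp) hx3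
  have hx5 : ∀ᶠ y in 𝓝 x,
      (hf.contDiffAt (x := (x, ψ x))).implicitFunction (by simp) hx3 y = ψ y := by
    have ht : Tendsto (fun y ↦ (y, ψ y)) (𝓝 x) (𝓝 (x, ψ x)) :=
      continuousAt_id.prodMk hx1.continuousAt
    filter_upwards [ht.eventually hiff, hx4] with y hy1 hy2
    exact hy1.1 (hy2.trans hx2.symm)
  exact ((hf.contDiffAt (x := (x, ψ x))).contDiffAt_implicitFunction (by simp) hx3).congr_of_eventuallyEq
    (hx5.mono fun y hy ↦ hy.symm)

/-! ### Smooth dependence of solutions of differential equations on initial conditions -/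

namespace ODEFlow

variable {F : Type*} [NormedAddCommGroup F]

/-- The time interval `[-1, 1]`. -/
abbrev TimeInterval : Type := Icc (-1 : ℝ) 1

/-- Extension of a continuous curve on `[-1, 1]` to the real line. -/
def extend (z : C(TimeInterval, F)) (t : ℝ) : F := z (projIcc (-1) 1 (by norm_num) t)

lemma continuous_extend (z : C(TimeInterval, F)) : Continuous (extend z) :=
  z.continuous.comp continuous_projIcc

lemma extend_of_mem (z : C(TimeInterval, F)) {t : ℝ} (ht : t ∈ Icc (-1 : ℝ) 1) :
    extend z t = z ⟨t, ht⟩ := by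
  rw [extend, projIcc_of_mem _ ht]

lemma norm_extend_le (z : C(TimeInterval, F)) (t : ℝ) : ‖extend z t‖ ≤ ‖z‖ :=
  z.norm_coe_le_norm _

variable [NormedSpace ℝ F]

/-- Integration `z ↦ (t ↦ ∫ s in 0..t, z s)` of curves. -/
def integrate (F : Type*) [NormedAddCommGroup F] [NormedSpace ℝ F] :
    C(TimeInterval, F) →L[ℝ] C(TimeInterval, F) :=
  LinearMap.mkContinuous
    { toFun := fun z ↦ ⟨fun t ↦ ∫ s in (0 : ℝ)..t, extend z s,
        (intervalIntegral.continuous_primitive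
          (fun a b ↦ (continuous_extend z).intervalIntegrable a b) 0).comp continuous_subtype_val⟩
      map_add' := fun z w ↦ by
        ext t
        exact intervalIntegral.integral_add ((continuous_extend z).intervalIntegrable _ _)
          ((continuous_extend w).intervalIntegrable _ _)
      map_smul' := fun a z ↦ by
        ext t
        exact intervalIntegral.integral_smul a (extend z) }
    1 (fun z ↦ by
      rw [ContinuousMap.norm_le _ (by positivity)]
      intro t
      have h1 : |(t : ℝ) - 0| ≤ 1 := by
        rw [sub_zero, abs_le]; exact t.2
      have h := intervalIntegral.norm_integral_le_of_norm_le_const (a := 0) (b := (t : ℝ))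
        (f := extend z) (C := ‖z‖) (fun s _ ↦ norm_extend_le z s)
      calc _ ≤ ‖z‖ * |(t : ℝ) - 0| := h
        _ ≤ ‖z‖ * 1 := by gcongr
        _ = 1 * ‖z‖ := by ring)

/-- The map whose zeros `((ε, x), z)` are the solutions on `[-1, 1]` of `z' = ε f(z)`,
`z 0 = x`. -/
def residual (f : C(F, F)) (q : (ℝ × F) × C(TimeInterval, F)) : C(TimeInterval, F) :=
  q.2 - ContinuousMap.const _ q.1.2 - q.1.1 • integrate F (ContinuousMap.superposition f q.2)

lemma contDiff_residual (f : C(F, F)) (hf : ContDiff ℝ ∞ f) : ContDiff ℝ ∞ (residual f) := by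
  have h1 : ContDiff ℝ ∞ (fun q : (ℝ × F) × C(TimeInterval, F) ↦
      (ContinuousMap.const TimeInterval q.1.2 : C(TimeInterval, F))) :=
    (ContinuousLinearMap.const ℝ (M := F) TimeInterval).contDiff.comp (by fun_prop)
  have h2 : ContDiff ℝ ∞ (fun q : (ℝ × F) × C(TimeInterval, F) ↦
      integrate F (ContinuousMap.superposition f q.2)) :=
    (integrate F).contDiff.comp ((ContinuousMap.contDiff_superposition f hf).comp contDiff_snd)
  exact (contDiff_snd.sub h1).sub (contDiff_fst.fst.smul h2)

lemma residual_eq_zero_iff (f : C(F, F)) (ε : ℝ) (x : F) (z : C(TimeInterval, F)) :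
    residual f ((ε, x), z) = 0 ↔
      ∀ t : TimeInterval, z t = x + ε • ∫ s in (0 : ℝ)..t, f (extend z s) := by
  rw [ContinuousMap.ext_iff]
  refine forall_congr' fun t ↦ ?_
  have : integrate F (ContinuousMap.superposition f z) t = ∫ s in (0 : ℝ)..t, f (extend z s) := rfl
  simp only [residual, ContinuousMap.coe_sub, ContinuousMap.coe_smul, Pi.sub_apply,
    ContinuousMap.const_apply, Pi.smul_apply, this, ContinuousMap.coe_zero, Pi.zero_apply]
  rw [sub_sub, sub_eq_zero]

lemma hasDerivAt_extend_of_residual_eq_zero [CompleteSpace F] {f : C(F, F)} {ε : ℝ} {x : F}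
    {z : C(TimeInterval, F)} (h : residual f ((ε, x), z) = 0) {t : ℝ} (ht : t ∈ Ioo (-1 : ℝ) 1) :
    HasDerivAt (extend z) (ε • f (extend z t)) t := by
  rw [residual_eq_zero_iff] at h
  have hc : Continuous fun s ↦ f (extend z s) := f.continuous.comp (continuous_extend z)
  have h1 := ((intervalIntegral.integral_hasDerivAt_right (hc.intervalIntegrable 0 t)
    hc.stronglyMeasurable.stronglyMeasurableAtFilter hc.continuousAt).const_smul ε).const_add x
  refine h1.congr_of_eventuallyEq ?_
  filter_upwards [Icc_mem_nhds ht.1 ht.2] with s hs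
  rw [extend_of_mem z hs, h]
  rfl

/-- The reparametrized curve `t ↦ z (s t)`, for `|s| ≤ 1`. -/
def rescale (s : TimeInterval) (z : C(TimeInterval, F)) : C(TimeInterval, F) :=
  z.comp ⟨fun t ↦ ⟨(s : ℝ) * t, by
    have h := abs_le.1 (show |(s : ℝ) * t| ≤ 1 by
      rw [abs_mul]
      exact mul_le_one₀ (abs_le.2 s.2) (abs_nonneg _) (abs_le.2 t.2))
    exact h⟩, by fun_prop⟩

/-- Reparametrizing time by s turns a solution with speed factor ε into one with factor sε. This
allows the parameter ε to play the role of time. -/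
lemma residual_rescale {f : C(F, F)} {ε : ℝ} {x : F} {z : C(TimeInterval, F)}
    (h : residual f ((ε, x), z) = 0) (s : TimeInterval) :
    residual f (((s : ℝ) * ε, x), rescale s z) = 0 := by
  rw [residual_eq_zero_iff] at h ⊢
  intro t
  have hm : ∀ r ∈ Icc (-1 : ℝ) 1, (s : ℝ) * r ∈ Icc (-1 : ℝ) 1 := fun r hr ↦
    abs_le.1 (by
      rw [abs_mul]
      exact mul_le_one₀ (abs_le.2 s.2) (abs_nonneg _) (abs_le.2 hr))
  have h1 : rescale s z t = z ⟨(s : ℝ) * t, hm t t.2⟩ := rfl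
  rw [h1, h, mul_comm (s : ℝ) ε, mul_smul]
  congr 2
  have h2 := intervalIntegral.smul_integral_comp_mul_left (a := 0) (b := (t : ℝ))
    (fun r ↦ f (extend z r)) (s : ℝ)
  rw [mul_zero] at h2
  rw [← h2]
  congr 1
  refine intervalIntegral.integral_congr fun r hr ↦ ?_
  have hr' : r ∈ Icc (-1 : ℝ) 1 := by
    have h0 : (0 : ℝ) ∈ Icc (-1 : ℝ) 1 := by simp
    exact (ordConnected_Icc.uIcc_subset h0 t.2) hr
  rw [extend_of_mem z (hm r hr'), extend_of_mem _ hr']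
  rfl

universe u in
/-- Local flow of a smooth autonomous differential equation, smooth in time and initial value. -/
theorem exists_smooth_flow {F : Type u} [NormedAddCommGroup F] [NormedSpace ℝ F] [CompleteSpace F]
    {f : F → F} (hf : ContDiff ℝ ∞ f) (x₀ : F) :
    ∃ (δ : ℝ) (Z : ℝ × F → F), 0 < δ ∧
      (∀ t ∈ Ioo (-δ) δ, ∀ x ∈ Metric.ball x₀ δ, ContDiffAt ℝ ∞ Z (t, x) ∧
        HasDerivAt (fun s ↦ Z (s, x)) (f (Z (t, x))) t) ∧
      ∀ x ∈ Metric.ball x₀ δ, Z (0, x) = x := by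
  let f₀ : C(F, F) := ⟨f, hf.continuous⟩
  have hG := contDiff_residual f₀ hf
  let c₀ : C(TimeInterval, F) := ContinuousMap.const _ x₀
  let u : (ℝ × F) × C(TimeInterval, F) := ((0, x₀), c₀)
  have hu : residual f₀ u = 0 := by
    rw [residual_eq_zero_iff]; intro t; simp [c₀]
  -- At ε = 0 the nonlinear term disappears and the residual is z - c₀, hence the partial derivative
  -- in z is the identity.
  have hpart : fderiv ℝ (residual f₀) u ∘L .inr ℝ (ℝ × F) C(TimeInterval, F) = .id ℝ _ := by
    have h1 : HasFDerivAt (fun z : C(TimeInterval, F) ↦ residual f₀ ((0, x₀), z))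
        (fderiv ℝ (residual f₀) u ∘L .inr ℝ (ℝ × F) C(TimeInterval, F)) c₀ :=
      ((hG.differentiable (by simp) u).hasFDerivAt).comp c₀ (hasFDerivAt_prodMk_right (0, x₀) c₀)
    have h2 : HasFDerivAt (fun z : C(TimeInterval, F) ↦ residual f₀ ((0, x₀), z))
        (.id ℝ _) c₀ := by
      have : (fun z : C(TimeInterval, F) ↦ residual f₀ ((0, x₀), z)) = fun z ↦ z - c₀ := by
        funext z; simp [residual, c₀]
      rw [this]
      exact (hasFDerivAt_id c₀).sub_const c₀
    exact h1.unique h2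
  have hi : (fderiv ℝ (residual f₀) u ∘L .inr ℝ (ℝ × F) C(TimeInterval, F)).IsInvertible := by
    rw [hpart]; exact ⟨.refl ℝ _, rfl⟩
  have hGu := hG.contDiffAt (x := u)
  have hsm := ContDiffAt.eventually_contDiffAt_implicitFunction hG u hi
  have hsol := hGu.eventually_apply_implicitFunction (by simp) hi
  have hiff := hGu.eventually_apply_eq_iff_implicitFunction (by simp) hi
  have hself := hGu.implicitFunction_apply_self (by simp) hi
  set ψ := hGu.implicitFunction (by simp) hi with hψ
  obtain ⟨r, hr, hball⟩ := Metric.eventually_nhds_iff_ball.1 hiff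
  have hcont : Tendsto ψ (𝓝 u.1) (𝓝 c₀) := by
    have : ContinuousAt ψ u.1 := (hsm.self_of_nhds).continuousAt
    rwa [ContinuousAt, hself] at this
  have hclose := hcont.eventually (Metric.ball_mem_nhds c₀ hr)
  obtain ⟨d, hd, hev⟩ := Metric.eventually_nhds_iff_ball.1 (hsm.and (hsol.and hclose))
  let δ := min d r
  have hδ : 0 < δ := lt_min hd hr
  have hmem : ∀ t ∈ Ioo (-δ) δ, ∀ x ∈ Metric.ball x₀ δ, (t, x) ∈ Metric.ball u.1 δ := by
    intro t ht x hx
    rw [Metric.mem_ball, Prod.dist_eq, max_lt_iff]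
    exact ⟨by simpa [u, abs_lt] using ht, hx⟩
  have hmemd : ∀ t ∈ Ioo (-δ) δ, ∀ x ∈ Metric.ball x₀ δ, (t, x) ∈ Metric.ball u.1 d :=
    fun t ht x hx ↦ Metric.ball_subset_ball (min_le_left _ _) (hmem t ht x hx)
  have hzero : ∀ t ∈ Ioo (-δ) δ, ∀ x ∈ Metric.ball x₀ δ,
      residual f₀ ((t, x), ψ (t, x)) = 0 := fun t ht x hx ↦
    ((hev _ (hmemd t ht x hx)).2.1).trans hu
  -- Rescaling a curve does not increase its distance to the constant curve c₀, so the rescaled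
  -- solution stays in the ball where the implicit function is the only solution.
  have hscale : ∀ t ∈ Ioo (-δ) δ, ∀ x ∈ Metric.ball x₀ δ, ∀ s : TimeInterval,
      ψ ((s : ℝ) * t, x) = rescale s (ψ (t, x)) := by
    intro t ht x hx s
    have hst : (s : ℝ) * t ∈ Ioo (-δ) δ := by
      refine abs_lt.1 ?_
      calc |(s : ℝ) * t| ≤ 1 * |t| := by rw [abs_mul]; gcongr; exact abs_le.2 s.2
        _ < δ := by rw [one_mul]; exact abs_lt.2 ht
    have hb : (((s : ℝ) * t, x), rescale s (ψ (t, x))) ∈ Metric.ball u r := by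
      rw [Metric.mem_ball, Prod.dist_eq, max_lt_iff]
      refine ⟨lt_of_lt_of_le (hmem _ hst x hx) (min_le_right _ _), ?_⟩
      have hc := (hev _ (hmemd t ht x hx)).2.2
      refine lt_of_le_of_lt ?_ hc
      rw [ContinuousMap.dist_le dist_nonneg]
      intro k
      exact ContinuousMap.dist_apply_le_dist (f := ψ (t, x)) (g := c₀) _
    exact ((hball _ hb).1 ((residual_rescale (hzero t ht x hx) s).trans hu.symm))
  -- The solution of z' = t f(z), taken at time 1, is the solution of z' = f(z) at time t.
  -- Smoothness in the parameters thus includes smoothness in time.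
  let one : TimeInterval := ⟨1, by norm_num⟩
  have heval : ∀ t ∈ Ioo (-δ) δ, ∀ x ∈ Metric.ball x₀ δ, ∀ s ∈ Icc (-1 : ℝ) 1,
      ψ (s * t, x) one = extend (ψ (t, x)) s := by
    intro t ht x hx s hs
    rw [hscale t ht x hx ⟨s, hs⟩, extend_of_mem _ hs]
    simp only [rescale, ContinuousMap.comp_apply, ContinuousMap.coe_mk]
    congr 1
    ext
    simp [one]
  refine ⟨δ, fun q ↦ ψ q one, hδ, fun t ht x hx ↦ ⟨?_, ?_⟩, fun x hx ↦ ?_⟩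
  · exact (ContinuousMap.evalCLM ℝ one).contDiff.contDiffAt.comp _ (hev _ (hmemd t ht x hx)).1
  -- With |t| < τ < δ, the time t corresponds to the interior time t/τ of the single curve ψ(τ, x),
  -- where the integral equation can be differentiated.
  · obtain ⟨τ, hτ1, hτ2⟩ := exists_between (show |t| < δ from abs_lt.2 ht)
    have hτ : 0 < τ := (abs_nonneg t).trans_lt hτ1
    have hτm : τ ∈ Ioo (-δ) δ := ⟨by linarith, hτ2⟩
    have hm : t / τ ∈ Ioo (-1 : ℝ) 1 := by
      refine abs_lt.1 ?_
      rw [abs_div, abs_of_pos hτ, div_lt_one hτ]; exact hτ1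
    have h1 := hasDerivAt_extend_of_residual_eq_zero (hzero τ hτm x hx) hm
    have h2 : HasDerivAt (fun s ↦ extend (ψ (τ, x)) (s / τ)) _ t :=
      HasDerivAt.scomp (g₁ := extend (ψ (τ, x))) (h := fun s ↦ s / τ) t h1
        ((hasDerivAt_id t).div_const τ)
    have h3 : ∀ s, s / τ ∈ Icc (-1 : ℝ) 1 → ψ (s, x) one = extend (ψ (τ, x)) (s / τ) := by
      intro s hs
      rw [← heval τ hτm x hx _ hs, div_mul_cancel₀ _ hτ.ne']
    have h4 : (fun s ↦ ψ (s, x) one) =ᶠ[𝓝 t] fun s ↦ extend (ψ (τ, x)) (s / τ) := by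
      have : Tendsto (fun s ↦ s / τ) (𝓝 t) (𝓝 (t / τ)) := tendsto_id.div_const τ
      filter_upwards [this.eventually (Icc_mem_nhds hm.1 hm.2)] with s hs using h3 s hs
    refine (h2.congr_of_eventuallyEq h4).congr_deriv ?_
    change _ = f (ψ (t, x) one)
    rw [h3 t (Ioo_subset_Icc_self hm), smul_smul, one_div, inv_mul_cancel₀ hτ.ne', one_smul]
    rfl
  · have h := (residual_eq_zero_iff _ _ _ _).1 (hzero 0 ⟨by linarith, hδ⟩ x hx) one
    simpa using h

end ODEFlow

/-! ### Geodesics of a connection on an open subset of a vector space -/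

/-- To prove a property on a preconnected set of times, it suffices that it holds somewhere and is
both open and closed there. -/
lemma IsPreconnected.forall_of_eventually_of_frequently {J : Set ℝ} (hJ : IsPreconnected J)
    (hJo : IsOpen J)
    {P : ℝ → Prop} {t₀ : ℝ} (ht₀ : t₀ ∈ J) (h₀ : P t₀)
    (hopen : ∀ t ∈ J, P t → ∀ᶠ s in 𝓝 t, P s)
    (hclosed : ∀ t ∈ J, (∃ᶠ s in 𝓝 t, s ∈ J ∧ P s) → P t) : ∀ t ∈ J, P t := by
  let A : Set ℝ := {t | ∀ᶠ s in 𝓝 t, P s}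
  have hA : IsOpen A := isOpen_setOfPred_eventually_nhds
  have hsub : J ⊆ A := by
    refine hJ.subset_of_closure_inter_subset hA ⟨t₀, ht₀, hopen t₀ ht₀ h₀⟩ ?_
    rintro t ⟨htc, htJ⟩
    have hf : ∃ᶠ s in 𝓝 t, s ∈ A := mem_closure_iff_frequently.1 htc
    exact hopen t htJ (hclosed t htJ
      ((hf.and_eventually (hJo.mem_nhds htJ)).mono fun s hs ↦ ⟨hs.2, hs.1.self_of_nhds⟩))
  exact fun t ht ↦ (hsub ht).self_of_nhds

namespace LocalConnection

universe u
variable {E : Type u} [NormedAddCommGroup E] [NormedSpace ℝ E]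

/-- The geodesic spray `(x, u) ↦ (u, -Γ_x(u, u))` of the connection with Christoffel symbols `Γ`. -/
def spray (Γ : E → E →L[ℝ] E →L[ℝ] E) (z : E × E) : E × E := (z.2, -Γ z.1 z.2 z.2)

lemma contDiffAt_spray {Γ : E → E →L[ℝ] E →L[ℝ] E} {U : Set E} (hU : IsOpen U)
    (hΓ : ContDiffOn ℝ ∞ Γ U) {z : E × E} (hz : z.1 ∈ U) : ContDiffAt ℝ ∞ (spray Γ) z := by
  have h1 : ContDiffAt ℝ ∞ (fun z : E × E ↦ Γ z.1) z :=
    (hΓ.contDiffAt (hU.mem_nhds hz)).comp z contDiffAt_fst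
  exact contDiffAt_snd.prodMk ((h1.clm_apply contDiffAt_snd).clm_apply contDiffAt_snd).neg

/-- Two solutions of the geodesic equation that agree at some time agree nearby. -/
lemma spray_eventuallyEq {Γ : E → E →L[ℝ] E →L[ℝ] E} {U : Set E} (hU : IsOpen U)
    (hΓ : ContDiffOn ℝ ∞ Γ U) {Z₁ Z₂ : ℝ → E × E} {t : ℝ} (ht : (Z₁ t).1 ∈ U)
    (h₁ : ∀ᶠ s in 𝓝 t, HasDerivAt Z₁ (spray Γ (Z₁ s)) s)
    (h₂ : ∀ᶠ s in 𝓝 t, HasDerivAt Z₂ (spray Γ (Z₂ s)) s) (he : Z₁ t = Z₂ t) :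
    Z₁ =ᶠ[𝓝 t] Z₂ := by
  obtain ⟨K, s, hs, hK⟩ := ((contDiffAt_spray hU hΓ ht).of_le
    (m := 1) (by simp)).exists_lipschitzOnWith
  refine ODE_solution_unique_of_eventually (v := fun _ ↦ spray Γ) (s := fun _ ↦ s) (K := K)
    (Eventually.of_forall fun _ ↦ hK) ?_ ?_ he
  · exact h₁.and (h₁.self_of_nhds.continuousAt.eventually_mem hs)
  · exact h₂.and (h₂.self_of_nhds.continuousAt.eventually_mem (he ▸ hs))

/-- Uniqueness of geodesics with given initial position and velocity. -/
lemma spray_eqOn {Γ : E → E →L[ℝ] E →L[ℝ] E} {U : Set E} (hU : IsOpen U)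
    (hΓ : ContDiffOn ℝ ∞ Γ U) {Z₁ Z₂ : ℝ → E × E} {a b t₀ : ℝ}
    (ht₀ : t₀ ∈ Ioo a b) (hm : ∀ t ∈ Ioo a b, (Z₁ t).1 ∈ U)
    (h₁ : ∀ t ∈ Ioo a b, HasDerivAt Z₁ (spray Γ (Z₁ t)) t)
    (h₂ : ∀ t ∈ Ioo a b, HasDerivAt Z₂ (spray Γ (Z₂ t)) t) (he : Z₁ t₀ = Z₂ t₀) :
    ∀ t ∈ Ioo a b, Z₁ t = Z₂ t := by
  refine isPreconnected_Ioo.forall_of_eventually_of_frequently isOpen_Ioo ht₀ he (fun t ht hP ↦ ?_)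
    (fun t ht hf ↦ ?_)
  · have hn : ∀ᶠ s in 𝓝 t, s ∈ Ioo a b := isOpen_Ioo.mem_nhds ht
    exact spray_eventuallyEq hU hΓ (hm t ht) (hn.mono fun s hs ↦ h₁ s hs)
      (hn.mono fun s hs ↦ h₂ s hs) hP
  · by_contra hne
    have := ((h₁ t ht).continuousAt.prodMk (h₂ t ht).continuousAt).eventually
      (isOpen_ne_fun continuous_fst continuous_snd |>.mem_nhds hne)
    exact hf (this.mono fun s hs hs' ↦ hs hs'.2)

/-- `Z` is a smooth family of solutions of the geodesic equation on the time interval `(-2, 2)`: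
for `‖v‖ < δ`, `Z (t, v)` is the position and the velocity at time `t` of the geodesic that starts
at `p` with velocity `v`. -/
structure IsGeodesicFlow (U : Set E) (Γ : E → E →L[ℝ] E →L[ℝ] E) (p : E) (δ : ℝ)
    (Z : ℝ × E → E × E) : Prop where
  pos : 0 < δ
  mem : ∀ t ∈ Ioo (-2 : ℝ) 2, ∀ v ∈ Metric.ball (0 : E) δ, (Z (t, v)).1 ∈ U
  contDiffAt : ∀ t ∈ Ioo (-2 : ℝ) 2, ∀ v ∈ Metric.ball (0 : E) δ, ContDiffAt ℝ ∞ Z (t, v)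
  hasDerivAt : ∀ t ∈ Ioo (-2 : ℝ) 2, ∀ v ∈ Metric.ball (0 : E) δ,
    HasDerivAt (fun s ↦ Z (s, v)) (spray Γ (Z (t, v))) t
  init : ∀ v ∈ Metric.ball (0 : E) δ, Z (0, v) = (p, v)

theorem exists_isGeodesicFlow [FiniteDimensional ℝ E] {Γ : E → E →L[ℝ] E →L[ℝ] E} {U : Set E}
    (hU : IsOpen U) (hΓ : ContDiffOn ℝ ∞ Γ U) {p : E} (hp : p ∈ U) :
    ∃ δ Z, IsGeodesicFlow U Γ p δ Z := by
  have hV : IsOpen (Prod.fst ⁻¹' U : Set (E × E)) := hU.preimage continuous_fst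
  obtain ⟨R, hR, hRU⟩ := Metric.isOpen_iff.1 hV (p, 0) hp
  -- The closed ball of radius R/2 lies in the domain of Γ, so the cut-off spray is smooth
  -- everywhere. It agrees with the spray on the ball of radius R/4, where the flow is kept below.
  let χ : ContDiffBump ((p, 0) : E × E) := ⟨R / 4, R / 2, by linarith, by linarith⟩
  have hχs : tsupport χ ⊆ Prod.fst ⁻¹' U := by
    rw [χ.tsupport_eq]
    exact (Metric.closedBall_subset_ball (by simp only [χ]; linarith)).trans hRU
  let f : E × E → E × E := fun z ↦ χ z • spray Γ z
  have hf : ContDiff ℝ ∞ f := by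
    rw [contDiff_iff_contDiffAt]
    intro z
    by_cases hz : z ∈ tsupport χ
    · exact χ.contDiff.contDiffAt.smul (contDiffAt_spray hU hΓ (hχs hz))
    · have : f =ᶠ[𝓝 z] fun _ ↦ 0 := by
        filter_upwards [(isClosed_tsupport χ).isOpen_compl.mem_nhds hz] with w hw
        simp [f, image_eq_zero_of_notMem_tsupport hw]
      exact contDiffAt_const.congr_of_eventuallyEq this
  obtain ⟨δ₀, Z₀, hδ₀, hZ₀, hi₀⟩ := ODEFlow.exists_smooth_flow hf (p, 0)
  have hcont : ContinuousAt Z₀ (0, (p, 0)) :=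
    (hZ₀ 0 ⟨by linarith, hδ₀⟩ _ (Metric.mem_ball_self hδ₀)).1.continuousAt
  have hnear : ∀ᶠ q in 𝓝 ((0, (p, 0)) : ℝ × E × E), Z₀ q ∈ Metric.ball (p, 0) (R / 4) :=
    hcont.eventually_mem (by
      rw [hi₀ _ (Metric.mem_ball_self hδ₀)]
      exact Metric.ball_mem_nhds _ (by linarith))
  obtain ⟨r, hr, hball⟩ := Metric.eventually_nhds_iff_ball.1 hnear
  obtain ⟨d, hd, hd1, hd2⟩ : ∃ d, 0 < d ∧ d ≤ δ₀ ∧ d ≤ r :=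
    ⟨min δ₀ r, lt_min hδ₀ hr, min_le_left _ _, min_le_right _ _⟩
  -- Slowing time by ε = d/2 carries (-2, 2) into (-d, d). The initial velocity is divided by ε, and
  -- `S` multiplies the velocity by ε at the end; this gives geodesics again because the spray is
  -- quadratic in the velocity. The interval (-2, 2) leaves room around the times ±1.
  let ε := d / 2
  have hε : 0 < ε := by simp only [ε]; linarith
  let T : ℝ × E → ℝ × E × E := fun q ↦ (ε * q.1, (p, ε⁻¹ • q.2))
  have hT : ∀ t ∈ Ioo (-2 : ℝ) 2, ∀ v ∈ Metric.ball (0 : E) (ε * d),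
      ε * t ∈ Ioo (-d) d ∧ ((p, ε⁻¹ • v) : E × E) ∈ Metric.ball (p, 0) d := by
    intro t ht v hv
    refine ⟨⟨?_, ?_⟩, ?_⟩
    · have := mul_lt_mul_of_pos_left ht.1 hε
      simp only [ε] at *; linarith
    · have := mul_lt_mul_of_pos_left ht.2 hε
      simp only [ε] at *; linarith
    · rw [mem_ball_zero_iff] at hv
      rw [Metric.mem_ball, Prod.dist_eq, max_lt_iff]
      refine ⟨by simpa using hd, ?_⟩
      simp only [dist_zero_right, norm_smul, norm_inv, Real.norm_eq_abs, abs_of_pos hε]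
      rwa [inv_mul_lt_iff₀ hε]
  have hT2 : ∀ t ∈ Ioo (-2 : ℝ) 2, ∀ v ∈ Metric.ball (0 : E) (ε * d),
      Z₀ (T (t, v)) ∈ Metric.ball (p, 0) (R / 4) := by
    intro t ht v hv
    obtain ⟨h1, h2⟩ := hT t ht v hv
    refine hball _ ?_
    rw [Metric.mem_ball, Prod.dist_eq, max_lt_iff]
    refine ⟨?_, lt_of_lt_of_le h2 hd2⟩
    simp only [T, dist_zero_right, Real.norm_eq_abs]
    exact lt_of_lt_of_le (abs_lt.2 h1) hd2
  let S : E × E →L[ℝ] E × E :=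
    (ContinuousLinearMap.fst ℝ E E).prod (ε • ContinuousLinearMap.snd ℝ E E)
  have hsub : ∀ d', d' ≤ δ₀ → Ioo (-d') d' ⊆ Ioo (-δ₀) δ₀ := fun d' h ↦
    Ioo_subset_Ioo (by linarith) h
  refine ⟨ε * d, fun q ↦ S (Z₀ (T q)), by positivity, fun t ht v hv ↦ ?_, fun t ht v hv ↦ ?_,
    fun t ht v hv ↦ ?_, fun v hv ↦ ?_⟩
  · have h := hT2 t ht v hv
    have h5 := hRU (Metric.ball_subset_ball (show R / 4 ≤ R by linarith) h)
    exact h5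
  · obtain ⟨h1, h2⟩ := hT t ht v hv
    have hTs : ContDiff ℝ ∞ T := by fun_prop
    exact S.contDiff.contDiffAt.comp _
      (ContDiffAt.comp (f := T) (t, v) (hZ₀ _ (hsub d hd1 h1) _ (Metric.ball_subset_ball hd1 h2)).1
        hTs.contDiffAt)
  · obtain ⟨h1, h2⟩ := hT t ht v hv
    have h3 := (hZ₀ _ (hsub d hd1 h1) _ (Metric.ball_subset_ball hd1 h2)).2
    have h4 : HasDerivAt (fun s ↦ Z₀ (T (s, v))) (ε • f (Z₀ (T (t, v)))) t := by
      have h5 : HasDerivAt (fun s : ℝ ↦ ε * s) ε t := by simpa using (hasDerivAt_id t).const_mul ε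
      exact HasDerivAt.scomp (g₁ := fun s ↦ Z₀ (s, (p, ε⁻¹ • v))) (h := fun s ↦ ε * s) t h3 h5
    have h6 := S.hasFDerivAt.comp_hasDerivAt t h4
    refine h6.congr_deriv ?_
    have h7 : χ (Z₀ (T (t, v))) = 1 :=
      χ.one_of_mem_closedBall (Metric.ball_subset_closedBall (hT2 t ht v hv))
    simp [S, f, h7, spray, smul_smul]
  · have h1 := hi₀ (p, ε⁻¹ • v) (Metric.ball_subset_ball hd1 (hT 0 (by norm_num) v hv).2)
    simp only [T, mul_zero, h1]
    simp [S, smul_smul, hε.ne']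

namespace IsGeodesicFlow

variable {U : Set E} {Γ : E → E →L[ℝ] E →L[ℝ] E} {p : E} {δ : ℝ} {Z : ℝ × E → E × E}

lemma smul_mem_ball {v : E} (hv : v ∈ Metric.ball (0 : E) δ) {s : ℝ} (hs : |s| ≤ 1) :
    s • v ∈ Metric.ball (0 : E) δ := by
  rw [mem_ball_zero_iff] at hv ⊢
  rw [norm_smul, Real.norm_eq_abs]
  exact (mul_le_of_le_one_left (norm_nonneg v) hs).trans_lt hv

/-- Homogeneity: the geodesic with initial velocity `s v` is `t ↦ γ_v (s t)`. -/
lemma homogeneous (hZ : IsGeodesicFlow U Γ p δ Z) (hU : IsOpen U) (hΓ : ContDiffOn ℝ ∞ Γ U)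
    {v : E} (hv : v ∈ Metric.ball (0 : E) δ) {s : ℝ} (hs : |s| ≤ 1) {t : ℝ}
    (ht : t ∈ Ioo (-2 : ℝ) 2) :
    Z (t, s • v) = ((Z (s * t, v)).1, s • (Z (s * t, v)).2) := by
  have hst : ∀ t ∈ Ioo (-2 : ℝ) 2, s * t ∈ Ioo (-2 : ℝ) 2 := fun t ht ↦ abs_lt.1 (by
    rw [abs_mul]
    exact (mul_le_of_le_one_left (abs_nonneg t) hs).trans_lt (abs_lt.2 ht))
  -- Since Γ(u, u) is quadratic, (γ(st), s γ'(st)) solves the same equation; uniqueness then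
  -- compares the two curves.
  let S : E × E →L[ℝ] E × E :=
    (ContinuousLinearMap.fst ℝ E E).prod (s • ContinuousLinearMap.snd ℝ E E)
  refine spray_eqOn (Z₂ := fun t ↦ S (Z (s * t, v))) hU hΓ (by norm_num : (0 : ℝ) ∈ Ioo (-2 : ℝ) 2)
    (fun t ht ↦ hZ.mem t ht _ (smul_mem_ball hv hs))
    (fun t ht ↦ hZ.hasDerivAt t ht _ (smul_mem_ball hv hs)) (fun t ht ↦ ?_) ?_ t ht
  · have h1 := hZ.hasDerivAt (s * t) (hst t ht) v hv
    have h2 : HasDerivAt (fun t : ℝ ↦ s * t) s t := by simpa using (hasDerivAt_id t).const_mul s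
    have h3 := HasDerivAt.scomp (g₁ := fun t ↦ Z (t, v)) (h := fun t ↦ s * t) t h1 h2
    refine (S.hasFDerivAt.comp_hasDerivAt t h3).congr_deriv ?_
    simp [S, spray, smul_smul]
  · simp [S, hZ.init _ (smul_mem_ball hv hs), hZ.init _ hv]

/-- The exponential map in the chart. -/
lemma fst_neg_one (hZ : IsGeodesicFlow U Γ p δ Z) (hU : IsOpen U) (hΓ : ContDiffOn ℝ ∞ Γ U)
    {v : E} (hv : v ∈ Metric.ball (0 : E) δ) : (Z (-1, v)).1 = (Z (1, -v)).1 := by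
  have h := hZ.homogeneous hU hΓ hv (s := -1) (by norm_num) (t := 1) (by norm_num)
  rw [neg_one_smul] at h
  rw [h, mul_one]

/-- The derivative of the exponential map at the origin is the identity. -/
lemma hasFDerivAt_fst_one_zero (hZ : IsGeodesicFlow U Γ p δ Z) (hU : IsOpen U)
    (hΓ : ContDiffOn ℝ ∞ Γ U) :
    HasFDerivAt (fun v ↦ (Z (1, v)).1) (.id ℝ E) 0 := by
  have hd : DifferentiableAt ℝ (fun v ↦ (Z (1, v)).1) (0 : E) := by
    have h := (hZ.contDiffAt 1 (by norm_num) 0 (Metric.mem_ball_self hZ.pos)).differentiableAt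
      (by simp)
    have h' : DifferentiableAt ℝ (fun v : E ↦ ((1 : ℝ), v)) (0 : E) := by fun_prop
    exact (h.comp (0 : E) h').fst
  have key : ∀ v ∈ Metric.ball (0 : E) δ, fderiv ℝ (fun v ↦ (Z (1, v)).1) 0 v = v := by
    intro v hv
    have hs : HasDerivAt (fun s : ℝ ↦ s • v) v 0 := by
      simpa using (hasDerivAt_id (0 : ℝ)).smul_const v
    have h1 : HasDerivAt (fun s : ℝ ↦ (Z (1, s • v)).1)
        (fderiv ℝ (fun v ↦ (Z (1, v)).1) 0 v) 0 :=
      HasFDerivAt.comp_hasDerivAt_of_eq (f := fun s : ℝ ↦ s • v) 0 hd.hasFDerivAt hs (by simp)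
    have h2 := (hZ.hasDerivAt 0 (by norm_num) v hv).hasFDerivAt.fst.hasDerivAt
    -- By homogeneity exp(sv) = γ_v(s), whose derivative at s = 0 is v.
    have h3 : (fun s : ℝ ↦ (Z (1, s • v)).1) =ᶠ[𝓝 0] fun s ↦ (Z (s, v)).1 := by
      filter_upwards [Metric.closedBall_mem_nhds (0 : ℝ) one_pos] with s hs
      rw [hZ.homogeneous hU hΓ hv (by simpa using hs) (by norm_num), mul_one]
    have h4 := h1.unique (h2.congr_of_eventuallyEq h3)
    simpa [spray, hZ.init v hv] using h4
  -- The formula is known on a ball only; a general vector is scaled into it by a nonzero factor.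
  refine hd.hasFDerivAt.congr_fderiv ?_
  ext v
  obtain ⟨c, hc, hcv⟩ : ∃ c : ℝ, c ≠ 0 ∧ c • v ∈ Metric.ball (0 : E) δ := by
    refine ⟨δ / 2 / (‖v‖ + 1), ?_, ?_⟩
    · have := hZ.pos
      positivity
    · have h1 := hZ.pos
      rw [mem_ball_zero_iff, norm_smul, Real.norm_of_nonneg (by positivity), div_mul_eq_mul_div,
        div_lt_iff₀ (by positivity)]
      nlinarith [norm_nonneg v]
  have h := key _ hcv
  rw [map_smul] at h
  simpa using smul_right_injective E hc h

/-- The variation field of the geodesic flow in the direction `w` of the initial velocity,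
together with its time derivative. -/
def variation (Z : ℝ × E → E × E) (v w : E) (t : ℝ) : E × E := fderiv ℝ Z (t, v) (0, w)

/-- The linearized geodesic equation: the derivatives in t and in v commute by symmetry of the
second derivative of Z, and the time derivative of Z is the spray. -/
lemma hasDerivAt_variation (hZ : IsGeodesicFlow U Γ p δ Z) (hU : IsOpen U)
    (hΓ : ContDiffOn ℝ ∞ Γ U) {v : E} (hv : v ∈ Metric.ball (0 : E) δ) (w : E) {t : ℝ}
    (ht : t ∈ Ioo (-2 : ℝ) 2) :
    HasDerivAt (variation Z v w) (fderiv ℝ (spray Γ) (Z (t, v)) (variation Z v w t)) t := by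
  have hc := hZ.contDiffAt t ht v hv
  have hD : DifferentiableAt ℝ (fderiv ℝ Z) (t, v) :=
    (hc.fderiv_right (m := ∞) (by simp)).differentiableAt (by simp)
  have hline : HasDerivAt (fun s : ℝ ↦ (s, v)) ((1 : ℝ), (0 : E)) t :=
    (hasDerivAt_id t).prodMk (hasDerivAt_const t v)
  have h1 : HasDerivAt (fun s ↦ fderiv ℝ Z (s, v)) (fderiv ℝ (fderiv ℝ Z) (t, v) (1, 0)) t :=
    hD.hasFDerivAt.comp_hasDerivAt t hline
  have h2 : HasDerivAt (variation Z v w) (fderiv ℝ (fderiv ℝ Z) (t, v) (1, 0) (0, w)) t := by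
    have h := h1.clm_apply (hasDerivAt_const t ((0 : ℝ), w))
    rw [map_zero, add_zero] at h
    exact h
  refine h2.congr_deriv ?_
  have hsym : fderiv ℝ (fderiv ℝ Z) (t, v) (1, 0) (0, w) =
      fderiv ℝ (fderiv ℝ Z) (t, v) (0, w) (1, 0) :=
    (hc.isSymmSndFDerivAt (by
      rw [minSmoothness_of_isRCLikeNormedField]
      exact WithTop.coe_le_coe.2 le_top)) _ _
  rw [hsym]
  -- The flow equation holds on an open set of pairs (t, v), so it can be differentiated in v.
  have hev : (fun q ↦ fderiv ℝ Z q ((1 : ℝ), (0 : E))) =ᶠ[𝓝 (t, v)] fun q ↦ spray Γ (Z q) := by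
    have hn : Ioo (-2 : ℝ) 2 ×ˢ Metric.ball (0 : E) δ ∈ 𝓝 (t, v) :=
      (isOpen_Ioo.prod Metric.isOpen_ball).mem_nhds ⟨ht, hv⟩
    filter_upwards [hn] with q hq
    have hq1 : HasDerivAt (fun s : ℝ ↦ (s, q.2)) ((1 : ℝ), (0 : E)) q.1 :=
      (hasDerivAt_id q.1).prodMk (hasDerivAt_const q.1 q.2)
    have hq2 := ((hZ.contDiffAt q.1 hq.1 q.2 hq.2).differentiableAt
      (by simp)).hasFDerivAt.comp_hasDerivAt q.1 hq1
    exact hq2.unique (hZ.hasDerivAt q.1 hq.1 q.2 hq.2)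
  have h3 : HasFDerivAt (fun q ↦ fderiv ℝ Z q ((1 : ℝ), (0 : E)))
      ((ContinuousLinearMap.apply ℝ (E × E) ((1 : ℝ), (0 : E))).comp
        (fderiv ℝ (fderiv ℝ Z) (t, v))) (t, v) :=
    (ContinuousLinearMap.apply ℝ (E × E) ((1 : ℝ), (0 : E))).hasFDerivAt.comp _ hD.hasFDerivAt
  have h4 : HasFDerivAt (fun q ↦ spray Γ (Z q))
      ((fderiv ℝ (spray Γ) (Z (t, v))).comp (fderiv ℝ Z (t, v))) (t, v) :=
    (((contDiffAt_spray hU hΓ (hZ.mem t ht v hv)).differentiableAt (by simp)).hasFDerivAt).comp _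
      (hc.differentiableAt (by simp)).hasFDerivAt
  have h5 := h3.unique (h4.congr_of_eventuallyEq hev)
  exact congrArg (fun L : ℝ × E →L[ℝ] E × E ↦ L (0, w)) h5

lemma hasFDerivAt_slice (hZ : IsGeodesicFlow U Γ p δ Z) {v : E}
    (hv : v ∈ Metric.ball (0 : E) δ) {t : ℝ} (ht : t ∈ Ioo (-2 : ℝ) 2) :
    HasFDerivAt (fun v ↦ Z (t, v)) ((fderiv ℝ Z (t, v)).comp (.inr ℝ ℝ E)) v :=
  ((hZ.contDiffAt t ht v hv).differentiableAt (by simp)).hasFDerivAt.comp v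
    (hasFDerivAt_prodMk_right t v)

lemma variation_zero (hZ : IsGeodesicFlow U Γ p δ Z) {v : E}
    (hv : v ∈ Metric.ball (0 : E) δ) (w : E) : variation Z v w 0 = (0, w) := by
  have h1 := hZ.hasFDerivAt_slice hv (t := 0) (by norm_num)
  have h2 : HasFDerivAt (fun v ↦ Z (0, v)) (.inr ℝ E E) v := by
    refine (hasFDerivAt_prodMk_right p v).congr_of_eventuallyEq ?_
    filter_upwards [Metric.isOpen_ball.mem_nhds hv] with x hx using hZ.init x hx
  exact congrArg (fun L : E →L[ℝ] E × E ↦ L w) (h1.unique h2)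

lemma variation_one (hZ : IsGeodesicFlow U Γ p δ Z) {v : E}
    (hv : v ∈ Metric.ball (0 : E) δ) (w : E) :
    (variation Z v w 1).1 = fderiv ℝ (fun v ↦ (Z (1, v)).1) v w := by
  rw [(hZ.hasFDerivAt_slice hv (t := 1) (by norm_num)).fst.fderiv]
  rfl

/-- The sign comes from the chain rule applied to γ_v(-1) = γ_{-v}(1). -/
lemma variation_neg_one (hZ : IsGeodesicFlow U Γ p δ Z) (hU : IsOpen U)
    (hΓ : ContDiffOn ℝ ∞ Γ U) {v : E} (hv : v ∈ Metric.ball (0 : E) δ) (w : E) :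
    (variation Z v w (-1)).1 = -fderiv ℝ (fun v ↦ (Z (1, v)).1) (-v) w := by
  have hnv : -v ∈ Metric.ball (0 : E) δ := by simpa using hv
  have h1 := (hZ.hasFDerivAt_slice hv (t := -1) (by norm_num)).fst
  have h2 : HasFDerivAt (fun v ↦ (Z (-1, v)).1)
      ((fderiv ℝ (fun v ↦ (Z (1, v)).1) (-v)).comp (-.id ℝ E)) v := by
    have h3 := (hZ.hasFDerivAt_slice hnv (t := 1) (by norm_num)).fst.differentiableAt.hasFDerivAt
    refine (HasFDerivAt.comp (f := fun v : E ↦ -v) v h3 (hasFDerivAt_id v).neg).congr_of_eventuallyEq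
      ?_
    filter_upwards [Metric.isOpen_ball.mem_nhds hv] with x hx using hZ.fst_neg_one hU hΓ hx
  have h4 := congrArg (fun L : E →L[ℝ] E ↦ L w) (h1.unique h2)
  simpa [variation] using h4

end IsGeodesicFlow

end LocalConnection

/-! ### Linear algebra of tensors of Ricci type -/

namespace RicciTypeAlgebra

variable {E : Type*} [AddCommGroup E] [Module ℝ E]

/-- The dimension hypothesis is needed for this: it provides nonzero vectors orthogonal to two given
ones. -/
lemma exists_ne_zero_of_two_functionals [FiniteDimensional ℝ E] (hdim : 4 ≤ Module.finrank ℝ E) (f g : E →ₗ[ℝ] ℝ) :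
    ∃ z : E, z ≠ 0 ∧ f z = 0 ∧ g z = 0 := by
  have h : LinearMap.ker (f.prod g) ≠ ⊥ := by
    refine LinearMap.ker_ne_bot_of_finrank_lt ?_
    simp only [Module.finrank_prod, Module.finrank_self]
    omega
  obtain ⟨z, hz, hz0⟩ := Submodule.exists_mem_ne_zero_of_ne_bot h
  rw [LinearMap.mem_ker, LinearMap.prod_apply] at hz
  exact ⟨z, hz0, congrArg Prod.fst hz, congrArg Prod.snd hz⟩

variable {σ : E →ₗ[ℝ] E →ₗ[ℝ] ℝ}

lemma exists_pairing_eq_one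
    (hnd : ∀ v, (∀ w, σ v w = 0) → v = 0)
    {v : E} (hv : v ≠ 0) : ∃ w, σ v w = 1 := by
  by_contra! h
  refine hv (hnd v fun w ↦ ?_)
  by_contra hw
  exact h ((σ v w)⁻¹ • w) (by simp [hw])

/-- Nondegeneracy turns the independence of x from v into that of the functionals σ x and σ v, so σ
x cannot vanish on the kernel of σ v. -/
lemma exists_pairing_eq_one_of_forall_ne
    (hnd : ∀ v, (∀ w, σ v w = 0) → v = 0)
    {v x : E} (hx : ∀ k : ℝ, x ≠ k • v) :
    ∃ y, σ v y = 0 ∧ σ x y = 1 := by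
  have hv : ¬ ∃ k : ℝ, σ x = k • σ v := by
    rintro ⟨k, hk⟩
    refine hx k (sub_eq_zero.1 (hnd _ fun w ↦ ?_))
    simp [hk]
  have hex : ∃ y, σ v y = 0 ∧ σ x y ≠ 0 := by
    by_contra! h
    refine hv ?_
    by_cases hv0 : v = 0
    · refine ⟨0, ?_⟩
      ext y
      simpa using h y (by simp [hv0])
    · obtain ⟨w, hw⟩ := exists_pairing_eq_one hnd hv0
      refine ⟨σ x w, ?_⟩
      ext y
      have := h (y - σ v y • w) (by simp [hw])
      simp only [map_sub, map_smul, smul_eq_mul] at this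
      simp only [LinearMap.smul_apply, smul_eq_mul]
      linarith
  obtain ⟨y, hy, hxy⟩ := hex
  exact ⟨(σ x y)⁻¹ • y, by simp [hy], by simp [hxy]⟩

lemma pairing_swap
    (halt : ∀ v, σ v v = 0)
    (v w : E) : σ v w = -σ w v := by
  have := halt (v + w)
  simp only [map_add, LinearMap.add_apply, halt] at this
  linarith

lemma exists_orthogonal_not_mem_span [FiniteDimensional ℝ E]
    (halt : ∀ v, σ v v = 0) (hnd : ∀ v, (∀ w, σ v w = 0) → v = 0)
    (hdim : 4 ≤ Module.finrank ℝ E) {v : E} (hv : v ≠ 0) :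
    ∃ x, σ v x = 0 ∧ ∀ k : ℝ, x ≠ k • v := by
  obtain ⟨y, hy⟩ := exists_pairing_eq_one hnd hv
  -- Orthogonality to y, where σ v y = 1, excludes the nonzero multiples of v.
  obtain ⟨z, hz, h1, h2⟩ := exists_ne_zero_of_two_functionals hdim (σ v) (σ y)
  refine ⟨z, h1, ?_⟩
  rintro k rfl
  rw [map_smul, pairing_swap halt, hy] at h2
  have : k = 0 := by simpa using h2
  exact hz (by simp [this])

/-- A bilinear form whose tensor of Ricci type satisfies the first Bianchi identity is symmetric. -/
lemma symm_of_firstBianchi [FiniteDimensional ℝ E]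
    (halt : ∀ v, σ v v = 0) (hnd : ∀ v, (∀ w, σ v w = 0) → v = 0)
    (hdim : 4 ≤ Module.finrank ℝ E) {r : E → E → ℝ}
    (h : ∀ u v w z, σ u z * (r v w - r w v) + σ v z * (r w u - r u w)
      + σ w z * (r u v - r v u) = 0) (v w : E) : r v w = r w v := by
  obtain ⟨z, hz, h1, h2⟩ := exists_ne_zero_of_two_functionals hdim (σ v) (σ w)
  obtain ⟨u, hu⟩ := exists_pairing_eq_one hnd hz
  have := h u v w z
  rw [h1, h2, pairing_swap halt, hu] at this
  linarith

/-- The second Bianchi identity for a curvature tensor of Ricci type: the covariant derivative `N`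
of the Ricci tensor satisfies `N v v t = 0` whenever `σ v t = 0`. -/
lemma eq_zero_of_secondBianchi [FiniteDimensional ℝ E]
    (halt : ∀ v, σ v v = 0) (hnd : ∀ v, (∀ w, σ v w = 0) → v = 0)
    (hdim : 4 ≤ Module.finrank ℝ E) {N : E → E → E → ℝ}
    (hsymm : ∀ x v w, N x v w = N x w v) (hsmul : ∀ (k : ℝ) x v w, N x v (k • w) = k * N x v w)
    (h : ∀ x y z w t,
      2 * (σ y z * N x w t + σ z x * N y w t + σ x y * N z w t)
        + (σ y w * N x z t + σ z w * N y x t + σ x w * N z y t)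
        + (σ y t * N x z w + σ z t * N y x w + σ x t * N z y w)
        - (σ z w * N x y t + σ x w * N y z t + σ y w * N z x t)
        - (σ z t * N x y w + σ x t * N y z w + σ y t * N z x w) = 0)
    {v t : E} (hvt : σ v t = 0) : N v v t = 0 := by
  have hsw := pairing_swap halt
  by_cases hv : v = 0
  · have h0 : σ t v = 0 := by rw [hsw, hvt, neg_zero]
    subst hv
    rw [hsymm]
    simpa using hsmul 0 0 t 0
  -- Take x, y orthogonal to v with σ x y = 1: of the identity at (x, y, v, v, v) only 2 N v v v
  -- remains.
  have hvvv : N v v v = 0 := by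
    obtain ⟨x, hx, hxv⟩ := exists_orthogonal_not_mem_span halt hnd hdim hv
    obtain ⟨y, hy, hxy⟩ := exists_pairing_eq_one_of_forall_ne hnd hxv
    have := h x y v v v
    have h1 : σ x v = 0 := by rw [hsw, hx, neg_zero]
    have h2 : σ y v = 0 := by rw [hsw, hy, neg_zero]
    simp only [h1, h2, hx, hxy, halt] at this
    linarith
  by_cases ht : ∃ k : ℝ, t = k • v
  · obtain ⟨k, rfl⟩ := ht
    rw [hsmul, hvvv, mul_zero]
  push Not at ht
  have htv : σ t v = 0 := by rw [hsw, hvt, neg_zero]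
  -- The identity at (t, y, v, v, v), with y dual to v.
  have h1 : 2 * N t v v = N v v t := by
    obtain ⟨y, hy⟩ := exists_pairing_eq_one hnd hv
    have hyv : σ y v = -1 := by rw [hsw, hy]
    have := h t y v v v
    have e1 := hsymm v t v
    simp only [hvt, htv, hyv, halt, hvvv] at this
    linarith
  -- The identity at (x, t, v, v, t), with x orthogonal to v and dual to t. Combined with `h1` it
  -- gives N v v t = 6 N v v t.
  have h2 : 3 * N v v t = N t v v := by
    obtain ⟨x, hx, hxt⟩ := exists_pairing_eq_one_of_forall_ne hnd ht
    have hxv : σ x v = 0 := by rw [hsw, hx, neg_zero]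
    have htx := hsw x t
    have := h x t v v t
    have e1 := hsymm v t v
    simp only [hvt, htv, hx, hxv, htx, hxt, halt] at this
    linarith
  linarith

end RicciTypeAlgebra

/-! ### Bianchi identities and the covariant derivative of the Ricci tensor -/

namespace LocalConnection

universe u
variable {E : Type u} [NormedAddCommGroup E] [NormedSpace ℝ E]

/-- The curvature `R_x(u, v) w` of the connection with Christoffel symbols `Γ`. -/
def curv (Γ : E → E →L[ℝ] E →L[ℝ] E) (x u v w : E) : E :=
  fderiv ℝ Γ x u v w - fderiv ℝ Γ x v u w + Γ x u (Γ x v w) - Γ x v (Γ x u w)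

/-- The covariant derivative of a field of bilinear forms. -/
def covForm (Γ : E → E →L[ℝ] E →L[ℝ] E) (r : E → E →L[ℝ] E →L[ℝ] ℝ) (x a u v : E) : ℝ :=
  fderiv ℝ r x a u v - r x (Γ x a u) v - r x u (Γ x a v)

/-- The tensor of Ricci type determined by a form `σ` and a symmetric form `r`. -/
def ricciTensor (σ r : E →L[ℝ] E →L[ℝ] ℝ) (u v w z : E) : ℝ :=
  2 * σ u v * r w z + σ u w * r v z + σ u z * r v w - σ v w * r u z - σ v z * r u w

/-- A torsion-free connection on an open set that preserves a nondegenerate alternating form and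
has curvature of Ricci type. -/
structure IsRicciTypeOn (U : Set E) (Γ : E → E →L[ℝ] E →L[ℝ] E) (σ r : E → E →L[ℝ] E →L[ℝ] ℝ)
    (c : ℝ) : Prop where
  isOpen : IsOpen U
  contDiffOn : ContDiffOn ℝ ∞ Γ U
  symm : ∀ x ∈ U, ∀ u v, Γ x u v = Γ x v u
  differentiableOn_form : DifferentiableOn ℝ σ U
  differentiableOn_ricci : DifferentiableOn ℝ r U
  parallel : ∀ x ∈ U, ∀ a u v, fderiv ℝ σ x a u v = σ x (Γ x a u) v + σ x u (Γ x a v)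
  alternating : ∀ x ∈ U, ∀ v, σ x v v = 0
  nondegenerate : ∀ x ∈ U, ∀ v, (∀ w, σ x v w = 0) → v = 0
  ne_zero : c ≠ 0
  ricci : ∀ x ∈ U, ∀ u v w z, σ x (curv Γ x u v w) z = -c * ricciTensor (σ x) (r x) u v w z

lemma curv_cyclic {Γ : E → E →L[ℝ] E →L[ℝ] E} {x : E} (hs : ∀ u v, Γ x u v = Γ x v u)
    (hds : ∀ a u v, fderiv ℝ Γ x a u v = fderiv ℝ Γ x a v u) (u v w : E) :
    curv Γ x u v w + curv Γ x v w u + curv Γ x w u v = 0 := by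
  simp only [curv]
  rw [hds u v w, hds v w u, hds w u v, hs v w, hs w u, hs u v]
  abel

/-- The second Bianchi identity. -/
lemma secondBianchi {G : E →L[ℝ] E →L[ℝ] E} {D : E →L[ℝ] E →L[ℝ] E →L[ℝ] E}
    {D2 : E →L[ℝ] E →L[ℝ] E →L[ℝ] E →L[ℝ] E} (hs : ∀ u v, G u v = G v u)
    (hs2 : ∀ u v, D2 u v = D2 v u)
    {R : E → E → E → E} (hR : ∀ u v w, R u v w = D u v w - D v u w + G u (G v w) - G v (G u w))
    {B : E → E → E → E → E} (hB : ∀ a u v w, B a u v w =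
      D2 a u v w - D2 a v u w + (D a u (G v w) + G u (D a v w))
        - (D a v (G u w) + G v (D a u w))
        + G a (R u v w) - R (G a u) v w - R u (G a v) w - R u v (G a w)) (a u v w : E) :
    B a u v w + B u v a w + B v a u w = 0 := by
  simp only [hB, hR]
  rw [hs u a, hs v a, hs v u, hs2 u a, hs2 v a, hs2 v u]
  simp only [map_add, map_sub]
  abel

namespace IsRicciTypeOn

variable {U : Set E} {Γ : E → E →L[ℝ] E →L[ℝ] E} {σ r : E → E →L[ℝ] E →L[ℝ] ℝ} {c : ℝ}

lemma contDiffAt (h : IsRicciTypeOn U Γ σ r c) {x : E} (hx : x ∈ U) : ContDiffAt ℝ ∞ Γ x :=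
  h.contDiffOn.contDiffAt (h.isOpen.mem_nhds hx)

lemma hasFDerivAt (h : IsRicciTypeOn U Γ σ r c) {x : E} (hx : x ∈ U) :
    HasFDerivAt Γ (fderiv ℝ Γ x) x :=
  ((h.contDiffAt hx).differentiableAt (by simp)).hasFDerivAt

lemma hasFDerivAt_form (h : IsRicciTypeOn U Γ σ r c) {x : E} (hx : x ∈ U) :
    HasFDerivAt σ (fderiv ℝ σ x) x :=
  (h.differentiableOn_form.differentiableAt (h.isOpen.mem_nhds hx)).hasFDerivAt

lemma hasFDerivAt_ricci (h : IsRicciTypeOn U Γ σ r c) {x : E} (hx : x ∈ U) :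
    HasFDerivAt r (fderiv ℝ r x) x :=
  (h.differentiableOn_ricci.differentiableAt (h.isOpen.mem_nhds hx)).hasFDerivAt

lemma form_swap (h : IsRicciTypeOn U Γ σ r c) {x : E} (hx : x ∈ U) (u v : E) :
    σ x u v = -σ x v u := by
  have := h.alternating x hx (u + v)
  simp only [map_add, add_apply, h.alternating x hx] at this
  linarith

lemma fderiv_symm (h : IsRicciTypeOn U Γ σ r c) {x : E} (hx : x ∈ U) (a u v : E) :
    fderiv ℝ Γ x a u v = fderiv ℝ Γ x a v u := by
  have h1 : ∀ u v, HasFDerivAt (fun y ↦ Γ y u v)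
      ((ContinuousLinearMap.apply ℝ E v).comp ((ContinuousLinearMap.apply ℝ (E →L[ℝ] E) u).comp
        (fderiv ℝ Γ x))) x := fun u v ↦
    (ContinuousLinearMap.apply ℝ E v).hasFDerivAt.comp x
      ((ContinuousLinearMap.apply ℝ (E →L[ℝ] E) u).hasFDerivAt.comp x (h.hasFDerivAt hx))
  have h2 : (fun y ↦ Γ y u v) =ᶠ[𝓝 x] fun y ↦ Γ y v u := by
    filter_upwards [h.isOpen.mem_nhds hx] with y hy using h.symm y hy u v
  exact congrArg (fun L : E →L[ℝ] E ↦ L a) ((h1 u v).unique ((h1 v u).congr_of_eventuallyEq h2))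

lemma ricci_symm [FiniteDimensional ℝ E] (h : IsRicciTypeOn U Γ σ r c) (hdim : 4 ≤ Module.finrank ℝ E) {x : E}
    (hx : x ∈ U) (u v : E) : r x u v = r x v u := by
  let τ : E →ₗ[ℝ] E →ₗ[ℝ] ℝ := (σ x).toLinearMap₁₂
  refine RicciTypeAlgebra.symm_of_firstBianchi (σ := τ) (h.alternating x hx)
    (h.nondegenerate x hx) hdim (r := fun u v ↦ r x u v) (fun u v w z ↦ ?_) u v
  change σ x u z * (r x v w - r x w v) + σ x v z * (r x w u - r x u w)
      + σ x w z * (r x u v - r x v u) = 0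
  have h1 := congrArg (fun y ↦ σ x y z) (curv_cyclic (h.symm x hx) (h.fderiv_symm hx) u v w)
  simp only [map_add, add_apply, h.ricci x hx, ricciTensor, map_zero, zero_apply] at h1
  rw [h.form_swap hx w u, h.form_swap hx v u, h.form_swap hx w v] at h1
  have h2 := h.ne_zero
  refine mul_left_cancel₀ h2 ?_
  linear_combination -h1

lemma covForm_symm [FiniteDimensional ℝ E] (h : IsRicciTypeOn U Γ σ r c) (hdim : 4 ≤ Module.finrank ℝ E) {x : E}
    (hx : x ∈ U) (a u v : E) : covForm Γ r x a u v = covForm Γ r x a v u := by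
  have h1 : ∀ u v, HasFDerivAt (fun y ↦ r y u v)
      ((ContinuousLinearMap.apply ℝ ℝ v).comp ((ContinuousLinearMap.apply ℝ (E →L[ℝ] ℝ) u).comp
        (fderiv ℝ r x))) x := fun u v ↦
    (ContinuousLinearMap.apply ℝ ℝ v).hasFDerivAt.comp x
      ((ContinuousLinearMap.apply ℝ (E →L[ℝ] ℝ) u).hasFDerivAt.comp x (h.hasFDerivAt_ricci hx))
  have h2 : (fun y ↦ r y u v) =ᶠ[𝓝 x] fun y ↦ r y v u := by
    filter_upwards [h.isOpen.mem_nhds hx] with y hy using h.ricci_symm hdim hy u v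
  have h3 : fderiv ℝ r x a u v = fderiv ℝ r x a v u :=
    congrArg (fun L : E →L[ℝ] ℝ ↦ L a) ((h1 u v).unique ((h1 v u).congr_of_eventuallyEq h2))
  simp only [covForm]
  rw [h3, h.ricci_symm hdim hx (Γ x a u) v, h.ricci_symm hdim hx u (Γ x a v)]
  ring

/-- The derivative of the curvature tensor along a line. -/
lemma hasDerivAt_curv (h : IsRicciTypeOn U Γ σ r c) {x : E} (hx : x ∈ U) (a u v w : E) :
    HasDerivAt (fun s : ℝ ↦ curv Γ (x + s • a) u v w)
      (fderiv ℝ (fderiv ℝ Γ) x a u v w - fderiv ℝ (fderiv ℝ Γ) x a v u w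
        + (fderiv ℝ Γ x a u (Γ x v w) + Γ x u (fderiv ℝ Γ x a v w))
        - (fderiv ℝ Γ x a v (Γ x u w) + Γ x v (fderiv ℝ Γ x a u w))) 0 := by
  have hl : HasDerivAt (fun s : ℝ ↦ x + s • a) a 0 := by
    simpa using ((hasDerivAt_id (0 : ℝ)).smul_const a).const_add x
  have hΓ : HasDerivAt (fun s : ℝ ↦ Γ (x + s • a)) (fderiv ℝ Γ x a) 0 :=
    (h.hasFDerivAt hx).comp_hasDerivAt_of_eq 0 hl (by simp)
  have hD : HasDerivAt (fun s : ℝ ↦ fderiv ℝ Γ (x + s • a)) (fderiv ℝ (fderiv ℝ Γ) x a) 0 :=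
    ((((h.contDiffAt hx).fderiv_right (m := ∞) (by simp)).differentiableAt
      (by simp)).hasFDerivAt).comp_hasDerivAt_of_eq 0 hl (by simp)
  have hc : ∀ e : E, HasDerivAt (fun _ : ℝ ↦ e) 0 0 := fun e ↦ hasDerivAt_const 0 e
  have hGG : ∀ u v, HasDerivAt (fun s : ℝ ↦ Γ (x + s • a) u (Γ (x + s • a) v w))
      (fderiv ℝ Γ x a u (Γ x v w) + Γ x u (fderiv ℝ Γ x a v w)) 0 := by
    intro u v
    have := (hΓ.clm_apply (hc u)).clm_apply ((hΓ.clm_apply (hc v)).clm_apply (hc w))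
    simpa using this
  have hDD : ∀ u v, HasDerivAt (fun s : ℝ ↦ fderiv ℝ Γ (x + s • a) u v w)
      (fderiv ℝ (fderiv ℝ Γ) x a u v w) 0 := by
    intro u v
    have := ((hD.clm_apply (hc u)).clm_apply (hc v)).clm_apply (hc w)
    simpa using this
  exact (((hDD u v).sub (hDD v u)).add (hGG u v)).sub (hGG v u)

/-- The covariant derivative of the curvature is determined by that of the Ricci tensor. -/
lemma form_cov_curv (h : IsRicciTypeOn U Γ σ r c) {x : E} (hx : x ∈ U) (a u v w z : E) :
    σ x (fderiv ℝ (fderiv ℝ Γ) x a u v w - fderiv ℝ (fderiv ℝ Γ) x a v u w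
        + (fderiv ℝ Γ x a u (Γ x v w) + Γ x u (fderiv ℝ Γ x a v w))
        - (fderiv ℝ Γ x a v (Γ x u w) + Γ x v (fderiv ℝ Γ x a u w))
        + Γ x a (curv Γ x u v w) - curv Γ x (Γ x a u) v w - curv Γ x u (Γ x a v) w
        - curv Γ x u v (Γ x a w)) z =
      -c * (2 * σ x u v * covForm Γ r x a w z + σ x u w * covForm Γ r x a v z
        + σ x u z * covForm Γ r x a v w - σ x v w * covForm Γ r x a u z
        - σ x v z * covForm Γ r x a u w) := by
  have hl : HasDerivAt (fun s : ℝ ↦ x + s • a) a 0 := by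
    simpa using ((hasDerivAt_id (0 : ℝ)).smul_const a).const_add x
  have hσ : HasDerivAt (fun s : ℝ ↦ σ (x + s • a)) (fderiv ℝ σ x a) 0 :=
    (h.hasFDerivAt_form hx).comp_hasDerivAt_of_eq 0 hl (by simp)
  have hr : HasDerivAt (fun s : ℝ ↦ r (x + s • a)) (fderiv ℝ r x a) 0 :=
    (h.hasFDerivAt_ricci hx).comp_hasDerivAt_of_eq 0 hl (by simp)
  have hc : ∀ e : E, HasDerivAt (fun _ : ℝ ↦ e) 0 0 := fun e ↦ hasDerivAt_const 0 e
  have hσe : ∀ u v, HasDerivAt (fun s : ℝ ↦ σ (x + s • a) u v) (fderiv ℝ σ x a u v) 0 := by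
    intro u v
    simpa using (hσ.clm_apply (hc u)).clm_apply (hc v)
  have hre : ∀ u v, HasDerivAt (fun s : ℝ ↦ r (x + s • a) u v) (fderiv ℝ r x a u v) 0 := by
    intro u v
    simpa using (hr.clm_apply (hc u)).clm_apply (hc v)
  have hL := (hσ.clm_apply (h.hasDerivAt_curv hx a u v w)).clm_apply (hc z)
  have hT := (((((((hσe u v).const_mul 2).mul (hre w z)).add ((hσe u w).mul (hre v z))).add
    ((hσe u z).mul (hre v w))).sub ((hσe v w).mul (hre u z))).sub
    ((hσe v z).mul (hre u w))).const_mul (-c)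
  have hev : (fun s : ℝ ↦ σ (x + s • a) (curv Γ (x + s • a) u v w) z) =ᶠ[𝓝 0]
      fun s ↦ -c * ricciTensor (σ (x + s • a)) (r (x + s • a)) u v w z := by
    have : ∀ᶠ s in 𝓝 (0 : ℝ), x + s • a ∈ U :=
      hl.continuousAt.eventually_mem (by simpa using h.isOpen.mem_nhds hx)
    filter_upwards [this] with s hs using h.ricci _ hs u v w z
  have heq := hL.unique (hT.congr_of_eventuallyEq hev)
  simp only [zero_smul, add_zero, map_zero, add_apply] at heq
  have p := h.parallel x hx a
  have q := h.ricci x hx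
  have q1 := q (Γ x a u) v w z
  have q2 := q u (Γ x a v) w z
  have q3 := q u v (Γ x a w) z
  have q4 := q u v w (Γ x a z)
  rw [p (curv Γ x u v w) z] at heq
  simp only [p] at heq
  simp only [ricciTensor] at q1 q2 q3 q4
  rw [map_sub, map_sub, map_sub, map_add]
  simp only [sub_apply, add_apply]
  rw [q1, q2, q3]
  simp only [covForm]
  -- `heq` is the Ricci-type identity differentiated along x + s a, with the derivative of σ
  -- rewritten by parallelism. `q1` to `q3` move the connection terms of the first three arguments
  -- of the curvature; `q4` accounts for the one in the argument z.
  linear_combination heq - q4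

/-- Pairing the second Bianchi identity with z and substituting `form_cov_curv` produces the
hypothesis of `eq_zero_of_secondBianchi` up to the factor -c, which is nonzero. -/
lemma covForm_eq_zero [FiniteDimensional ℝ E] (h : IsRicciTypeOn U Γ σ r c) (hdim : 4 ≤ Module.finrank ℝ E) {x : E}
    (hx : x ∈ U) {v t : E} (hvt : σ x v t = 0) : covForm Γ r x v v t = 0 := by
  let τ : E →ₗ[ℝ] E →ₗ[ℝ] ℝ := (σ x).toLinearMap₁₂
  refine RicciTypeAlgebra.eq_zero_of_secondBianchi (σ := τ) (h.alternating x hx)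
    (h.nondegenerate x hx) hdim (N := covForm Γ r x) (h.covForm_symm hdim hx)
    (fun k a u v ↦ ?_) (fun a u v w z ↦ ?_) hvt
  · simp only [covForm, map_smul, smul_eq_mul]; ring
  · have hs2 : ∀ u v, fderiv ℝ (fderiv ℝ Γ) x u v = fderiv ℝ (fderiv ℝ Γ) x v u :=
      fun u v ↦ ((h.contDiffAt hx).isSymmSndFDerivAt (by
        rw [minSmoothness_of_isRCLikeNormedField]
        exact WithTop.coe_le_coe.2 le_top)) u v
    have hB := secondBianchi (G := Γ x) (D := fderiv ℝ Γ x) (D2 := fderiv ℝ (fderiv ℝ Γ) x)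
      (h.symm x hx) hs2 (R := curv Γ x) (fun _ _ _ ↦ rfl) (fun _ _ _ _ ↦ rfl) a u v w
    have h1 := congrArg (fun y ↦ σ x y z) hB
    simp only [map_add (σ x)] at h1
    rw [add_apply, add_apply, h.form_cov_curv hx, h.form_cov_curv hx,
      h.form_cov_curv hx, map_zero, zero_apply] at h1
    have hs := h.covForm_symm hdim hx
    refine mul_left_cancel₀ h.ne_zero ?_
    change c * (2 * (σ x u v * _ + σ x v a * _ + σ x a u * _)
        + (σ x u w * _ + σ x v w * _ + σ x a w * _)
        + (σ x u z * _ + σ x v z * _ + σ x a z * _)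
        - (σ x v w * _ + σ x a w * _ + σ x u w * _)
        - (σ x v z * _ + σ x a z * _ + σ x u z * _)) = c * 0
    linear_combination -h1

/-- Along each vector `v`, the form `(∇_v r)(v, ·)` is proportional to `σ(v, ·)`. -/
lemma exists_covForm_eq [FiniteDimensional ℝ E] (h : IsRicciTypeOn U Γ σ r c) (hdim : 4 ≤ Module.finrank ℝ E) {x : E}
    (hx : x ∈ U) (v : E) : ∃ β : ℝ, ∀ t, covForm Γ r x v v t = β * σ x v t := by
  by_cases hv : v = 0
  · exact ⟨0, fun t ↦ by simp [hv, covForm]⟩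
  obtain ⟨w, hw⟩ := RicciTypeAlgebra.exists_pairing_eq_one
    (σ := (σ x).toLinearMap₁₂) (h.nondegenerate x hx) hv
  change σ x v w = 1 at hw
  refine ⟨covForm Γ r x v v w, fun t ↦ ?_⟩
  -- The vector t - σ(v, t) w is orthogonal to v, so both functionals have it in their kernel;
  -- evaluating at w identifies the factor β.
  have h1 := h.covForm_eq_zero hdim hx (v := v) (t := t - σ x v t • w) (by simp [hw])
  simp only [covForm, map_sub, map_smul, smul_eq_mul] at h1 ⊢
  linear_combination h1

end IsRicciTypeOn

end LocalConnection

/-! ### Parity of Jacobi fields -/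

/-- A solution of `u' = v`, `v' = k u` with vanishing initial values vanishes. -/
lemma eq_zero_of_hasDerivAt_linear {u v : ℝ → ℝ} {k a b : ℝ} (h0 : (0 : ℝ) ∈ Ioo a b)
    (hu : ∀ t ∈ Ioo a b, HasDerivAt u (v t) t) (hv : ∀ t ∈ Ioo a b, HasDerivAt v (k * u t) t)
    (hu0 : u 0 = 0) (hv0 : v 0 = 0) {t : ℝ} (ht : t ∈ Ioo a b) : u t = 0 ∧ v t = 0 := by
  let A : ℝ × ℝ →L[ℝ] ℝ × ℝ :=
    (ContinuousLinearMap.snd ℝ ℝ ℝ).prod (k • ContinuousLinearMap.fst ℝ ℝ ℝ)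
  have h := ODE_solution_unique_of_mem_Ioo (v := fun _ ↦ A) (s := fun _ ↦ univ) (K := ‖A‖₊)
    (f := fun s ↦ (u s, v s)) (g := fun _ ↦ (0 : ℝ × ℝ)) (fun _ _ ↦ A.lipschitz.lipschitzOnWith)
    h0 (fun s hs ↦ ⟨by simpa [A] using (hu s hs).prodMk (hv s hs), mem_univ _⟩)
    (fun s hs ↦ ⟨by simpa using hasDerivAt_const s (0 : ℝ × ℝ), mem_univ _⟩) (by simp [hu0, hv0]) ht
  exact ⟨congrArg Prod.fst h, congrArg Prod.snd h⟩

lemma HasDerivAt.comp_neg_eq {f : ℝ → ℝ} {f' t : ℝ} (h : HasDerivAt f f' (-t)) :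
    HasDerivAt (fun s ↦ f (-s)) (-f') t :=
  (HasDerivAt.comp (h₂ := f) (h := fun s ↦ -s) t h (hasDerivAt_neg t)).congr_deriv (by ring)

/-- Parity of the solutions of the linear system satisfied by the scalar invariants of two Jacobi
fields that vanish at time `0`. -/
lemma even_of_jacobi_system {n₁ n₂ n₃ n₄ w w₁ p : ℝ → ℝ} {k c : ℝ}
    (h₁ : ∀ t ∈ Ioo (-2 : ℝ) 2, HasDerivAt n₁ (n₂ t + n₃ t) t)
    (h₂ : ∀ t ∈ Ioo (-2 : ℝ) 2, HasDerivAt n₂ (4 * k * n₁ t + n₄ t) t)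
    (h₃ : ∀ t ∈ Ioo (-2 : ℝ) 2, HasDerivAt n₃ (n₄ t) t)
    (h₄ : ∀ t ∈ Ioo (-2 : ℝ) 2, HasDerivAt n₄ (4 * k * n₃ t) t)
    (hw : ∀ t ∈ Ioo (-2 : ℝ) 2, HasDerivAt w (w₁ t) t)
    (hw₁ : ∀ t ∈ Ioo (-2 : ℝ) 2, HasDerivAt w₁ (2 * p t + 2 * k * w t - 2 * c * n₁ t) t)
    (hp : ∀ t ∈ Ioo (-2 : ℝ) 2, HasDerivAt p (k * w₁ t + c * (n₂ t - 3 * n₃ t)) t)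
    (h₂0 : n₂ 0 = 0) (h₃0 : n₃ 0 = 0) (hw₁0 : w₁ 0 = 0) {t : ℝ} (ht : t ∈ Ioo (-2 : ℝ) 2) :
    w (-t) = w t := by
  have hneg : ∀ t ∈ Ioo (-2 : ℝ) 2, -t ∈ Ioo (-2 : ℝ) 2 := fun t ht ↦
    ⟨by linarith [ht.2], by linarith [ht.1]⟩
  have h0 : (0 : ℝ) ∈ Ioo (-2 : ℝ) 2 := by norm_num
  -- n₃ and n₄ form a closed subsystem. The odd or even parts that should vanish again solve a
  -- system u' = v, v' = 4k u with zero initial values, and n₁, n₂ follow in the same way.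
  have e₃ : ∀ t ∈ Ioo (-2 : ℝ) 2, n₃ t + n₃ (-t) = 0 ∧ n₄ t - n₄ (-t) = 0 := fun t ht ↦
    eq_zero_of_hasDerivAt_linear (u := fun t ↦ n₃ t + n₃ (-t)) (v := fun t ↦ n₄ t - n₄ (-t))
      (k := 4 * k) h0
      (fun t ht ↦ ((h₃ t ht).add (h₃ _ (hneg t ht)).comp_neg_eq).congr_deriv (by ring))
      (fun t ht ↦ ((h₄ t ht).sub (h₄ _ (hneg t ht)).comp_neg_eq).congr_deriv (by ring))
      (by simp [h₃0]) (by simp) ht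
  have e₁ : ∀ t ∈ Ioo (-2 : ℝ) 2, n₁ t - n₁ (-t) = 0 ∧ n₂ t + n₂ (-t) = 0 := fun t ht ↦
    eq_zero_of_hasDerivAt_linear (u := fun t ↦ n₁ t - n₁ (-t)) (v := fun t ↦ n₂ t + n₂ (-t))
      (k := 4 * k) h0
      (fun t ht ↦ ((h₁ t ht).sub (h₁ _ (hneg t ht)).comp_neg_eq).congr_deriv
        (by linear_combination (e₃ t ht).1))
      (fun t ht ↦ ((h₂ t ht).add (h₂ _ (hneg t ht)).comp_neg_eq).congr_deriv
        (by linear_combination (e₃ t ht).2))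
      (by simp) (by simp [h₂0]) ht
  -- In the derivative of p - k w the term w₁ cancels and leaves c(n₂ - 3n₃), which is odd. So the
  -- odd part of p - k w is constant, hence zero.
  have ep : ∀ t ∈ Ioo (-2 : ℝ) 2, (p t - p (-t)) - k * (w t - w (-t)) = 0 := fun t ht ↦
    (eq_zero_of_hasDerivAt_linear (u := fun t ↦ (p t - p (-t)) - k * (w t - w (-t)))
      (v := fun _ ↦ 0) (k := 0) h0
      (fun t ht ↦ (((hp t ht).sub (hp _ (hneg t ht)).comp_neg_eq).sub
        (((hw t ht).sub (hw _ (hneg t ht)).comp_neg_eq).const_mul k)).congr_deriv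
        (by linear_combination c * (e₁ t ht).2 - 3 * c * (e₃ t ht).1))
      (fun t ht ↦ (hasDerivAt_const t 0).congr_deriv (by ring)) (by simp) rfl ht).1
  -- Here w₁' = 2(p - k w) + 4k w - 2c n₁, where p - k w and n₁ are already known to be even.
  have ew := (eq_zero_of_hasDerivAt_linear (u := fun t ↦ w t - w (-t))
      (v := fun t ↦ w₁ t + w₁ (-t)) (k := 4 * k) h0
      (fun t ht ↦ ((hw t ht).sub (hw _ (hneg t ht)).comp_neg_eq).congr_deriv (by ring))
      (fun t ht ↦ ((hw₁ t ht).add (hw₁ _ (hneg t ht)).comp_neg_eq).congr_deriv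
        (by linear_combination 2 * ep t ht - 2 * c * (e₁ t ht).1))
      (by simp) (by simp [hw₁0]) ht).1
  linarith

/-! ### Jacobi fields of a connection of Ricci type -/

namespace LocalConnection

universe u
variable {E : Type u} [NormedAddCommGroup E] [NormedSpace ℝ E]

namespace IsRicciTypeOn

variable {U : Set E} {Γ : E → E →L[ℝ] E →L[ℝ] E} {σ r : E → E →L[ℝ] E →L[ℝ] ℝ} {c : ℝ}

/-- A₁ and B₁ are the covariant derivatives of A and B along γ. The Christoffel terms cancel against
the derivative of σ because σ is parallel. -/
lemma hasDerivAt_form_along (h : IsRicciTypeOn U Γ σ r c) {γ A B : ℝ → E} {X A₁ B₁ : E} {t : ℝ}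
    (hm : γ t ∈ U) (hγ : HasDerivAt γ X t) (hA : HasDerivAt A (A₁ - Γ (γ t) X (A t)) t)
    (hB : HasDerivAt B (B₁ - Γ (γ t) X (B t)) t) :
    HasDerivAt (fun s ↦ σ (γ s) (A s) (B s)) (σ (γ t) A₁ (B t) + σ (γ t) (A t) B₁) t := by
  have h1 := (((h.hasFDerivAt_form hm).comp_hasDerivAt t hγ).clm_apply hA).clm_apply hB
  refine h1.congr_deriv ?_
  have h2 := h.parallel _ hm X (A t) (B t)
  simp only [add_apply, map_sub, sub_apply, Function.comp_apply]
  linear_combination h2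

/-- The same product rule for r, which is not assumed parallel and so contributes its covariant
derivative. -/
lemma hasDerivAt_ricci_along (h : IsRicciTypeOn U Γ σ r c) {γ A B : ℝ → E} {X A₁ B₁ : E} {t : ℝ}
    (hm : γ t ∈ U) (hγ : HasDerivAt γ X t) (hA : HasDerivAt A (A₁ - Γ (γ t) X (A t)) t)
    (hB : HasDerivAt B (B₁ - Γ (γ t) X (B t)) t) :
    HasDerivAt (fun s ↦ r (γ s) (A s) (B s))
      (covForm Γ r (γ t) X (A t) (B t) + r (γ t) A₁ (B t) + r (γ t) (A t) B₁) t := by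
  have h1 := (((h.hasFDerivAt_ricci hm).comp_hasDerivAt t hγ).clm_apply hA).clm_apply hB
  refine h1.congr_deriv ?_
  simp only [add_apply, map_sub, sub_apply, Function.comp_apply, covForm]
  ring

/-- The Jacobi operator `J ↦ R(X, J) X` of a connection of Ricci type. -/
lemma form_jacobi [FiniteDimensional ℝ E] (h : IsRicciTypeOn U Γ σ r c)
    (hdim : 4 ≤ Module.finrank ℝ E) {x : E} (hx : x ∈ U) (X J T : E) :
    σ x (curv Γ x X J X) T = -c * (3 * σ x X J * r x X T + σ x X T * r x X J
      - r x X X * σ x J T) := by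
  rw [h.ricci x hx, ricciTensor, h.form_swap hx J X, h.alternating x hx, h.ricci_symm hdim hx J X]
  ring

/-- Write r(X, ·) = σ(A, ·). Putting T = A in the Jacobi operator kills the first term, since r(X,
A) = σ(A, A) = 0, and the other two cancel. -/
lemma ricci_jacobi [FiniteDimensional ℝ E] (h : IsRicciTypeOn U Γ σ r c)
    (hdim : 4 ≤ Module.finrank ℝ E) {x : E} (hx : x ∈ U) (X J : E) :
    r x X (curv Γ x X J X) = 0 := by
  let τ : E →ₗ[ℝ] Module.Dual ℝ E := (σ x).toLinearMap₁₂
  have hinj : Function.Injective τ := by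
    rw [injective_iff_map_eq_zero]
    intro v hv
    exact h.nondegenerate x hx v fun w ↦ congrArg (fun f : Module.Dual ℝ E ↦ f w) hv
  have hsurj : Function.Surjective τ :=
    (LinearMap.injective_iff_surjective_of_finrank_eq_finrank (by simp)).1 hinj
  obtain ⟨A, hA⟩ := hsurj (r x X).toLinearMap
  have hA' : ∀ T, σ x A T = r x X T := fun T ↦ congrArg (fun f : Module.Dual ℝ E ↦ f T) hA
  rw [← hA', h.form_swap hx, h.form_jacobi hdim hx, h.form_swap hx X A, h.form_swap hx J A]
  have h1 := hA' A
  rw [h.alternating x hx] at h1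
  simp only [hA', ← h1]
  ring

/-- The pairing of two Jacobi fields that vanish at time `0` is an even function of time. -/
theorem form_jacobi_even [FiniteDimensional ℝ E] (h : IsRicciTypeOn U Γ σ r c)
    (hdim : 4 ≤ Module.finrank ℝ E) {γ X J J₁ K K₁ : ℝ → E}
    (hm : ∀ t ∈ Ioo (-2 : ℝ) 2, γ t ∈ U)
    (hγ : ∀ t ∈ Ioo (-2 : ℝ) 2, HasDerivAt γ (X t) t)
    (hX : ∀ t ∈ Ioo (-2 : ℝ) 2, HasDerivAt X (0 - Γ (γ t) (X t) (X t)) t)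
    (hJ : ∀ t ∈ Ioo (-2 : ℝ) 2, HasDerivAt J (J₁ t - Γ (γ t) (X t) (J t)) t)
    (hJ₁ : ∀ t ∈ Ioo (-2 : ℝ) 2,
      HasDerivAt J₁ (curv Γ (γ t) (X t) (J t) (X t) - Γ (γ t) (X t) (J₁ t)) t)
    (hK : ∀ t ∈ Ioo (-2 : ℝ) 2, HasDerivAt K (K₁ t - Γ (γ t) (X t) (K t)) t)
    (hK₁ : ∀ t ∈ Ioo (-2 : ℝ) 2,
      HasDerivAt K₁ (curv Γ (γ t) (X t) (K t) (X t) - Γ (γ t) (X t) (K₁ t)) t)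
    (hJ0 : J 0 = 0) (hK0 : K 0 = 0) {t : ℝ} (ht : t ∈ Ioo (-2 : ℝ) 2) :
    σ (γ (-t)) (J (-t)) (K (-t)) = σ (γ t) (J t) (K t) := by
  have h0 : (0 : ℝ) ∈ Ioo (-2 : ℝ) 2 := by norm_num
  have hβ : ∀ s ∈ Ioo (-2 : ℝ) 2, ∃ β : ℝ, ∀ T,
      covForm Γ r (γ s) (X s) (X s) T = β * σ (γ s) (X s) T := fun s hs ↦
    h.exists_covForm_eq hdim (hm s hs) (X s)
  have hswap : ∀ s ∈ Ioo (-2 : ℝ) 2, ∀ u v, σ (γ s) u v = -σ (γ s) v u := fun s hs u v ↦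
    h.form_swap (hm s hs) u v
  -- the function `r(X, X)` is constant
  have hconst : ∀ s ∈ Ioo (-2 : ℝ) 2,
      r (γ s) (X s) (X s) = r (γ 0) (X 0) (X 0) := by
    intro s hs
    have := (eq_zero_of_hasDerivAt_linear
      (u := fun s ↦ r (γ s) (X s) (X s) - r (γ 0) (X 0) (X 0)) (v := fun _ ↦ 0) (k := 0) h0
      (fun s hs ↦ by
        -- The derivative of r(X, X) is (∇_X r)(X, X) = β σ(X, X) = 0.
        obtain ⟨β, hβs⟩ := hβ s hs
        refine ((h.hasDerivAt_ricci_along (hm s hs) (hγ s hs) (hX s hs) (hX s hs)).sub_const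
          _).congr_deriv ?_
        simp [hβs, h.alternating _ (hm s hs)])
      (fun s hs ↦ (hasDerivAt_const s 0).congr_deriv (by ring)) (by simp) rfl hs).1
    linarith
  set a := r (γ 0) (X 0) (X 0) with ha
  -- the scalar invariants of a Jacobi field
  have key : ∀ {A A₁ : ℝ → E}, (∀ t ∈ Ioo (-2 : ℝ) 2,
      HasDerivAt A (A₁ t - Γ (γ t) (X t) (A t)) t) → (∀ t ∈ Ioo (-2 : ℝ) 2,
      HasDerivAt A₁ (curv Γ (γ t) (X t) (A t) (X t) - Γ (γ t) (X t) (A₁ t)) t) →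
      ∀ s ∈ Ioo (-2 : ℝ) 2, ∀ β : ℝ,
      (∀ T, covForm Γ r (γ s) (X s) (X s) T = β * σ (γ s) (X s) T) →
      HasDerivAt (fun s ↦ σ (γ s) (X s) (A s)) (σ (γ s) (X s) (A₁ s)) s ∧
      HasDerivAt (fun s ↦ σ (γ s) (X s) (A₁ s)) (4 * (c * a) * σ (γ s) (X s) (A s)) s ∧
      HasDerivAt (fun s ↦ r (γ s) (X s) (A s))
        (β * σ (γ s) (X s) (A s) + r (γ s) (X s) (A₁ s)) s ∧
      HasDerivAt (fun s ↦ r (γ s) (X s) (A₁ s)) (β * σ (γ s) (X s) (A₁ s)) s := by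
    intro A A₁ hA hA₁ s hs β hβs
    refine ⟨?_, ?_, ?_, ?_⟩
    · exact (h.hasDerivAt_form_along (hm s hs) (hγ s hs) (hX s hs) (hA s hs)).congr_deriv
        (by simp)
    · refine (h.hasDerivAt_form_along (hm s hs) (hγ s hs) (hX s hs) (hA₁ s hs)).congr_deriv ?_
      rw [hswap s hs (X s) (curv _ _ _ _ _), h.form_jacobi hdim (hm s hs), hconst s hs,
        h.alternating _ (hm s hs), hswap s hs (A s) (X s), map_zero, zero_apply]
      ring
    · refine (h.hasDerivAt_ricci_along (hm s hs) (hγ s hs) (hX s hs) (hA s hs)).congr_deriv ?_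
      simp [hβs]
    · refine (h.hasDerivAt_ricci_along (hm s hs) (hγ s hs) (hX s hs) (hA₁ s hs)).congr_deriv ?_
      simp [hβs, h.ricci_jacobi hdim (hm s hs)]
  -- the Wronskian vanishes
  have hwr : ∀ s ∈ Ioo (-2 : ℝ) 2, σ (γ s) (X s) (J s) * σ (γ s) (X s) (K₁ s)
      - σ (γ s) (X s) (K s) * σ (γ s) (X s) (J₁ s) = 0 := fun s hs ↦
    (eq_zero_of_hasDerivAt_linear
      (u := fun s ↦ σ (γ s) (X s) (J s) * σ (γ s) (X s) (K₁ s)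
        - σ (γ s) (X s) (K s) * σ (γ s) (X s) (J₁ s)) (v := fun _ ↦ 0) (k := 0) h0
      (fun s hs ↦ by
        obtain ⟨β, hβs⟩ := hβ s hs
        obtain ⟨j1, j2, -, -⟩ := key hJ hJ₁ s hs β hβs
        obtain ⟨k1, k2, -, -⟩ := key hK hK₁ s hs β hβs
        exact ((j1.mul k2).sub (k1.mul j2)).congr_deriv (by ring))
      (fun s hs ↦ (hasDerivAt_const s 0).congr_deriv (by ring)) (by simp [hJ0, hK0]) rfl hs).1
  have hJK : ∀ s ∈ Ioo (-2 : ℝ) 2, ∀ T, σ (γ s) (J s) T = -σ (γ s) T (J s) := fun s hs T ↦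
    hswap s hs _ _
  -- Antisymmetrizing in J and K removes the unknown β: it is multiplied either by an expression
  -- that cancels identically (n₁, n₄) or by the Wronskian (n₂, n₃).
  refine even_of_jacobi_system (k := c * a) (c := c)
    (n₁ := fun s ↦ σ (γ s) (X s) (J s) * r (γ s) (X s) (K s)
      - σ (γ s) (X s) (K s) * r (γ s) (X s) (J s))
    (n₂ := fun s ↦ σ (γ s) (X s) (J₁ s) * r (γ s) (X s) (K s)
      - σ (γ s) (X s) (K₁ s) * r (γ s) (X s) (J s))
    (n₃ := fun s ↦ σ (γ s) (X s) (J s) * r (γ s) (X s) (K₁ s)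
      - σ (γ s) (X s) (K s) * r (γ s) (X s) (J₁ s))
    (n₄ := fun s ↦ σ (γ s) (X s) (J₁ s) * r (γ s) (X s) (K₁ s)
      - σ (γ s) (X s) (K₁ s) * r (γ s) (X s) (J₁ s))
    (w := fun s ↦ σ (γ s) (J s) (K s))
    (w₁ := fun s ↦ σ (γ s) (J₁ s) (K s) + σ (γ s) (J s) (K₁ s))
    (p := fun s ↦ σ (γ s) (J₁ s) (K₁ s)) ?_ ?_ ?_ ?_ ?_ ?_ ?_ ?_ ?_ ?_ ht
  · intro s hs
    obtain ⟨β, hβs⟩ := hβ s hs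
    obtain ⟨j1, j2, j3, j4⟩ := key hJ hJ₁ s hs β hβs
    obtain ⟨k1, k2, k3, k4⟩ := key hK hK₁ s hs β hβs
    exact ((j1.mul k3).sub (k1.mul j3)).congr_deriv (by ring)
  · intro s hs
    obtain ⟨β, hβs⟩ := hβ s hs
    obtain ⟨j1, j2, j3, j4⟩ := key hJ hJ₁ s hs β hβs
    obtain ⟨k1, k2, k3, k4⟩ := key hK hK₁ s hs β hβs
    exact ((j2.mul k3).sub (k2.mul j3)).congr_deriv
      (by linear_combination -β * hwr s hs)
  · intro s hs
    obtain ⟨β, hβs⟩ := hβ s hs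
    obtain ⟨j1, j2, j3, j4⟩ := key hJ hJ₁ s hs β hβs
    obtain ⟨k1, k2, k3, k4⟩ := key hK hK₁ s hs β hβs
    exact ((j1.mul k4).sub (k1.mul j4)).congr_deriv
      (by linear_combination β * hwr s hs)
  · intro s hs
    obtain ⟨β, hβs⟩ := hβ s hs
    obtain ⟨j1, j2, j3, j4⟩ := key hJ hJ₁ s hs β hβs
    obtain ⟨k1, k2, k3, k4⟩ := key hK hK₁ s hs β hβs
    exact ((j2.mul k4).sub (k2.mul j4)).congr_deriv (by ring)
  · intro s hs
    exact h.hasDerivAt_form_along (hm s hs) (hγ s hs) (hJ s hs) (hK s hs)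
  · intro s hs
    refine ((h.hasDerivAt_form_along (hm s hs) (hγ s hs) (hJ₁ s hs) (hK s hs)).add
      (h.hasDerivAt_form_along (hm s hs) (hγ s hs) (hJ s hs) (hK₁ s hs))).congr_deriv ?_
    rw [hswap s hs (J s) (curv _ _ _ _ _), h.form_jacobi hdim (hm s hs),
      h.form_jacobi hdim (hm s hs), hconst s hs, hswap s hs (K s) (J s)]
    ring
  · intro s hs
    refine (h.hasDerivAt_form_along (hm s hs) (hγ s hs) (hJ₁ s hs) (hK₁ s hs)).congr_deriv ?_
    rw [hswap s hs (J₁ s) (curv _ _ _ _ _), h.form_jacobi hdim (hm s hs),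
      h.form_jacobi hdim (hm s hs), hconst s hs, hswap s hs (K s) (J₁ s)]
    ring
  · simp [hJ0, hK0]
  · simp [hJ0, hK0]
  · simp [hJ0, hK0]

/-- The Jacobi equation: if `J` solves the linearized geodesic equation, then its second covariant
derivative along the geodesic is `R(X, J) X`. -/
lemma hasDerivAt_jacobi_along (h : IsRicciTypeOn U Γ σ r c) {γ X J K : ℝ → E} {t : ℝ}
    (hm : γ t ∈ U) (hγ : HasDerivAt γ (X t) t) (hX : HasDerivAt X (-Γ (γ t) (X t) (X t)) t)
    (hJ : HasDerivAt J (K t) t)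
    (hK : HasDerivAt K (-(fderiv ℝ Γ (γ t) (J t) (X t) (X t) + Γ (γ t) (K t) (X t)
      + Γ (γ t) (X t) (K t))) t) :
    HasDerivAt (fun t ↦ K t + Γ (γ t) (X t) (J t))
      (curv Γ (γ t) (X t) (J t) (X t) - Γ (γ t) (X t) (K t + Γ (γ t) (X t) (J t))) t := by
  have hΓ : HasDerivAt (fun t ↦ Γ (γ t)) (fderiv ℝ Γ (γ t) (X t)) t :=
    (h.hasFDerivAt hm).comp_hasDerivAt t hγ
  refine (hK.add ((hΓ.clm_apply hX).clm_apply hJ)).congr_deriv ?_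
  simp only [curv, add_apply, map_add, map_neg, neg_apply]
  rw [h.fderiv_symm hm (X t) (J t) (X t), h.symm _ hm (K t) (X t), h.symm _ hm (J t) (X t), h.symm _ hm (J t) (Γ _ _ _)]
  abel

/-- The pullback of `σ` under the exponential map is invariant under `v ↦ -v`. -/
theorem form_exp_even [FiniteDimensional ℝ E] (h : IsRicciTypeOn U Γ σ r c)
    (hdim : 4 ≤ Module.finrank ℝ E) {p : E} {δ : ℝ} {Z : ℝ × E → E × E}
    (hZ : IsGeodesicFlow U Γ p δ Z) {v : E} (hv : v ∈ Metric.ball (0 : E) δ) (w w' : E) :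
    σ (Z (1, -v)).1 (fderiv ℝ (fun v ↦ (Z (1, v)).1) (-v) w)
        (fderiv ℝ (fun v ↦ (Z (1, v)).1) (-v) w') =
      σ (Z (1, v)).1 (fderiv ℝ (fun v ↦ (Z (1, v)).1) v w)
        (fderiv ℝ (fun v ↦ (Z (1, v)).1) v w') := by
  have hγ : ∀ t ∈ Ioo (-2 : ℝ) 2, HasDerivAt (fun t ↦ (Z (t, v)).1) (Z (t, v)).2 t :=
    fun t ht ↦ (hZ.hasDerivAt t ht v hv).hasFDerivAt.fst.hasDerivAt.congr_deriv (by simp [spray])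
  have hX : ∀ t ∈ Ioo (-2 : ℝ) 2, HasDerivAt (fun t ↦ (Z (t, v)).2)
      (-Γ (Z (t, v)).1 (Z (t, v)).2 (Z (t, v)).2) t :=
    fun t ht ↦ (hZ.hasDerivAt t ht v hv).hasFDerivAt.snd.hasDerivAt.congr_deriv (by simp [spray])
  have hspray : ∀ z : E × E, z.1 ∈ U → ∀ j k, fderiv ℝ (spray Γ) z (j, k) =
      (k, -(fderiv ℝ Γ z.1 j z.2 z.2 + Γ z.1 k z.2 + Γ z.1 z.2 k)) := by
    intro z hz j k
    have h1 : HasFDerivAt (fun z : E × E ↦ Γ z.1)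
        ((fderiv ℝ Γ z.1).comp (.fst ℝ E E)) z :=
      HasFDerivAt.comp (g := Γ) z (h.hasFDerivAt hz) hasFDerivAt_fst
    have h2 : HasFDerivAt (fun z : E × E ↦ z.2) (.snd ℝ E E) z := hasFDerivAt_snd
    have h3 := h2.prodMk ((h1.clm_apply h2).clm_apply h2).neg
    rw [HasFDerivAt.fderiv (f := spray Γ) h3]
    simp [add_comm, add_left_comm]
  have hJ : ∀ w, ∀ t ∈ Ioo (-2 : ℝ) 2,
      HasDerivAt (fun t ↦ (IsGeodesicFlow.variation Z v w t).1)
        ((IsGeodesicFlow.variation Z v w t).2) t := by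
    intro w t ht
    refine (hZ.hasDerivAt_variation h.isOpen h.contDiffOn hv w
      ht).hasFDerivAt.fst.hasDerivAt.congr_deriv ?_
    have := hspray (Z (t, v)) (hZ.mem t ht v hv) (IsGeodesicFlow.variation Z v w t).1
      (IsGeodesicFlow.variation Z v w t).2
    rw [Prod.mk.eta] at this
    simp [this]
  have hJ' : ∀ w, ∀ t ∈ Ioo (-2 : ℝ) 2,
      HasDerivAt (fun t ↦ (IsGeodesicFlow.variation Z v w t).2)
        (-(fderiv ℝ Γ (Z (t, v)).1 (IsGeodesicFlow.variation Z v w t).1 (Z (t, v)).2 (Z (t, v)).2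
          + Γ (Z (t, v)).1 (IsGeodesicFlow.variation Z v w t).2 (Z (t, v)).2
          + Γ (Z (t, v)).1 (Z (t, v)).2 (IsGeodesicFlow.variation Z v w t).2)) t := by
    intro w t ht
    refine (hZ.hasDerivAt_variation h.isOpen h.contDiffOn hv w
      ht).hasFDerivAt.snd.hasDerivAt.congr_deriv ?_
    have := hspray (Z (t, v)) (hZ.mem t ht v hv) (IsGeodesicFlow.variation Z v w t).1
      (IsGeodesicFlow.variation Z v w t).2
    rw [Prod.mk.eta] at this
    simp [this]
  have hD : ∀ w, ∀ t ∈ Ioo (-2 : ℝ) 2,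
      HasDerivAt (fun t ↦ (IsGeodesicFlow.variation Z v w t).2
          + Γ (Z (t, v)).1 (Z (t, v)).2 (IsGeodesicFlow.variation Z v w t).1)
        (curv Γ (Z (t, v)).1 (Z (t, v)).2 (IsGeodesicFlow.variation Z v w t).1 (Z (t, v)).2
          - Γ (Z (t, v)).1 (Z (t, v)).2 ((IsGeodesicFlow.variation Z v w t).2
          + Γ (Z (t, v)).1 (Z (t, v)).2 (IsGeodesicFlow.variation Z v w t).1)) t := by
    intro w t ht
    have hz := hZ.mem t ht v hv
    exact h.hasDerivAt_jacobi_along (γ := fun t ↦ (Z (t, v)).1) (X := fun t ↦ (Z (t, v)).2) hz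
      (hγ t ht) (hX t ht) (hJ w t ht) (hJ' w t ht)
  have key := h.form_jacobi_even hdim (γ := fun t ↦ (Z (t, v)).1) (X := fun t ↦ (Z (t, v)).2)
    (J := fun t ↦ (IsGeodesicFlow.variation Z v w t).1)
    (J₁ := fun t ↦ (IsGeodesicFlow.variation Z v w t).2
          + Γ (Z (t, v)).1 (Z (t, v)).2 (IsGeodesicFlow.variation Z v w t).1)
    (K := fun t ↦ (IsGeodesicFlow.variation Z v w' t).1)
    (K₁ := fun t ↦ (IsGeodesicFlow.variation Z v w' t).2
          + Γ (Z (t, v)).1 (Z (t, v)).2 (IsGeodesicFlow.variation Z v w' t).1)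
    (fun t ht ↦ hZ.mem t ht v hv) hγ (fun t ht ↦ (hX t ht).congr_deriv (by simp))
    (fun t ht ↦ (hJ w t ht).congr_deriv (by simp)) (hD w)
    (fun t ht ↦ (hJ w' t ht).congr_deriv (by simp)) (hD w')
    (by simp [hZ.variation_zero hv]) (by simp [hZ.variation_zero hv]) (t := 1) (by norm_num)
  -- At t = -1 both fields carry a minus sign, and these cancel in the bilinear form.
  simp only [hZ.variation_one hv, hZ.variation_neg_one h.isOpen h.contDiffOn hv,
    hZ.fst_neg_one h.isOpen h.contDiffOn hv] at key
  simpa using key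

end IsRicciTypeOn

end LocalConnection

namespace SymplecticConnection

universe u v
variable {E : Type u} [NormedAddCommGroup E] [NormedSpace ℝ E]
  {M : Type v} [TopologicalSpace M] [ChartedSpace E M] {p y : M}

/-! ### Vector fields in a chart -/

lemma eventually_mem_source (hy : y ∈ (extChartAt 𝓘(ℝ, E) p).source) :
    ∀ᶠ z in 𝓝 y, z ∈ (extChartAt 𝓘(ℝ, E) p).source :=
  (isOpen_extChartAt_source p).mem_nhds hy

lemma eventually_chart_mem_target {x : E} (hx : x ∈ (extChartAt 𝓘(ℝ, E) p).target) :
    ∀ᶠ z in 𝓝 x, z ∈ (extChartAt 𝓘(ℝ, E) p).target :=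
  (isOpen_extChartAt_target p).mem_nhds hx

lemma eventually_chart {P : M → Prop} (hy : y ∈ (extChartAt 𝓘(ℝ, E) p).source)
    (h : ∀ᶠ z in 𝓝 y, P z) :
    ∀ᶠ x in 𝓝 (extChartAt 𝓘(ℝ, E) p y), P ((extChartAt 𝓘(ℝ, E) p).symm x) := by
  have hc := continuousAt_extChartAt_symm' (I := 𝓘(ℝ, E)) hy
  rw [ContinuousAt, (extChartAt 𝓘(ℝ, E) p).left_inv hy] at hc
  exact hc.eventually h

variable [IsManifold 𝓘(ℝ, E) ∞ M]

/-- The coordinates of a tangent vector at `y` in the tangent bundle trivialization at `p`. -/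
def chartCoord (p y : M) : TangentSpace 𝓘(ℝ, E) y →L[ℝ] E :=
  (trivializationAt E (TangentSpace 𝓘(ℝ, E) : M → Type _) p).continuousLinearMapAt ℝ y

/-- The coordinate expression of a vector field in the preferred chart at `p`. -/
def localRep (p : M) (s : Π x : M, TangentSpace 𝓘(ℝ, E) x) (x : E) : E :=
  chartCoord p ((extChartAt 𝓘(ℝ, E) p).symm x) (s ((extChartAt 𝓘(ℝ, E) p).symm x))

lemma chartCoord_constField (hy : y ∈ (extChartAt 𝓘(ℝ, E) p).source) (c : E) :
    chartCoord p y (constField p c y) = c :=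
  (trivializationAt E (TangentSpace 𝓘(ℝ, E) : M → Type _) p).continuousLinearMapAt_symmL
    (by simpa using hy) c

lemma constField_chartCoord (hy : y ∈ (extChartAt 𝓘(ℝ, E) p).source)
    (v : TangentSpace 𝓘(ℝ, E) y) : constField p (chartCoord p y v) y = v :=
  (trivializationAt E (TangentSpace 𝓘(ℝ, E) : M → Type _) p).symmL_continuousLinearMapAt
    (by simpa using hy) v

lemma chartCoord_injective (hy : y ∈ (extChartAt 𝓘(ℝ, E) p).source) :
    Function.Injective (chartCoord (E := E) p y) :=
  fun v w h ↦ by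
    rw [← constField_chartCoord hy v, h, constField_chartCoord hy]

lemma chartCoord_eq_snd (hy : y ∈ (extChartAt 𝓘(ℝ, E) p).source) (v : TangentSpace 𝓘(ℝ, E) y) :
    chartCoord p y v = (trivializationAt E (TangentSpace 𝓘(ℝ, E) : M → Type _) p ⟨y, v⟩).2 := by
  have hy' : y ∈ (trivializationAt E (TangentSpace 𝓘(ℝ, E) : M → Type _) p).baseSet := by
    simpa using hy
  rw [chartCoord, Trivialization.continuousLinearMapAt_apply,
    Trivialization.coe_linearMapAt_of_mem _ hy']

lemma chartCoord_eq_mfderiv (hy : y ∈ (extChartAt 𝓘(ℝ, E) p).source) :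
    chartCoord p y = mfderiv 𝓘(ℝ, E) 𝓘(ℝ, E) (extChartAt 𝓘(ℝ, E) p) y :=
  TangentBundle.continuousLinearMapAt_trivializationAt (by simpa using hy)

lemma contMDiffAt_iff_chart {F : Type*} [NormedAddCommGroup F] [NormedSpace ℝ F] {g : M → F}
    (hy : y ∈ (extChartAt 𝓘(ℝ, E) p).source) :
    CMDiffAt ∞ g y ↔ ContDiffAt ℝ ∞ (g ∘ (extChartAt 𝓘(ℝ, E) p).symm)
      (extChartAt 𝓘(ℝ, E) p y) := by
  rw [contMDiffAt_iff_source_of_mem_source (I := 𝓘(ℝ, E)) (x := p) (by simpa using hy)]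
  simp [contMDiffWithinAt_univ, contMDiffAt_iff_contDiffAt]

lemma mdifferentiableAt_iff_chart {F : Type*} [NormedAddCommGroup F] [NormedSpace ℝ F] {g : M → F}
    (hy : y ∈ (extChartAt 𝓘(ℝ, E) p).source) :
    MDiffAt g y ↔ DifferentiableAt ℝ (g ∘ (extChartAt 𝓘(ℝ, E) p).symm)
      (extChartAt 𝓘(ℝ, E) p y) := by
  rw [mdifferentiableAt_iff_source_of_mem_source (I := 𝓘(ℝ, E)) (x := p) (by simpa using hy)]
  simp [mdifferentiableWithinAt_univ, mdifferentiableAt_iff_differentiableAt]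

lemma contMDiffAt_field_iff {s : Π x : M, TangentSpace 𝓘(ℝ, E) x}
    (hy : y ∈ (extChartAt 𝓘(ℝ, E) p).source) :
    CMDiffAt ∞ (T% s) y ↔ ContDiffAt ℝ ∞ (localRep p s) (extChartAt 𝓘(ℝ, E) p y) := by
  rw [(trivializationAt E (TangentSpace 𝓘(ℝ, E) : M → Type _) p).contMDiffAt_section_iff
    (by simpa using hy), show localRep p s = (fun z ↦ chartCoord p z (s z)) ∘ (extChartAt 𝓘(ℝ, E) p).symm from rfl,
    ← contMDiffAt_iff_chart hy]
  refine Filter.EventuallyEq.contMDiffAt_iff ?_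
  filter_upwards [eventually_mem_source hy] with z hz
  exact (chartCoord_eq_snd hz _).symm

lemma mdifferentiableAt_field_iff {s : Π x : M, TangentSpace 𝓘(ℝ, E) x}
    (hy : y ∈ (extChartAt 𝓘(ℝ, E) p).source) :
    MDiffAt (T% s) y ↔ DifferentiableAt ℝ (localRep p s) (extChartAt 𝓘(ℝ, E) p y) := by
  rw [(trivializationAt E (TangentSpace 𝓘(ℝ, E) : M → Type _) p).mdifferentiableAt_section_iff
    _ _ (by simpa using hy), show localRep p s = (fun z ↦ chartCoord p z (s z)) ∘ (extChartAt 𝓘(ℝ, E) p).symm from rfl,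
    ← mdifferentiableAt_iff_chart hy]
  refine Filter.EventuallyEq.mdifferentiableAt_iff ?_
  filter_upwards [eventually_mem_source hy] with z hz
  exact (chartCoord_eq_snd hz _).symm

lemma localRep_extChartAt (hy : y ∈ (extChartAt 𝓘(ℝ, E) p).source)
    (s : Π x : M, TangentSpace 𝓘(ℝ, E) x) :
    localRep p s (extChartAt 𝓘(ℝ, E) p y) = chartCoord p y (s y) := by
  rw [localRep, (extChartAt 𝓘(ℝ, E) p).left_inv hy]

lemma localRep_constField {x : E} (hx : x ∈ (extChartAt 𝓘(ℝ, E) p).target) (c : E) :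
    localRep p (constField p c) x = c :=
  chartCoord_constField ((extChartAt 𝓘(ℝ, E) p).map_target hx) c

/-- The differential of a function in a chart. -/
lemma mvfderiv_eq_fderiv_chart {F : Type*} [NormedAddCommGroup F] [NormedSpace ℝ F] {g : M → F}
    (hy : y ∈ (extChartAt 𝓘(ℝ, E) p).source) (hg : MDiffAt g y) (v : TangentSpace 𝓘(ℝ, E) y) :
    d% g y v = fderiv ℝ (g ∘ (extChartAt 𝓘(ℝ, E) p).symm) (extChartAt 𝓘(ℝ, E) p y)
      (chartCoord p y v) := by
  have h1 := (mdifferentiableAt_iff_chart hy).1 hg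
  have h2 : MDifferentiableAt 𝓘(ℝ, E) 𝓘(ℝ, E) (extChartAt 𝓘(ℝ, E) p) y :=
    mdifferentiableAt_extChartAt (by simpa using hy)
  have h3 : g =ᶠ[𝓝 y] (g ∘ (extChartAt 𝓘(ℝ, E) p).symm) ∘ (extChartAt 𝓘(ℝ, E) p) := by
    filter_upwards [eventually_mem_source hy] with z hz
    exact congrArg g ((extChartAt 𝓘(ℝ, E) p).left_inv hz).symm
  have h4 := h1.hasFDerivAt.hasMFDerivAt.comp y h2.hasMFDerivAt
  have h5 := (h4.congr_of_eventuallyEq h3).mfderiv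
  rw [chartCoord_eq_mfderiv hy]
  exact congrArg (fun L ↦ L v) h5

end SymplecticConnection

namespace SymplecticConnection

universe u v
variable {E : Type u} [NormedAddCommGroup E] [NormedSpace ℝ E]
  {M : Type v} [TopologicalSpace M] [ChartedSpace E M] [IsManifold 𝓘(ℝ, E) ∞ M] {p y : M}

/-! ### Christoffel symbols -/

lemma contMDiffAt_constField_of_mem (hy : y ∈ (extChartAt 𝓘(ℝ, E) p).source) (c : E) :
    CMDiffAt ∞ (T% (constField p c)) y :=
  (contMDiffOn_constField p c).contMDiffAt
    ((trivializationAt E (TangentSpace 𝓘(ℝ, E) : M → Type _) p).open_baseSet.mem_nhds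
      (by simpa using hy))

lemma mdifferentiableAt_constField (hy : y ∈ (extChartAt 𝓘(ℝ, E) p).source) (c : E) :
    MDiffAt (T% (constField p c)) y :=
  (contMDiffAt_constField_of_mem hy c).mdifferentiableAt (by simp)

variable (cov : CovariantDerivative 𝓘(ℝ, E) E (TangentSpace 𝓘(ℝ, E) : M → Type _))

lemma cov_sum {ι : Type*} (t : Finset ι) {s : ι → Π x : M, TangentSpace 𝓘(ℝ, E) x}
    (hs : ∀ i, MDiffAt (T% (s i)) y) :
    cov (fun z ↦ ∑ i ∈ t, s i z) y = ∑ i ∈ t, cov (s i) y := by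
  classical
  induction t using Finset.induction_on with
  | empty => exact cov.isCovariantDerivativeOnUniv.zero (x := y)
  | insert a t ha ih =>
    have h1 : MDiffAt (T% (fun z ↦ ∑ i ∈ t, s i z)) y :=
      MDifferentiableAt.sum_section fun i _ ↦ hs i
    have h2 : (fun z ↦ ∑ i ∈ insert a t, s i z) = s a + fun z ↦ ∑ i ∈ t, s i z := by
      funext z
      simp [Finset.sum_insert ha]
    rw [h2, cov.isCovariantDerivativeOnUniv.add (hs a) h1, ih, Finset.sum_insert ha]

variable [FiniteDimensional ℝ E]

/-- A vector field that is smooth near a point agrees near that point with a smooth one. -/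
lemma exists_contMDiff_eventuallyEq [T2Space M] {s : Π x : M, TangentSpace 𝓘(ℝ, E) x} {V : Set M}
    (hV : IsOpen V) (hs : CMDiff[V] ∞ (T% s)) (hy : y ∈ V) :
    ∃ s' : Π x : M, TangentSpace 𝓘(ℝ, E) x, CMDiff ∞ (T% s') ∧ ∀ᶠ z in 𝓝 y, s' z = s z := by
  obtain ⟨f, -, hf⟩ := (SmoothBumpFunction.nhds_basis_tsupport (I := 𝓘(ℝ, E)) y).mem_iff.1
    (hV.mem_nhds hy)
  refine ⟨(f : M → ℝ) • s, f.contMDiff.contMDiffOn.smul_section_of_tsupport hV hf hs, ?_⟩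
  filter_upwards [f.eventuallyEq_one] with z hz
  simp [hz]

/-- If the connection is smooth, then so is the covariant derivative of a smooth field. -/
lemma contMDiffAt_cov [T2Space M] [h : CovariantDerivative.ContMDiffCovariantDerivative cov ∞]
    {s X : Π x : M, TangentSpace 𝓘(ℝ, E) x} {V : Set M}
    (hV : IsOpen V) (hs : CMDiff[V] ∞ (T% s)) (hy : y ∈ V) (hX : CMDiffAt ∞ (T% X) y) :
    CMDiffAt ∞ (T% (fun z ↦ cov s z (X z))) y := by
  obtain ⟨s', hs', he⟩ := exists_contMDiff_eventuallyEq hV hs hy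
  have h1 := (h.contMDiff.contMDiff (σ := s') hs'.contMDiffOn).contMDiffAt (x := y) univ_mem
  have h2 := h1.clm_bundle_apply hX
  refine h2.congr_of_eventuallyEq ?_
  filter_upwards [he.eventually_nhds, hV.mem_nhds hy] with z hz hzV
  have : cov s z = cov s' z := by
    refine cov.isCovariantDerivativeOnUniv.congr_of_eventuallyEq
      ((hs.contMDiffAt (hV.mem_nhds hzV)).mdifferentiableAt (by simp))
      (hs'.mdifferentiable (by simp) z) univ_mem ?_
    filter_upwards [hz] with z hz using hz.symm
  simp [this]

variable (p) in
/-- The Christoffel symbols of the connection in the preferred chart at `p`. -/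
def christoffel (x : E) : E →L[ℝ] E →L[ℝ] E :=
  -- Linear extension from a basis makes this linear in the field argument at every x, also off the
  -- chart target. The extension is linear in the differentiated field first; `flip` puts the
  -- direction first.
  (LinearMap.toContinuousLinearMap ((Module.finBasis ℝ E).constr ℝ fun i ↦
    chartCoord p ((extChartAt 𝓘(ℝ, E) p).symm x) ∘L
      cov (constField p (Module.finBasis ℝ E i)) ((extChartAt 𝓘(ℝ, E) p).symm x) ∘L
      (trivializationAt E (TangentSpace 𝓘(ℝ, E) : M → Type _) p).symmL ℝ
        ((extChartAt 𝓘(ℝ, E) p).symm x))).flip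

lemma christoffel_apply (x u w : E) : christoffel p cov x u w =
    ∑ i, (Module.finBasis ℝ E).repr w i • localRep p (fun z ↦
      cov (constField p (Module.finBasis ℝ E i)) z (constField p u z)) x := by
  simp [christoffel, Module.Basis.constr_apply_fintype, localRep, constField,
    Module.Basis.equivFun_apply]
  rfl

/-- The covariant derivative in a chart. -/
theorem chartCoord_cov (hy : y ∈ (extChartAt 𝓘(ℝ, E) p).source)
    {s : Π x : M, TangentSpace 𝓘(ℝ, E) x} (hs : MDiffAt (T% s) y) (v : TangentSpace 𝓘(ℝ, E) y) :
    chartCoord p y (cov s y v) =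
      fderiv ℝ (localRep p s) (extChartAt 𝓘(ℝ, E) p y) (chartCoord p y v) +
        christoffel p cov (extChartAt 𝓘(ℝ, E) p y) (chartCoord p y v) (chartCoord p y (s y)) := by
  set b := Module.finBasis ℝ E with hb
  let B : Fin _ → E →L[ℝ] ℝ := fun i ↦ LinearMap.toContinuousLinearMap (b.coord i)
  let g : Fin (Module.finrank ℝ E) → M → ℝ := fun i z ↦ B i (chartCoord p z (s z))
  have hrep := (mdifferentiableAt_field_iff hy).1 hs
  have hgB : ∀ i, g i ∘ (extChartAt 𝓘(ℝ, E) p).symm = fun x ↦ B i (localRep p s x) := fun i ↦ rfl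
  have hg : ∀ i, MDiffAt (g i) y := fun i ↦ by
    rw [mdifferentiableAt_iff_chart hy, hgB]
    exact (B i).differentiableAt.comp _ hrep
  have hd : ∀ i, d% (g i) y v = B i (fderiv ℝ (localRep p s) (extChartAt 𝓘(ℝ, E) p y)
      (chartCoord p y v)) := fun i ↦ by
    rw [mvfderiv_eq_fderiv_chart hy (hg i), hgB]
    have := ((B i).hasFDerivAt (x := localRep p s (extChartAt 𝓘(ℝ, E) p y))).comp _
      hrep.hasFDerivAt
    exact congrArg (fun L ↦ L (chartCoord p y v)) this.fderiv
  have hc : ∀ i, MDiffAt (T% (constField p (b i))) y := fun i ↦ mdifferentiableAt_constField hy _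
  have hgc : ∀ i, MDiffAt (T% (g i • constField p (b i))) y := fun i ↦ (hg i).smul_section (hc i)
  -- Expand s in the coordinate frame and apply the Leibniz rule: the derivatives of the
  -- coefficients reassemble to the ordinary derivative, and the derivatives of the frame give the
  -- Christoffel term.
  have he : ∀ᶠ z in 𝓝 y, s z = ∑ i, (g i • constField p (b i)) z := by
    filter_upwards [eventually_mem_source hy] with z hz
    apply chartCoord_injective hz
    simp only [map_sum, Pi.smul_apply', map_smul, chartCoord_constField hz]
    exact (b.sum_repr _).symm
  have hsum : MDiffAt (T% (fun z ↦ ∑ i, (g i • constField p (b i)) z)) y :=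
    MDifferentiableAt.sum_section fun i _ ↦ hgc i
  rw [cov.isCovariantDerivativeOnUniv.congr_of_eventuallyEq hs hsum univ_mem he,
    cov_sum cov _ hgc, sum_apply, map_sum, christoffel_apply]
  have hi : ∀ i, chartCoord p y (cov (g i • constField p (b i)) y v) =
      (b.coord i (fderiv ℝ (localRep p s) (extChartAt 𝓘(ℝ, E) p y) (chartCoord p y v))) • b i +
      b.repr (chartCoord p y (s y)) i • localRep p (fun z ↦
      cov (constField p (b i)) z (constField p (chartCoord p y v) z))
        (extChartAt 𝓘(ℝ, E) p y) := fun i ↦ by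
    rw [cov.isCovariantDerivativeOnUniv.leibniz (hc i) (hg i), localRep_extChartAt hy,
      constField_chartCoord hy]
    simp only [add_apply, smul_apply, ContinuousLinearMap.smulRight_apply, map_add,
      map_smul, chartCoord_constField hy, hd]
    rw [add_comm]
    rfl
  simp only [hi, Finset.sum_add_distrib]
  congr 1
  exact b.sum_repr _

/-- The coordinate expression of `constField` is locally constant, so the formula for the covariant
derivative reduces to its Christoffel term, for all w and not only basis vectors. -/
lemma christoffel_eq {x : E} (hx : x ∈ (extChartAt 𝓘(ℝ, E) p).target) (u w : E) :
    christoffel p cov x u w =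
      localRep p (fun z ↦ cov (constField p w) z (constField p u z)) x := by
  have hy := (extChartAt 𝓘(ℝ, E) p).map_target hx
  have h := chartCoord_cov cov hy (mdifferentiableAt_constField hy w)
    (constField p u ((extChartAt 𝓘(ℝ, E) p).symm x))
  rw [localRep, h, chartCoord_constField hy, chartCoord_constField hy,
    (extChartAt 𝓘(ℝ, E) p).right_inv hx]
  have : localRep p (constField p w) =ᶠ[𝓝 x] fun _ ↦ w := by
    filter_upwards [eventually_chart_mem_target hx] with z hz using localRep_constField hz w
  simp [this.fderiv_eq]

lemma contDiffOn_christoffel [T2Space M]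
    [CovariantDerivative.ContMDiffCovariantDerivative cov ∞] :
    ContDiffOn ℝ ∞ (christoffel p cov) (extChartAt 𝓘(ℝ, E) p).target := by
  refine contDiffOn_clm_apply.2 fun u ↦ contDiffOn_clm_apply.2 fun w ↦ ?_
  refine ContDiffOn.congr (f := localRep p fun z ↦ cov (constField p w) z (constField p u z))
    ?_ fun x hx ↦ christoffel_eq cov hx u w
  intro x hx
  have hy := (extChartAt 𝓘(ℝ, E) p).map_target hx
  have h := (contMDiffAt_field_iff hy).1 (contMDiffAt_cov cov
    (trivializationAt E (TangentSpace 𝓘(ℝ, E) : M → Type _) p).open_baseSet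
    (contMDiffOn_constField p w) (by simpa using hy) (contMDiffAt_constField_of_mem hy u))
  rw [(extChartAt 𝓘(ℝ, E) p).right_inv hx] at h
  exact h.contDiffWithinAt

end SymplecticConnection

/-! ### Curvature in a chart -/

namespace LocalConnection

universe u
variable {E : Type u} [NormedAddCommGroup E] [NormedSpace ℝ E]

/-- The derivative of the coordinate expression of `∇_A S`. -/
lemma fderiv_cov_apply {Γ : E → E →L[ℝ] E →L[ℝ] E} {S A : E → E} {x : E}
    (hΓ : DifferentiableAt ℝ Γ x) (hS : ContDiffAt ℝ ∞ S x) (hA : DifferentiableAt ℝ A x) (a : E) :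
    fderiv ℝ (fun x ↦ fderiv ℝ S x (A x) + Γ x (A x) (S x)) x a =
      fderiv ℝ (fderiv ℝ S) x a (A x) + fderiv ℝ S x (fderiv ℝ A x a) +
        (fderiv ℝ Γ x a (A x) (S x) + Γ x (fderiv ℝ A x a) (S x) + Γ x (A x) (fderiv ℝ S x a)) := by
  have hS0 : DifferentiableAt ℝ S x := hS.differentiableAt (by simp)
  have hS1 : DifferentiableAt ℝ (fderiv ℝ S) x :=
    (hS.fderiv_right (m := ∞) (by simp)).differentiableAt (by simp)
  have h1 := hS1.hasFDerivAt.clm_apply hA.hasFDerivAt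
  have h2 := (hΓ.hasFDerivAt.clm_apply hA.hasFDerivAt).clm_apply hS0.hasFDerivAt
  have h3 : fderiv ℝ (fun x ↦ fderiv ℝ S x (A x) + Γ x (A x) (S x)) x = _ := (h1.add h2).fderiv
  rw [h3]
  simp only [add_apply, ContinuousLinearMap.comp_apply, ContinuousLinearMap.flip_apply]
  abel

/-- The coordinate expression of `∇_A ∇_B S - ∇_B ∇_A S - ∇_[A,B] S`. -/
lemma curv_eq_commutator {Γ : E → E →L[ℝ] E →L[ℝ] E} {S A B : E → E} {x : E}
    (hsymm : ∀ u v, Γ x u v = Γ x v u)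
    (hΓ : DifferentiableAt ℝ Γ x) (hS : ContDiffAt ℝ ∞ S x) (hA : DifferentiableAt ℝ A x)
    (hB : DifferentiableAt ℝ B x) {L : E}
    (hL : L = fderiv ℝ B x (A x) + Γ x (A x) (B x) - (fderiv ℝ A x (B x) + Γ x (B x) (A x))) :
    fderiv ℝ (fun x ↦ fderiv ℝ S x (B x) + Γ x (B x) (S x)) x (A x) +
        Γ x (A x) (fderiv ℝ S x (B x) + Γ x (B x) (S x)) -
      (fderiv ℝ (fun x ↦ fderiv ℝ S x (A x) + Γ x (A x) (S x)) x (B x) +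
        Γ x (B x) (fderiv ℝ S x (A x) + Γ x (A x) (S x))) -
      (fderiv ℝ S x L + Γ x L (S x)) = curv Γ x (A x) (B x) (S x) := by
  have hsnd : fderiv ℝ (fderiv ℝ S) x (A x) (B x) = fderiv ℝ (fderiv ℝ S) x (B x) (A x) :=
    (hS.isSymmSndFDerivAt
      (by rw [minSmoothness_of_isRCLikeNormedField]; exact ENat.LEInfty.out)) (A x) (B x)
  rw [fderiv_cov_apply hΓ hS hB, fderiv_cov_apply hΓ hS hA, hL, hsymm (B x) (A x), hsnd, curv]
  simp only [map_add, map_sub, add_apply, sub_apply]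
  abel

variable [FiniteDimensional ℝ E]

/-- The Ricci tensor `r(u, w) = tr (v ↦ R(u, v) w)`. -/
def ricciForm (Γ : E → E →L[ℝ] E →L[ℝ] E) (x : E) : E →L[ℝ] E →L[ℝ] ℝ :=
  (LinearMap.mk₂ ℝ (fun u w ↦ ∑ i, (Module.finBasis ℝ E).repr
      (curv Γ x u (Module.finBasis ℝ E i) w) i)
    (by intros; simp only [curv, map_add, map_sub, add_apply, Finsupp.add_apply,
          Finsupp.sub_apply, ← Finset.sum_add_distrib]
        exact Finset.sum_congr rfl fun i _ ↦ by ring)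
    (by intros; simp only [curv, map_smul, smul_apply, map_add, map_sub, Finsupp.add_apply,
          Finsupp.sub_apply, Finsupp.smul_apply, smul_eq_mul, Finset.mul_sum]
        exact Finset.sum_congr rfl fun i _ ↦ by ring)
    (by intros; simp only [curv, map_add, map_sub, Finsupp.add_apply,
          Finsupp.sub_apply, ← Finset.sum_add_distrib]
        exact Finset.sum_congr rfl fun i _ ↦ by ring)
    (by intros; simp only [curv, map_smul, map_add, map_sub, Finsupp.add_apply,
          Finsupp.sub_apply, Finsupp.smul_apply, smul_eq_mul, Finset.mul_sum]
        exact Finset.sum_congr rfl fun i _ ↦ by ring)).toContinuousBilinearMap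

lemma ricciForm_apply (Γ : E → E →L[ℝ] E →L[ℝ] E) (x u w : E) : ricciForm Γ x u w =
    ∑ i, (Module.finBasis ℝ E).repr (curv Γ x u (Module.finBasis ℝ E i) w) i := rfl

lemma ricciForm_eq_trace {Γ : E → E →L[ℝ] E →L[ℝ] E} {x u w : E} {f : E →ₗ[ℝ] E}
    (hf : ∀ v, f v = curv Γ x u v w) : ricciForm Γ x u w = LinearMap.trace ℝ E f := by
  rw [LinearMap.trace_eq_matrix_trace ℝ (Module.finBasis ℝ E), ricciForm_apply]
  simp [Matrix.trace, LinearMap.toMatrix_apply, hf]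

lemma differentiableOn_ricciForm {Γ : E → E →L[ℝ] E →L[ℝ] E} {U : Set E} (hU : IsOpen U)
    (hΓ : ContDiffOn ℝ ∞ Γ U) : DifferentiableOn ℝ (ricciForm Γ) U := by
  refine ContDiffOn.differentiableOn (n := ∞) ?_ (by simp)
  refine contDiffOn_clm_apply.2 fun u ↦ contDiffOn_clm_apply.2 fun w ↦ ?_
  simp only [ricciForm_apply]
  have hD : ContDiffOn ℝ ∞ (fderiv ℝ Γ) U := hΓ.fderiv_of_isOpen hU (by simp)
  have hc : ∀ v, ContDiffOn ℝ ∞ (fun x ↦ curv Γ x u v w) U := fun v ↦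
    ((((hD.clm_apply contDiffOn_const).clm_apply contDiffOn_const).clm_apply
      contDiffOn_const).sub (((hD.clm_apply contDiffOn_const).clm_apply
      contDiffOn_const).clm_apply contDiffOn_const)).add ((hΓ.clm_apply contDiffOn_const).clm_apply
      ((hΓ.clm_apply contDiffOn_const).clm_apply contDiffOn_const)) |>.sub
      ((hΓ.clm_apply contDiffOn_const).clm_apply
      ((hΓ.clm_apply contDiffOn_const).clm_apply contDiffOn_const))
  refine ContDiffOn.sum fun i _ ↦ ?_
  exact (LinearMap.toContinuousLinearMap ((Module.finBasis ℝ E).coord i)).contDiff.comp_contDiffOn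
    (hc (Module.finBasis ℝ E i))

end LocalConnection

namespace SymplecticConnection

open LocalConnection

universe u v
variable {E : Type u} [NormedAddCommGroup E] [NormedSpace ℝ E] [FiniteDimensional ℝ E]
  {M : Type v} [TopologicalSpace M] [ChartedSpace E M] [IsManifold 𝓘(ℝ, E) ∞ M] {p y : M}

lemma mlieBracket_eq_lieBracket {E : Type*} [NormedAddCommGroup E] [NormedSpace ℝ E]
    (V W : Π x : E, TangentSpace 𝓘(ℝ, E) x) (x : E) :
    VectorField.mlieBracket 𝓘(ℝ, E) V W x = VectorField.lieBracket ℝ V W x := by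
  rw [← VectorField.mlieBracketWithin_univ,
    VectorField.mlieBracketWithin_eq_lieBracketWithin]
  exact congrFun VectorField.lieBracketWithin_univ x

/-- These fields are pullbacks of constant fields under the chart, and pullback commutes with the
bracket. -/
lemma mlieBracket_constField (hy : y ∈ (extChartAt 𝓘(ℝ, E) p).source) (u v : E) :
    VectorField.mlieBracket 𝓘(ℝ, E) (constField p u) (constField p v) y = 0 := by
  have : IsManifold 𝓘(ℝ, E) (minSmoothness ℝ 2) M := by
    rw [minSmoothness_of_isRCLikeNormedField]
    infer_instance
  have h : ∀ c : E, constField p c =ᶠ[𝓝 y] VectorField.mpullback 𝓘(ℝ, E) 𝓘(ℝ, E)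
      (extChartAt 𝓘(ℝ, E) p) (fun _ ↦ c) := fun c ↦ by
    refine (eventually_mem_source hy).mono fun z hz ↦ ?_
    have h1 : (mfderiv 𝓘(ℝ, E) 𝓘(ℝ, E) (extChartAt 𝓘(ℝ, E) p) z).inverse =
        (trivializationAt E (TangentSpace 𝓘(ℝ, E) : M → Type _) p).symmL ℝ z := by
      rw [← chartCoord_eq_mfderiv hz]
      exact ContinuousLinearMap.inverse_eq (by ext c; exact chartCoord_constField hz c)
        (by ext v; exact constField_chartCoord hz v)
    exact (congrArg (fun L ↦ L c) h1).symm
  have hc : ∀ c : E, MDifferentiableAt 𝓘(ℝ, E) (𝓘(ℝ, E).prod 𝓘(ℝ, E))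
      (fun x : E ↦ (⟨x, c⟩ : TangentBundle 𝓘(ℝ, E) E)) (extChartAt 𝓘(ℝ, E) p y) := fun c ↦
    ((contMDiffAt_vectorSpace_iff_contDiffAt (n := 1)
      (V := fun _ : E ↦ (c : E))).2 contDiffAt_const).mdifferentiableAt one_ne_zero
  rw [(h u).mlieBracket_vectorField_eq (h v),
    ← VectorField.mpullback_mlieBracket (n := ∞) (hc u) (hc v)
      (contMDiffAt_extChartAt' (by simpa using hy))
      (by rw [minSmoothness_of_isRCLikeNormedField]; exact ENat.LEInfty.out),
    VectorField.mpullback_apply]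
  have h0 : VectorField.lieBracket ℝ (fun _ : E ↦ u) (fun _ ↦ v) (extChartAt 𝓘(ℝ, E) p y) = 0 := by
    simp [VectorField.lieBracket]
  exact (congrArg _ ((mlieBracket_eq_lieBracket _ _ _).trans h0)).trans (map_zero _)

variable (cov : CovariantDerivative 𝓘(ℝ, E) E (TangentSpace 𝓘(ℝ, E) : M → Type _))

lemma christoffel_symm (hT : cov.torsion = 0) {x : E} (hx : x ∈ (extChartAt 𝓘(ℝ, E) p).target)
    (u v : E) : christoffel p cov x u v = christoffel p cov x v u := by
  have hy := (extChartAt 𝓘(ℝ, E) p).map_target hx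
  have h := cov.torsion_eq_zero_iff.1 hT (mdifferentiableAt_constField hy u)
    (mdifferentiableAt_constField hy v)
  rw [mlieBracket_constField hy, sub_eq_zero] at h
  rw [christoffel_eq cov hx, christoffel_eq cov hx, localRep, localRep, h]

lemma localRep_cov {s X : Π x : M, TangentSpace 𝓘(ℝ, E) x}
    (hy : y ∈ (extChartAt 𝓘(ℝ, E) p).source) (hs : ∀ᶠ z in 𝓝 y, MDiffAt (T% s) z) :
    localRep p (fun z ↦ cov s z (X z)) =ᶠ[𝓝 (extChartAt 𝓘(ℝ, E) p y)] fun x ↦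
      fderiv ℝ (localRep p s) x (localRep p X x) +
        christoffel p cov x (localRep p X x) (localRep p s x) := by
  have hx := (extChartAt 𝓘(ℝ, E) p).map_source hy
  filter_upwards [eventually_chart hy hs, eventually_chart_mem_target hx] with x h1 h2
  rw [localRep, chartCoord_cov cov ((extChartAt 𝓘(ℝ, E) p).map_target h2) h1,
    (extChartAt 𝓘(ℝ, E) p).right_inv h2]
  rfl

/-- Vanishing torsion replaces [X, Y] by ∇_X Y - ∇_Y X, so no coordinate formula for the bracket of
general fields is required. -/
theorem chartCoord_curvatureField [T2Space M]
    [CovariantDerivative.ContMDiffCovariantDerivative cov ∞] (hT : cov.torsion = 0)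
    {X Y Z : Π x : M, TangentSpace 𝓘(ℝ, E) x} {V : Set M} (hV : IsOpen V) (hyV : y ∈ V)
    (hX : CMDiff[V] ∞ (T% X)) (hY : CMDiff[V] ∞ (T% Y)) (hZ : CMDiff[V] ∞ (T% Z))
    (hy : y ∈ (extChartAt 𝓘(ℝ, E) p).source) :
    chartCoord p y (curvatureField cov X Y Z y) =
      curv (christoffel p cov) (extChartAt 𝓘(ℝ, E) p y) (chartCoord p y (X y))
        (chartCoord p y (Y y)) (chartCoord p y (Z y)) := by
  have hx := (extChartAt 𝓘(ℝ, E) p).map_source hy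
  have hat : ∀ {s : Π x : M, TangentSpace 𝓘(ℝ, E) x}, CMDiff[V] ∞ (T% s) →
      CMDiffAt ∞ (T% s) y := fun h ↦ h.contMDiffAt (hV.mem_nhds hyV)
  have hrep : ∀ {s : Π x : M, TangentSpace 𝓘(ℝ, E) x}, CMDiff[V] ∞ (T% s) →
      ContDiffAt ℝ ∞ (localRep p s) (extChartAt 𝓘(ℝ, E) p y) := fun h ↦
    (contMDiffAt_field_iff hy).1 (hat h)
  have hZd : ∀ᶠ z in 𝓝 y, MDiffAt (T% Z) z := by
    filter_upwards [hV.mem_nhds hyV] with z hz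
    exact (hZ.contMDiffAt (hV.mem_nhds hz)).mdifferentiableAt (by simp)
  have hcd : ∀ {s : Π x : M, TangentSpace 𝓘(ℝ, E) x}, CMDiff[V] ∞ (T% s) →
      MDiffAt (T% (fun z ↦ cov Z z (s z))) y := fun h ↦
    (contMDiffAt_cov cov hV hZ hyV (hat h)).mdifferentiableAt (by simp)
  have hd : ∀ {s : Π x : M, TangentSpace 𝓘(ℝ, E) x}, CMDiff[V] ∞ (T% s) → MDiffAt (T% s) y :=
    fun h ↦ (hat h).mdifferentiableAt (by simp)
  have hΓ : DifferentiableAt ℝ (christoffel p cov) (extChartAt 𝓘(ℝ, E) p y) :=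
    ((contDiffOn_christoffel cov).contDiffAt
      ((isOpen_extChartAt_target p).mem_nhds hx)).differentiableAt (by simp)
  have hbr := congrArg (chartCoord p y) (cov.torsion_eq_zero_iff.1 hT (hd hX) (hd hY))
  rw [map_sub, chartCoord_cov cov hy (hd hX), chartCoord_cov cov hy (hd hY)] at hbr
  simp only [← localRep_extChartAt hy] at hbr ⊢
  rw [← curv_eq_commutator (christoffel_symm cov hT hx) hΓ (hrep hZ)
    ((hrep hX).differentiableAt (by simp)) ((hrep hY).differentiableAt (by simp)) hbr.symm]
  rw [localRep_extChartAt hy, curvatureField, map_sub, map_sub, chartCoord_cov cov hy (hcd hY),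
    chartCoord_cov cov hy (hcd hX),
    (localRep_cov cov (X := Y) hy hZd).fderiv_eq, (localRep_cov cov (X := X) hy hZd).fderiv_eq]
  simp only [chartCoord_cov cov hy (hd hZ), ← localRep_extChartAt hy]

/-- `curvature` at y extends vectors by fields constant in the trivialization at y, whereas the
chart here is the one at p. Tensoriality, implicit in the previous formula, bridges the two. -/
theorem chartCoord_curvature [T2Space M]
    [CovariantDerivative.ContMDiffCovariantDerivative cov ∞] (hT : cov.torsion = 0)
    (hy : y ∈ (extChartAt 𝓘(ℝ, E) p).source) (u v w : TangentSpace 𝓘(ℝ, E) y) :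
    chartCoord p y (curvature cov y u v w) =
      curv (christoffel p cov) (extChartAt 𝓘(ℝ, E) p y) (chartCoord p y u)
        (chartCoord p y v) (chartCoord p y w) := by
  rw [curvature, chartCoord_curvatureField cov hT
    (trivializationAt E (TangentSpace 𝓘(ℝ, E) : M → Type _) y).open_baseSet
    (FiberBundle.mem_baseSet_trivializationAt' y) (contMDiffOn_constField y _)
    (contMDiffOn_constField y _) (contMDiffOn_constField y _) hy]
  simp only [constField_coord]

theorem ricci_eq_ricciForm [T2Space M]
    [CovariantDerivative.ContMDiffCovariantDerivative cov ∞] (hT : cov.torsion = 0)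
    (hy : y ∈ (extChartAt 𝓘(ℝ, E) p).source) (u w : TangentSpace 𝓘(ℝ, E) y) :
    ricci cov y u w = ricciForm (christoffel p cov) (extChartAt 𝓘(ℝ, E) p y) (chartCoord p y u)
      (chartCoord p y w) := by
  let e : TangentSpace 𝓘(ℝ, E) y ≃ₗ[ℝ] E := LinearEquiv.ofLinearMap (chartCoord p y).toLinearMap
    ((trivializationAt E (TangentSpace 𝓘(ℝ, E) : M → Type _) p).symmL ℝ y).toLinearMap
    (by ext c; exact chartCoord_constField hy c) (by ext v; exact constField_chartCoord hy v)
  rw [ricci, ← LinearMap.trace_conj' _ e]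
  refine (ricciForm_eq_trace fun c ↦ ?_).symm
  have h := chartCoord_curvature cov hT hy u (constField p c y) w
  rw [chartCoord_constField hy] at h
  exact h

end SymplecticConnection

namespace SymplecticConnection

open LocalConnection

universe u v
variable {E : Type u} [NormedAddCommGroup E] [NormedSpace ℝ E]
  {M : Type v} [TopologicalSpace M] [ChartedSpace E M] [IsManifold 𝓘(ℝ, E) ∞ M] {p y : M}
  {Ω : Π x : M, TangentSpace 𝓘(ℝ, E) x →L[ℝ] TangentSpace 𝓘(ℝ, E) x →L[ℝ] ℝ}

/-! ### Connections of Ricci type in a chart -/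

lemma IsSymplecticForm.contMDiffAt_apply (h : IsSymplecticForm Ω)
    {X Y : Π x : M, TangentSpace 𝓘(ℝ, E) x} (hX : CMDiffAt ∞ (T% X) y)
    (hY : CMDiffAt ∞ (T% Y) y) : CMDiffAt ∞ (fun z ↦ Ω z (X z) (Y z)) y := by
  have : ContMDiffAt 𝓘(ℝ, E) (𝓘(ℝ, E).prod 𝓘(ℝ)) ∞
      (fun z ↦ TotalSpace.mk' ℝ (E := Bundle.Trivial M ℝ) z (Ω z (X z) (Y z))) y := by
    apply ContMDiffAt.clm_bundle_apply₂ (F₁ := E) (F₂ := E)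
    · exact h.contMDiff y
    · exact hX
    · exact hY
  simp only [contMDiffAt_totalSpace] at this
  exact this.2

variable [FiniteDimensional ℝ E]

variable (p Ω) in
/-- The coordinate expression of a field of bilinear forms in the preferred chart at `p`. -/
def localForm (x : E) : E →L[ℝ] E →L[ℝ] ℝ :=
  (LinearMap.mk₂ ℝ (fun u v ↦ Ω ((extChartAt 𝓘(ℝ, E) p).symm x)
      (constField p u ((extChartAt 𝓘(ℝ, E) p).symm x))
      (constField p v ((extChartAt 𝓘(ℝ, E) p).symm x)))
    (by intros; simp only [constField, map_add, add_apply])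
    (by intros; simp only [constField, map_smul, smul_apply])
    (by intros; simp only [constField, map_add])
    (by intros; simp only [constField, map_smul])).toContinuousBilinearMap

lemma localForm_apply (x u v : E) : localForm p Ω x u v =
    ((fun y ↦ Ω y (constField p u y) (constField p v y)) ∘ (extChartAt 𝓘(ℝ, E) p).symm) x := rfl

lemma localForm_chartCoord (hy : y ∈ (extChartAt 𝓘(ℝ, E) p).source)
    (u v : TangentSpace 𝓘(ℝ, E) y) :
    localForm p Ω (extChartAt 𝓘(ℝ, E) p y) (chartCoord p y u) (chartCoord p y v) = Ω y u v := by
  rw [localForm_apply, Function.comp_apply, (extChartAt 𝓘(ℝ, E) p).left_inv hy,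
    constField_chartCoord hy, constField_chartCoord hy]

lemma IsSymplecticForm.contDiffOn_localForm (h : IsSymplecticForm Ω) :
    ContDiffOn ℝ ∞ (localForm p Ω) (extChartAt 𝓘(ℝ, E) p).target := by
  refine contDiffOn_clm_apply.2 fun u ↦ contDiffOn_clm_apply.2 fun v x hx ↦ ?_
  have hy := (extChartAt 𝓘(ℝ, E) p).map_target hx
  have h1 := (contMDiffAt_iff_chart hy).1 (h.contMDiffAt_apply
    (contMDiffAt_constField_of_mem hy u) (contMDiffAt_constField_of_mem hy v))
  rw [(extChartAt 𝓘(ℝ, E) p).right_inv hx] at h1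
  exact h1.contDiffWithinAt

variable (cov : CovariantDerivative 𝓘(ℝ, E) E (TangentSpace 𝓘(ℝ, E) : M → Type _))

/-- Parallelism is available for globally smooth fields only, so the coordinate fields are first
replaced by global ones that agree with them near y. -/
lemma fderiv_localForm [T2Space M] (h : IsSymplecticForm Ω) (hP : IsParallel cov Ω) {x : E}
    (hx : x ∈ (extChartAt 𝓘(ℝ, E) p).target) (a u v : E) :
    fderiv ℝ (localForm p Ω) x a u v = localForm p Ω x (christoffel p cov x a u) v +
      localForm p Ω x u (christoffel p cov x a v) := by
  obtain ⟨y, hy, rfl⟩ : ∃ y ∈ (extChartAt 𝓘(ℝ, E) p).source, extChartAt 𝓘(ℝ, E) p y = x :=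
    ⟨_, (extChartAt 𝓘(ℝ, E) p).map_target hx, (extChartAt 𝓘(ℝ, E) p).right_inv hx⟩
  have hext : ∀ c, ∃ s' : Π x : M, TangentSpace 𝓘(ℝ, E) x, CMDiff ∞ (T% s') ∧
      ∀ᶠ z in 𝓝 y, s' z = constField p c z := fun c ↦
    exists_contMDiff_eventuallyEq
      (trivializationAt E (TangentSpace 𝓘(ℝ, E) : M → Type _) p).open_baseSet
      (contMDiffOn_constField p c) (by simpa using hy)
  obtain ⟨Y, hY, hYe⟩ := hext u
  obtain ⟨Z, hZ, hZe⟩ := hext v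
  have hcov : ∀ {s : Π x : M, TangentSpace 𝓘(ℝ, E) x} {c : E}, CMDiff ∞ (T% s) →
      (∀ᶠ z in 𝓝 y, s z = constField p c z) → ∀ a,
      cov s y (constField p a y) =
        constField p (christoffel p cov (extChartAt 𝓘(ℝ, E) p y) a c) y := by
    intro s c hs he a
    rw [cov.isCovariantDerivativeOnUniv.congr_of_eventuallyEq
      (hs.mdifferentiable (by simp) y) (mdifferentiableAt_constField hy c) univ_mem he,
      christoffel_eq cov hx, localRep_extChartAt hy, constField_chartCoord hy]
  have h1 := hP Y Z hY hZ y (constField p a y)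
  have hmd : MDiffAt (fun z ↦ Ω z (Y z) (Z z)) y :=
    (h.contMDiffAt_apply hY.contMDiffAt hZ.contMDiffAt).mdifferentiableAt (by simp)
  rw [hcov hY hYe, hcov hZ hZe, hYe.self_of_nhds, hZe.self_of_nhds,
    mvfderiv_eq_fderiv_chart hy hmd, chartCoord_constField hy] at h1
  have he : (fun z ↦ Ω z (Y z) (Z z)) ∘ (extChartAt 𝓘(ℝ, E) p).symm
      =ᶠ[𝓝 (extChartAt 𝓘(ℝ, E) p y)] fun x ↦ localForm p Ω x u v := by
    filter_upwards [eventually_chart hy hYe, eventually_chart hy hZe] with x h1 h2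
    rw [localForm_apply, Function.comp_apply, h1, h2, Function.comp_apply]
  have hd : DifferentiableAt ℝ (localForm p Ω) (extChartAt 𝓘(ℝ, E) p y) :=
    (h.contDiffOn_localForm.contDiffAt
      ((isOpen_extChartAt_target p).mem_nhds hx)).differentiableAt (by simp)
  have hd' := (hd.hasFDerivAt.clm_apply (hasFDerivAt_const u _)).clm_apply (hasFDerivAt_const v _)
  rw [he.fderiv_eq, hd'.fderiv] at h1
  simp only [← localForm_chartCoord (p := p) hy, chartCoord_constField hy] at h1
  rw [← h1]
  simp

/-- A connection of Ricci type in a chart. -/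
theorem isRicciTypeOn [T2Space M] [CovariantDerivative.ContMDiffCovariantDerivative cov ∞]
    (hF : IsFedosov cov Ω) (hR : IsRicciType cov Ω) (p : M) :
    IsRicciTypeOn (extChartAt 𝓘(ℝ, E) p).target (christoffel p cov) (localForm p Ω)
      (ricciForm (christoffel p cov)) (1 / ((Module.finrank ℝ E : ℝ) + 2)) where
  isOpen := isOpen_extChartAt_target p
  contDiffOn := contDiffOn_christoffel cov
  symm x hx u v := christoffel_symm cov hF.torsion_free hx u v
  differentiableOn_form := hF.symplectic.contDiffOn_localForm.differentiableOn (by simp)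
  differentiableOn_ricci := differentiableOn_ricciForm (isOpen_extChartAt_target p)
    (contDiffOn_christoffel cov)
  parallel x hx a u v := fderiv_localForm cov hF.symplectic hF.parallel hx a u v
  alternating x _ v := hF.symplectic.alternating _ _
  nondegenerate x hx v h := by
    have hy := (extChartAt 𝓘(ℝ, E) p).map_target hx
    have h1 := hF.symplectic.nondegenerate _ (constField p v ((extChartAt 𝓘(ℝ, E) p).symm x))
      fun w ↦ by
        have h2 := h (chartCoord p _ w)
        rwa [localForm_apply, Function.comp_apply, constField_chartCoord hy] at h2
    rw [← chartCoord_constField hy v, h1, map_zero]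
  ne_zero := by positivity
  ricci x hx u v w z := by
    obtain ⟨y, hy, rfl⟩ : ∃ y ∈ (extChartAt 𝓘(ℝ, E) p).source, extChartAt 𝓘(ℝ, E) p y = x :=
      ⟨_, (extChartAt 𝓘(ℝ, E) p).map_target hx, (extChartAt 𝓘(ℝ, E) p).right_inv hx⟩
    have h := hR y (constField p u y) (constField p v y) (constField p w y) (constField p z y)
    rw [← localForm_chartCoord hy, chartCoord_curvature cov hF.torsion_free hy] at h
    simp only [ricciPart, ← localForm_chartCoord (p := p) hy,
      ricci_eq_ricciForm cov hF.torsion_free hy, chartCoord_constField hy] at h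
    exact h

end SymplecticConnection

lemma ContDiffAt.deriv_infty {F : Type*} [NormedAddCommGroup F] [NormedSpace ℝ F] {f : ℝ → F}
    {t : ℝ} (h : ContDiffAt ℝ ∞ f t) : ContDiffAt ℝ ∞ (deriv f) t :=
  (h.fderiv_right (m := ∞) (by simp)).clm_apply contDiffAt_const

lemma ContinuousAt.eventually_ne_of_continuousAt {X Y : Type*} [TopologicalSpace X]
    [TopologicalSpace Y] [T2Space Y] {f g : X → Y} {x : X} (hf : ContinuousAt f x)
    (hg : ContinuousAt g x) (h : f x ≠ g x) : ∀ᶠ z in 𝓝 x, f z ≠ g z :=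
  (hf.prodMk hg).eventually (isClosed_diagonal.isOpen_compl.mem_nhds h)

namespace SymplecticConnection

open LocalConnection

universe u v
variable {E : Type u} [NormedAddCommGroup E] [NormedSpace ℝ E]
  {M : Type v} [TopologicalSpace M] [ChartedSpace E M] [IsManifold 𝓘(ℝ, E) ∞ M] {p y q : M}

/-! ### Geodesics in a chart -/

lemma chartCoord_velocity {γ : ℝ → M} {t : ℝ} (ht : γ t ∈ (extChartAt 𝓘(ℝ, E) p).source)
    (hγ : MDifferentiableAt 𝓘(ℝ, ℝ) 𝓘(ℝ, E) γ t) :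
    chartCoord p (γ t) (velocity γ t) = deriv (extChartAt 𝓘(ℝ, E) p ∘ γ) t := by
  have h2 : MDifferentiableAt 𝓘(ℝ, E) 𝓘(ℝ, E) (extChartAt 𝓘(ℝ, E) p) (γ t) :=
    mdifferentiableAt_extChartAt (by simpa using ht)
  have h := mfderiv_comp t h2 hγ
  rw [mfderiv_eq_fderiv] at h
  rw [chartCoord_eq_mfderiv ht]
  exact (congrArg (fun L : ℝ →L[ℝ] E ↦ L 1) h).symm.trans fderiv_apply_one_eq_deriv

lemma contDiffAt_chart_comp {γ : ℝ → M} {t : ℝ} (ht : γ t ∈ (extChartAt 𝓘(ℝ, E) p).source)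
    (hγ : ContMDiffAt 𝓘(ℝ, ℝ) 𝓘(ℝ, E) ∞ γ t) :
    ContDiffAt ℝ ∞ (extChartAt 𝓘(ℝ, E) p ∘ γ) t :=
  contMDiffAt_iff_contDiffAt.1
    ((contMDiffAt_extChartAt' (n := ∞) (by simpa using ht)).comp t hγ)

lemma chartCoord_self (v : TangentSpace 𝓘(ℝ, E) p) : chartCoord p p v = (v : E) := by
  rw [chartCoord_eq_mfderiv (mem_extChartAt_source p), mfderiv_extChartAt_self]
  rfl

/-- At p itself `chartCoord p` is the identity of E, so coordinates determine the vector once the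
base points agree. -/
lemma tangentBundle_ext {y : M} (hy : y = p) {w : TangentSpace 𝓘(ℝ, E) y}
    {v : TangentSpace 𝓘(ℝ, E) p} (h : chartCoord p y w = (v : E)) :
    (⟨y, w⟩ : TangentBundle 𝓘(ℝ, E) M) = ⟨p, v⟩ := by
  subst hy
  rw [chartCoord_self] at h
  exact congrArg _ h

variable [FiniteDimensional ℝ E]
variable (cov : CovariantDerivative 𝓘(ℝ, E) E (TangentSpace 𝓘(ℝ, E) : M → Type _))

/-- The change of trivialization of the tangent bundle, in the preferred chart at `p`. -/
lemma exists_coordChange (p q : M) : ∃ D : E → E →L[ℝ] E,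
    (∀ x c, D x c = localRep p (constField q c) x) ∧
    ∀ y ∈ (extChartAt 𝓘(ℝ, E) p).source ∩ (extChartAt 𝓘(ℝ, E) q).source,
      DifferentiableAt ℝ D (extChartAt 𝓘(ℝ, E) p y) := by
  let D : E → E →L[ℝ] E := fun x ↦ LinearMap.toContinuousLinearMap
    { toFun := fun c ↦ localRep p (constField q c) x
      map_add' := fun c d ↦ by simp only [localRep, constField, map_add]
      map_smul' := fun a c ↦ by simp only [localRep, constField, map_smul, RingHom.id_apply] }
  refine ⟨D, fun _ _ ↦ rfl, fun y hy ↦ ?_⟩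
  have hW := (continuousOn_extChartAt_symm (I := 𝓘(ℝ, E)) p).isOpen_inter_preimage
    (isOpen_extChartAt_target p) (isOpen_extChartAt_source (I := 𝓘(ℝ, E)) q)
  have hD : ContDiffOn ℝ ∞ D ((extChartAt 𝓘(ℝ, E) p).target ∩
      (extChartAt 𝓘(ℝ, E) p).symm ⁻¹' (extChartAt 𝓘(ℝ, E) q).source) := by
    refine contDiffOn_clm_apply.2 fun c x hx ↦ ?_
    have h := (contMDiffAt_field_iff ((extChartAt 𝓘(ℝ, E) p).map_target hx.1)).1
      (contMDiffAt_constField_of_mem hx.2 c)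
    rw [(extChartAt 𝓘(ℝ, E) p).right_inv hx.1] at h
    exact h.contDiffWithinAt
  refine (hD.contDiffAt (hW.mem_nhds ⟨(extChartAt 𝓘(ℝ, E) p).map_source hy.1, ?_⟩)).differentiableAt
    (by simp)
  rw [mem_preimage, (extChartAt 𝓘(ℝ, E) p).left_inv hy.1]
  exact hy.2

/-- The covariant derivative along a curve in a chart. -/
theorem chartCoord_covAlong {γ : ℝ → M} {V : Π t : ℝ, TangentSpace 𝓘(ℝ, E) (γ t)} {t : ℝ}
    (ht : γ t ∈ (extChartAt 𝓘(ℝ, E) p).source)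
    (hγ : MDifferentiableAt 𝓘(ℝ, ℝ) 𝓘(ℝ, E) γ t)
    (hV : DifferentiableAt ℝ (fun s ↦ chartCoord (γ t) (γ s) (V s)) t) :
    chartCoord p (γ t) (covAlong cov γ V t) =
      deriv (fun s ↦ chartCoord p (γ s) (V s)) t +
        christoffel p cov (extChartAt 𝓘(ℝ, E) p (γ t)) (deriv (extChartAt 𝓘(ℝ, E) p ∘ γ) t)
          (chartCoord p (γ t) (V t)) := by
  have hq : γ t ∈ (extChartAt 𝓘(ℝ, E) (γ t)).source := mem_extChartAt_source _
  -- `covAlong` at time t uses the trivialization at γ t. D translates it to the one at p, and its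
  -- derivative along γ is absorbed by the coordinate formula for the covariant derivative of the
  -- frame.
  obtain ⟨D, hD, hDd⟩ := exists_coordChange (E := E) p (γ t)
  have hD' := (hDd (γ t) ⟨ht, hq⟩).hasFDerivAt
  have hφ : HasDerivAt (extChartAt 𝓘(ℝ, E) p ∘ γ) (deriv (extChartAt 𝓘(ℝ, E) p ∘ γ) t) t := by
    have h2 : MDifferentiableAt 𝓘(ℝ, E) 𝓘(ℝ, E) (extChartAt 𝓘(ℝ, E) p) (γ t) :=
      mdifferentiableAt_extChartAt (by simpa using ht)
    exact (mdifferentiableAt_iff_differentiableAt.1 (h2.comp t hγ)).hasDerivAt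
  have hDγ : HasDerivAt (fun s ↦ D (extChartAt 𝓘(ℝ, E) p (γ s)))
      (fderiv ℝ D (extChartAt 𝓘(ℝ, E) p (γ t)) (deriv (extChartAt 𝓘(ℝ, E) p ∘ γ) t)) t :=
    HasFDerivAt.comp_hasDerivAt (f := extChartAt 𝓘(ℝ, E) p ∘ γ) t hD' hφ
  have hprod := hDγ.clm_apply hV.hasDerivAt
  have he : (fun s ↦ chartCoord p (γ s) (V s)) =ᶠ[𝓝 t]
      fun s ↦ D (extChartAt 𝓘(ℝ, E) p (γ s)) (chartCoord (γ t) (γ s) (V s)) := by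
    filter_upwards [hγ.continuousAt.eventually (eventually_mem_source ht),
      hγ.continuousAt.eventually (eventually_mem_source hq)] with s h1 h2
    rw [hD, localRep_extChartAt h1, constField_chartCoord h2]
  rw [he.deriv_eq, hprod.deriv, covAlong, map_add]
  have hc := chartCoord_cov cov ht (mdifferentiableAt_constField (p := γ t) hq
    (chartCoord (γ t) (γ t) (V t))) (velocity γ t)
  have h1 : localRep p (constField (γ t) (chartCoord (γ t) (γ t) (V t))) =
      fun x ↦ D x (chartCoord (γ t) (γ t) (V t)) := funext fun x ↦ (hD x _).symm
  rw [h1, (hD'.clm_apply (hasFDerivAt_const _ _)).fderiv, chartCoord_velocity ht hγ,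
    constField_chartCoord hq] at hc
  have h2 : ∀ c, D (extChartAt 𝓘(ℝ, E) p (γ t)) c = chartCoord p (γ t) (constField (γ t) c (γ t)) :=
    fun c ↦ by rw [hD, localRep_extChartAt ht]
  refine (congrArg₂ (· + ·) (h2 _).symm hc).trans ?_
  simp only [ContinuousLinearMap.comp_zero, zero_add, ContinuousLinearMap.flip_apply]
  exact (add_assoc _ _ _).symm.trans (congrArg (· + _) (add_comm _ _))

lemma chartCoord_covAlong_velocity {γ : ℝ → M} {t : ℝ}
    (ht : γ t ∈ (extChartAt 𝓘(ℝ, E) p).source)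
    (hγ : ∀ᶠ s in 𝓝 t, ContMDiffAt 𝓘(ℝ, ℝ) 𝓘(ℝ, E) ∞ γ s) :
    chartCoord p (γ t) (covAlong cov γ (velocity γ) t) =
      deriv (deriv (extChartAt 𝓘(ℝ, E) p ∘ γ)) t +
        christoffel p cov (extChartAt 𝓘(ℝ, E) p (γ t)) (deriv (extChartAt 𝓘(ℝ, E) p ∘ γ) t)
          (deriv (extChartAt 𝓘(ℝ, E) p ∘ γ) t) := by
  have hd : ∀ᶠ s in 𝓝 t, MDifferentiableAt 𝓘(ℝ, ℝ) 𝓘(ℝ, E) γ s :=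
    hγ.mono fun s hs ↦ hs.mdifferentiableAt (by simp)
  have hvel : ∀ p' : M, γ t ∈ (extChartAt 𝓘(ℝ, E) p').source →
      (fun s ↦ chartCoord p' (γ s) (velocity γ s)) =ᶠ[𝓝 t]
        deriv (extChartAt 𝓘(ℝ, E) p' ∘ γ) := fun p' hp' ↦ by
    filter_upwards [hd.self_of_nhds.continuousAt.eventually (eventually_mem_source hp'), hd]
      with s h1 h2 using chartCoord_velocity h1 h2
  have hq : γ t ∈ (extChartAt 𝓘(ℝ, E) (γ t)).source := mem_extChartAt_source _
  rw [chartCoord_covAlong cov ht hd.self_of_nhds, (hvel p ht).deriv_eq,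
    chartCoord_velocity ht hd.self_of_nhds]
  refine (hvel _ hq).differentiableAt_iff.2 ?_
  exact (contDiffAt_chart_comp hq hγ.self_of_nhds).deriv_infty.differentiableAt (by simp)

/-- A geodesic solves the geodesic equation in a chart. -/
lemma IsGeodesicOn.hasDerivAt_chart {cov} {γ : ℝ → M} {J : Set ℝ} (h : IsGeodesicOn cov γ J)
    (hJ : IsOpen J) {t : ℝ} (ht : t ∈ J) (hm : γ t ∈ (extChartAt 𝓘(ℝ, E) p).source) :
    HasDerivAt (fun s ↦ (extChartAt 𝓘(ℝ, E) p (γ s), deriv (extChartAt 𝓘(ℝ, E) p ∘ γ) s))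
      (spray (christoffel p cov)
        (extChartAt 𝓘(ℝ, E) p (γ t), deriv (extChartAt 𝓘(ℝ, E) p ∘ γ) t)) t := by
  have hs : ∀ s ∈ J, ContMDiffAt 𝓘(ℝ, ℝ) 𝓘(ℝ, E) ∞ γ s := fun s hs ↦
    h.1.contMDiffAt (hJ.mem_nhds hs)
  have hc := contDiffAt_chart_comp hm (hs t ht)
  have h1 := chartCoord_covAlong_velocity cov hm
    (Filter.mem_of_superset (hJ.mem_nhds ht) hs)
  rw [h.2 t ht, map_zero] at h1
  have h2 : deriv (deriv (extChartAt 𝓘(ℝ, E) p ∘ γ)) t = -christoffel p cov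
      (extChartAt 𝓘(ℝ, E) p (γ t)) (deriv (extChartAt 𝓘(ℝ, E) p ∘ γ) t)
        (deriv (extChartAt 𝓘(ℝ, E) p ∘ γ) t) := eq_neg_of_add_eq_zero_left h1.symm
  have h3 := ((hc.differentiableAt (by simp)).hasDerivAt).prodMk
    ((hc.deriv_infty.differentiableAt (by simp)).hasDerivAt)
  rw [h2] at h3
  exact h3

/-! ### The geodesic flow in a chart and the exponential map -/

section Flow

variable {cov} {δ : ℝ} {Z : ℝ × E → E × E}

/-- The curves in `M` given by a local flow of the geodesic equation. -/
lemma isGeodesicOn_flow (hZ : IsGeodesicFlow (extChartAt 𝓘(ℝ, E) p).target (christoffel p cov)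
      (extChartAt 𝓘(ℝ, E) p p) δ Z) {v : E} (hv : v ∈ Metric.ball (0 : E) δ) :
    IsGeodesicOn cov (fun t ↦ (extChartAt 𝓘(ℝ, E) p).symm (Z (t, v)).1) (Ioo (-2) 2) := by
  have hd : ∀ t ∈ Ioo (-2 : ℝ) 2, HasDerivAt (fun t ↦ (Z (t, v)).1) (Z (t, v)).2 t :=
    fun t ht ↦ (hZ.hasDerivAt t ht v hv).hasFDerivAt.fst.hasDerivAt.congr_deriv (by simp [spray])
  have hd2 : ∀ t ∈ Ioo (-2 : ℝ) 2, HasDerivAt (fun t ↦ (Z (t, v)).2)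
      (-christoffel p cov (Z (t, v)).1 (Z (t, v)).2 (Z (t, v)).2) t :=
    fun t ht ↦ (hZ.hasDerivAt t ht v hv).hasFDerivAt.snd.hasDerivAt.congr_deriv (by simp [spray])
  have hsm : ∀ t ∈ Ioo (-2 : ℝ) 2, ContMDiffAt 𝓘(ℝ, ℝ) 𝓘(ℝ, E) ∞
      (fun t ↦ (extChartAt 𝓘(ℝ, E) p).symm (Z (t, v)).1) t := fun t ht ↦ by
    have h1 : ContDiffAt ℝ ∞ (fun t ↦ (Z (t, v)).1) t :=
      contDiffAt_fst.comp t ((hZ.contDiffAt t ht v hv).comp t (contDiffAt_id.prodMk contDiffAt_const))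
    exact ((contMDiffOn_extChartAt_symm p).contMDiffAt
      ((isOpen_extChartAt_target p).mem_nhds (hZ.mem t ht v hv))).comp t h1.contMDiffAt
  refine ⟨fun t ht ↦ (hsm t ht).contMDiffWithinAt, fun t ht ↦ ?_⟩
  have hm := (extChartAt 𝓘(ℝ, E) p).map_target (hZ.mem t ht v hv)
  have hev : ∀ᶠ s in 𝓝 t, s ∈ Ioo (-2 : ℝ) 2 := isOpen_Ioo.mem_nhds ht
  have hφ : ∀ s ∈ Ioo (-2 : ℝ) 2, (extChartAt 𝓘(ℝ, E) p ∘
      fun t ↦ (extChartAt 𝓘(ℝ, E) p).symm (Z (t, v)).1) s = (Z (s, v)).1 := fun s hs ↦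
    (extChartAt 𝓘(ℝ, E) p).right_inv (hZ.mem s hs v hv)
  have hφ' : ∀ s ∈ Ioo (-2 : ℝ) 2, deriv (extChartAt 𝓘(ℝ, E) p ∘
      fun t ↦ (extChartAt 𝓘(ℝ, E) p).symm (Z (t, v)).1) s = (Z (s, v)).2 := fun s hs ↦ by
    rw [Filter.EventuallyEq.deriv_eq (f := fun t ↦ (Z (t, v)).1)
      (Filter.mem_of_superset (isOpen_Ioo.mem_nhds hs) hφ), (hd s hs).deriv]
  apply chartCoord_injective hm
  rw [chartCoord_covAlong_velocity cov hm (hev.mono hsm), map_zero,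
    Filter.EventuallyEq.deriv_eq (f := fun t ↦ (Z (t, v)).2) (hev.mono hφ'), (hd2 t ht).deriv,
    hφ' t ht, (extChartAt 𝓘(ℝ, E) p).right_inv (hZ.mem t ht v hv)]
  exact neg_add_cancel _

lemma geodesicReaches_flow (hZ : IsGeodesicFlow (extChartAt 𝓘(ℝ, E) p).target (christoffel p cov)
      (extChartAt 𝓘(ℝ, E) p p) δ Z) {v : E} (hv : v ∈ Metric.ball (0 : E) δ) :
    GeodesicReaches cov p (v : TangentSpace 𝓘(ℝ, E) p)
      ((extChartAt 𝓘(ℝ, E) p).symm (Z (1, v)).1) := by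
  have hg := isGeodesicOn_flow hZ hv
  have h0 : (0 : ℝ) ∈ Ioo (-2 : ℝ) 2 := by norm_num
  refine ⟨_, -2, 2, by norm_num, by norm_num, hg, ?_, rfl⟩
  have hm := (extChartAt 𝓘(ℝ, E) p).map_target (hZ.mem 0 h0 v hv)
  refine tangentBundle_ext (by simp [hZ.init v hv]) ?_
  rw [chartCoord_velocity hm ((hg.1.contMDiffAt (isOpen_Ioo.mem_nhds h0)).mdifferentiableAt
    (by simp))]
  have he : (extChartAt 𝓘(ℝ, E) p ∘ fun t ↦ (extChartAt 𝓘(ℝ, E) p).symm (Z (t, v)).1) =ᶠ[𝓝 0]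
      fun t ↦ (Z (t, v)).1 := by
    filter_upwards [isOpen_Ioo.mem_nhds h0] with s hs
    exact (extChartAt 𝓘(ℝ, E) p).right_inv (hZ.mem s hs v hv)
  have hd := (hZ.hasDerivAt 0 h0 v hv).hasFDerivAt.fst.hasDerivAt.deriv
  rw [he.deriv_eq, hd]
  simp [spray, hZ.init v hv]

/-- Geodesics with the same initial velocity agree. -/
lemma eq_of_geodesicReaches [T2Space M]
    [CovariantDerivative.ContMDiffCovariantDerivative cov ∞]
    (hZ : IsGeodesicFlow (extChartAt 𝓘(ℝ, E) p).target (christoffel p cov)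
      (extChartAt 𝓘(ℝ, E) p p) δ Z) {v : E} (hv : v ∈ Metric.ball (0 : E) δ)
    {q : M} (hq : GeodesicReaches cov p (v : TangentSpace 𝓘(ℝ, E) p) q) :
    q = (extChartAt 𝓘(ℝ, E) p).symm (Z (1, v)).1 := by
  obtain ⟨γ, a, b, ha, hb, hγ, hinit, rfl⟩ := hq
  set φ := extChartAt 𝓘(ℝ, E) p with hφ
  have hsub : ∀ t ∈ Ioo (max a (-2)) (min b 2), t ∈ Ioo (-2 : ℝ) 2 ∧ t ∈ Ioo a b := fun t ht ↦
    ⟨⟨(le_max_right _ _).trans_lt ht.1, ht.2.trans_le (min_le_right _ _)⟩,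
      ⟨(le_max_left _ _).trans_lt ht.1, ht.2.trans_le (min_le_left _ _)⟩⟩
  have hJ0 : (0 : ℝ) ∈ Ioo (max a (-2)) (min b 2) :=
    ⟨max_lt ha (by norm_num), lt_min (by linarith) (by norm_num)⟩
  have hJ1 : (1 : ℝ) ∈ Ioo (max a (-2)) (min b 2) :=
    ⟨max_lt (by linarith) (by norm_num), lt_min hb (by norm_num)⟩
  have hm : ∀ t ∈ Ioo (-2 : ℝ) 2, (Z (t, v)).1 ∈ φ.target := fun t ht ↦ hZ.mem t ht v hv
  have hsm : ∀ t ∈ Ioo a b, ContMDiffAt 𝓘(ℝ, ℝ) 𝓘(ℝ, E) ∞ γ t := fun t ht ↦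
    hγ.1.contMDiffAt (isOpen_Ioo.mem_nhds ht)
  have hcZ : ∀ t ∈ Ioo (-2 : ℝ) 2, ContinuousAt (fun t ↦ Z (t, v)) t := fun t ht ↦
    (hZ.hasDerivAt t ht v hv).continuousAt
  suffices H : ∀ t ∈ Ioo (max a (-2)) (min b 2),
      γ t = φ.symm (Z (t, v)).1 ∧ deriv (φ ∘ γ) t = (Z (t, v)).2 from (H 1 hJ1).1
  -- The geodesic γ is not known to stay in the chart, so agreement with the flow, positions
  -- compared in M, is propagated by an open-and-closed argument.
  refine isPreconnected_Ioo.forall_of_eventually_of_frequently isOpen_Ioo hJ0 ?_ ?_ ?_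
  · have h0 : γ 0 = p := congrArg TotalSpace.proj hinit
    refine ⟨by simp [h0, hZ.init v hv, hφ], ?_⟩
    have hm0 : γ 0 ∈ φ.source := by rw [h0]; exact mem_extChartAt_source p
    rw [← chartCoord_velocity hm0 ((hsm 0 (hsub 0 hJ0).2).mdifferentiableAt (by simp)),
      hZ.init v hv]
    have h1 := congrArg (fun x : TangentBundle 𝓘(ℝ, E) M ↦ chartCoord p x.1 x.2) hinit
    exact h1.trans (chartCoord_self _)
  · rintro t ht ⟨h1, h2⟩
    have hmt : γ t ∈ φ.source := by rw [h1]; exact φ.map_target (hm t (hsub t ht).1)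
    have hev : ∀ᶠ s in 𝓝 t, s ∈ Ioo (max a (-2)) (min b 2) := isOpen_Ioo.mem_nhds ht
    have hsrc := (hsm t (hsub t ht).2).continuousAt.eventually (eventually_mem_source hmt)
    have he := spray_eventuallyEq (isOpen_extChartAt_target p) (contDiffOn_christoffel cov)
      (Z₁ := fun s ↦ (φ (γ s), deriv (φ ∘ γ) s)) (Z₂ := fun s ↦ Z (s, v)) (t := t)
      (φ.map_source hmt)
      (by filter_upwards [hev, hsrc] with s hs hs' using
            hγ.hasDerivAt_chart isOpen_Ioo (hsub s hs).2 hs')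
      (by filter_upwards [hev] with s hs using hZ.hasDerivAt s (hsub s hs).1 v hv)
      (Prod.ext (by rw [h1]; exact φ.right_inv (hm t (hsub t ht).1)) h2)
    filter_upwards [he, hsrc] with s hs hs'
    refine ⟨?_, congrArg Prod.snd hs⟩
    rw [← congrArg Prod.fst hs, φ.left_inv hs']
  · intro t ht hfr
    have hcγ := (hsm t (hsub t ht).2).continuousAt
    have hcs : ContinuousAt (fun s ↦ φ.symm (Z (s, v)).1) t :=
      ((isGeodesicOn_flow hZ hv).1.contMDiffAt (isOpen_Ioo.mem_nhds (hsub t ht).1)).continuousAt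
    have h1 : γ t = φ.symm (Z (t, v)).1 := by
      by_contra hne
      exact hfr ((hcγ.eventually_ne_of_continuousAt hcs hne).mono fun s hs hs' ↦ hs hs'.2.1)
    refine ⟨h1, ?_⟩
    -- Positions agree in the limit because M is Hausdorff. As the flow curve lies in the chart at
    -- every time, so does γ t, and velocities can be compared there.
    have hmt : γ t ∈ φ.source := by rw [h1]; exact φ.map_target (hm t (hsub t ht).1)
    have hcd := (contDiffAt_chart_comp hmt (hsm t (hsub t ht).2)).deriv_infty.continuousAt
    by_contra hne
    exact hfr ((hcd.eventually_ne_of_continuousAt (hcZ t (hsub t ht).1).snd hne).mono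
      fun s hs hs' ↦ hs hs'.2.2)

lemma expMap_eq [T2Space M] [CovariantDerivative.ContMDiffCovariantDerivative cov ∞]
    (hZ : IsGeodesicFlow (extChartAt 𝓘(ℝ, E) p).target (christoffel p cov)
      (extChartAt 𝓘(ℝ, E) p p) δ Z) {v : E} (hv : v ∈ Metric.ball (0 : E) δ) :
    expMap cov p (v : TangentSpace 𝓘(ℝ, E) p) = (extChartAt 𝓘(ℝ, E) p).symm (Z (1, v)).1 := by
  have h : ∃ q, GeodesicReaches cov p (v : TangentSpace 𝓘(ℝ, E) p) q :=
    ⟨_, geodesicReaches_flow hZ hv⟩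
  exact (dif_pos h).trans (eq_of_geodesicReaches hZ hv h.choose_spec)

end Flow

end SymplecticConnection

/-! ### Normal neighborhoods -/

/-- The inverse function theorem, on a ball. -/
lemma ContDiffAt.exists_openPartialHomeomorph_ball {E : Type*} [NormedAddCommGroup E]
    [NormedSpace ℝ E] [FiniteDimensional ℝ E] {f : E → E} {δ : ℝ} (hδ : 0 < δ)
    (hf : ∀ v ∈ Metric.ball (0 : E) δ, ContDiffAt ℝ ∞ f v)
    (hf0 : HasFDerivAt f (.id ℝ E) 0) :
    ∃ (e : OpenPartialHomeomorph E E) (r : ℝ), 0 < r ∧ r ≤ δ ∧ e.source = Metric.ball 0 r ∧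
      (∀ v, e v = f v) ∧ (∀ x ∈ e.target, ContDiffAt ℝ ∞ e.symm x) ∧
      ∀ v ∈ Metric.ball (0 : E) r, ∀ u, ∃ w, fderiv ℝ f v w = u := by
  have h0 := hf 0 (Metric.mem_ball_self hδ)
  have hf0' : HasFDerivAt f ((ContinuousLinearEquiv.refl ℝ E : E ≃L[ℝ] E) : E →L[ℝ] E) 0 := hf0
  let e₀ := h0.toOpenPartialHomeomorph f hf0' (by simp)
  have hs : e₀.source ∈ 𝓝 (0 : E) :=
    e₀.open_source.mem_nhds (h0.mem_toOpenPartialHomeomorph_source hf0' (by simp))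
  -- Invertibility is kept on a whole ball: it makes the inverse smooth at every point of the target
  -- and the differential surjective at every point of the source.
  have hinv : ∀ᶠ v in 𝓝 (0 : E), fderiv ℝ f v ∈
      range ((↑) : (E ≃L[ℝ] E) → E →L[ℝ] E) := by
    refine (h0.continuousAt_fderiv (by simp)).eventually ?_
    rw [hf0'.fderiv]
    exact ContinuousLinearEquiv.nhds _
  obtain ⟨r, hr, hrsub⟩ := Metric.mem_nhds_iff.1
    (Filter.inter_mem (Filter.inter_mem hs hinv) (Metric.ball_mem_nhds 0 hδ))
  let e := e₀.restrOpen (Metric.ball 0 (min r δ)) Metric.isOpen_ball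
  have hsub : Metric.ball (0 : E) (min r δ) ⊆ Metric.ball 0 r :=
    Metric.ball_subset_ball (min_le_left _ _)
  have hsrc : e.source = Metric.ball 0 (min r δ) := by
    rw [OpenPartialHomeomorph.restrOpen_source]
    exact inter_eq_right.2 fun v hv ↦ (hrsub (hsub hv)).1.1
  refine ⟨e, min r δ, lt_min hr hδ, min_le_right _ _, hsrc, fun v ↦ rfl, fun x hx ↦ ?_,
    fun v hv u ↦ ?_⟩
  · have hv := hrsub (hsub (hsrc ▸ e.map_target hx))
    obtain ⟨L, hL⟩ := hv.1.2
    have hd := hf _ hv.2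
    refine e.contDiffAt_symm hx (f₀' := L) ?_ hd
    rw [hL]
    exact (hd.differentiableAt (by simp)).hasFDerivAt
  · obtain ⟨L, hL⟩ := (hrsub (hsub hv)).1.2
    exact ⟨L.symm u, by rw [← hL]; simp⟩

namespace SymplecticConnection

open LocalConnection

universe u v
variable {E : Type u} [NormedAddCommGroup E] [NormedSpace ℝ E]
  {M : Type v} [TopologicalSpace M] [ChartedSpace E M] [IsManifold 𝓘(ℝ, E) ∞ M] {p : M}
  {cov : CovariantDerivative 𝓘(ℝ, E) E (TangentSpace 𝓘(ℝ, E) : M → Type _)}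

/-- The differential of a map `s`, read in the charts `Φ` and `extChartAt p`. -/
lemma chartCoord_mfderiv_comp_exp {Φ : PartialDiffeomorph 𝓘(ℝ, E) 𝓘(ℝ, E) E M ∞} {s : M → M}
    {v : E} (hv : v ∈ Φ.source) (hs : MDifferentiableAt 𝓘(ℝ, E) 𝓘(ℝ, E) s (Φ v))
    (hm : s (Φ v) ∈ (extChartAt 𝓘(ℝ, E) p).source) {g : E → E}
    (hg : (fun v ↦ extChartAt 𝓘(ℝ, E) p (s (Φ v))) =ᶠ[𝓝 v] g) (w : E) :
    chartCoord p (s (Φ v)) (mfderiv 𝓘(ℝ, E) 𝓘(ℝ, E) s (Φ v)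
      (mfderiv 𝓘(ℝ, E) 𝓘(ℝ, E) Φ v w)) = fderiv ℝ g v w := by
  have hΦ := Φ.mdifferentiableAt (by simp) hv
  have h2 : MDifferentiableAt 𝓘(ℝ, E) 𝓘(ℝ, E) (extChartAt 𝓘(ℝ, E) p) (s (Φ v)) :=
    mdifferentiableAt_extChartAt (by simpa using hm)
  have h3 := (h2.hasMFDerivAt.comp v (hs.hasMFDerivAt.comp v hΦ.hasMFDerivAt)).mfderiv
  rw [mfderiv_eq_fderiv] at h3
  rw [chartCoord_eq_mfderiv hm, ← hg.fderiv_eq]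
  exact (congrArg (fun L : E →L[ℝ] E ↦ L w) h3).symm

variable [FiniteDimensional ℝ E]

/-- The exponential map restricts to a diffeomorphism of a ball onto a neighborhood of `p`. -/
theorem exists_isSymmetricNormal [T2Space M]
    [CovariantDerivative.ContMDiffCovariantDerivative cov ∞] {δ : ℝ} {Z : ℝ × E → E × E}
    (hZ : IsGeodesicFlow (extChartAt 𝓘(ℝ, E) p).target (christoffel p cov)
      (extChartAt 𝓘(ℝ, E) p p) δ Z) :
    ∃ Φ : PartialDiffeomorph 𝓘(ℝ, E) 𝓘(ℝ, E) E M ∞, IsSymmetricNormal cov p Φ ∧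
      Φ.source ⊆ Metric.ball 0 δ ∧ (∀ v, Φ v = (extChartAt 𝓘(ℝ, E) p).symm (Z (1, v)).1) ∧
      ∀ v ∈ Φ.source, ∀ u, ∃ w, fderiv ℝ (fun v ↦ (Z (1, v)).1) v w = u := by
  have h1 : (1 : ℝ) ∈ Ioo (-2 : ℝ) 2 := by norm_num
  have hf : ∀ v ∈ Metric.ball (0 : E) δ, ContDiffAt ℝ ∞ (fun v ↦ (Z (1, v)).1) v := fun v hv ↦
    contDiffAt_fst.comp v ((hZ.contDiffAt 1 h1 v hv).comp v (contDiffAt_const.prodMk contDiffAt_id))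
  obtain ⟨e, r, hr, hrδ, hsrc, he, hsymm, hsurj⟩ :=
    ContDiffAt.exists_openPartialHomeomorph_ball hZ.pos hf
      (hZ.hasFDerivAt_fst_one_zero (isOpen_extChartAt_target p) (contDiffOn_christoffel cov))
  have hball : Metric.ball (0 : E) r ⊆ Metric.ball 0 δ := Metric.ball_subset_ball hrδ
  let Ψ := e.trans (chartAt E p).symm
  have hΨs : Ψ.source = Metric.ball 0 r := by
    rw [OpenPartialHomeomorph.trans_source, hsrc]
    refine inter_eq_left.2 fun v hv ↦ ?_
    have := hZ.mem 1 h1 v (hball hv)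
    rw [mem_preimage, he]
    simpa using this
  have hΨ : ∀ v, Ψ v = (extChartAt 𝓘(ℝ, E) p).symm (Z (1, v)).1 := fun v ↦ by simp [Ψ, he]
  let Φ : PartialDiffeomorph 𝓘(ℝ, E) 𝓘(ℝ, E) E M ∞ :=
    { toPartialEquiv := Ψ.toPartialEquiv
      open_source := Ψ.open_source
      open_target := Ψ.open_target
      contMDiffOn_toFun := fun v hv ↦ by
        have hv' : v ∈ Metric.ball (0 : E) δ := hball (hΨs ▸ hv)
        have h2 := ((contMDiffOn_extChartAt_symm (I := 𝓘(ℝ, E)) (n := ∞) p).contMDiffAt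
          ((isOpen_extChartAt_target p).mem_nhds (hZ.mem 1 h1 v hv'))).comp v
          (hf v hv').contMDiffAt
        exact (h2.congr_of_eventuallyEq (Eventually.of_forall hΨ)).contMDiffWithinAt
      contMDiffOn_invFun := fun x hx ↦ by
        have hx' : x ∈ (chartAt E p).source ∧ chartAt E p x ∈ e.target := by
          simpa [Ψ, OpenPartialHomeomorph.trans_target] using hx
        have h2 := (hsymm _ hx'.2).contMDiffAt.comp x
          ((contMDiffOn_chart (I := 𝓘(ℝ, E)) (n := ∞)).contMDiffAt
            ((chartAt E p).open_source.mem_nhds hx'.1))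
        exact h2.contMDiffWithinAt }
  have hΦs : Φ.source = Metric.ball 0 r := hΨs
  refine ⟨Φ, ⟨?_, ?_, ?_, ?_, ?_⟩, hΦs ▸ hball, hΨ, hΦs ▸ hsurj⟩
  · rw [hΦs]
    exact Metric.mem_ball_self hr
  · rw [hΦs]
    exact (convex_ball 0 r).starConvex (Metric.mem_ball_self hr)
  · rw [hΦs]
    intro v hv
    simpa using hv
  · rw [hΦs]
    exact fun v hv ↦ ⟨_, geodesicReaches_flow hZ (hball hv)⟩
  · rw [hΦs]
    exact fun v hv ↦ (hΨ v).trans (expMap_eq hZ (hball hv)).symm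

end SymplecticConnection

end

/-! ### The geodesic symmetry preserves the symplectic form -/

theorem mainTheorem3
    {E : Type*} [NormedAddCommGroup E] [NormedSpace ℝ E] [FiniteDimensional ℝ E]
    {M : Type*} [TopologicalSpace M] [T2Space M] [SecondCountableTopology M]
    [ChartedSpace E M] [IsManifold 𝓘(ℝ, E) ∞ M]
    (hdim : 4 ≤ Module.finrank ℝ E)
    (Ω : Π x : M, TangentSpace 𝓘(ℝ, E) x →L[ℝ] TangentSpace 𝓘(ℝ, E) x →L[ℝ] ℝ)
    (cov : CovariantDerivative 𝓘(ℝ, E) E (TangentSpace 𝓘(ℝ, E) : M → Type _))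
    [CovariantDerivative.ContMDiffCovariantDerivative cov ∞]
    (hF : SymplecticConnection.IsFedosov cov Ω)
    (hR : SymplecticConnection.IsRicciType cov Ω) :
    SymplecticConnection.IsSType cov Ω := by
  intro p
  have hloc := SymplecticConnection.isRicciTypeOn cov hF hR p
  obtain ⟨δ, Z, hZ⟩ := LocalConnection.exists_isGeodesicFlow hloc.isOpen hloc.contDiffOn
    (mem_extChartAt_target (I := 𝓘(ℝ, E)) p)
  obtain ⟨Φ, hΦ, hball, hΦZ, hsurj⟩ := SymplecticConnection.exists_isSymmetricNormal hZ
  refine ⟨Φ, hΦ, fun q hq a b ↦ ?_⟩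
  obtain ⟨v, hv, rfl⟩ : ∃ v ∈ Φ.source, Φ v = q :=
    ⟨Φ.symm q, Φ.map_target hq, Φ.right_inv hq⟩
  have hsrc : ∀ v ∈ Φ.source, Φ v ∈ (extChartAt 𝓘(ℝ, E) p).source ∧
      extChartAt 𝓘(ℝ, E) p (Φ v) = (Z (1, v)).1 := fun v hv ↦ by
    have h := hZ.mem 1 (by norm_num) v (hball hv)
    rw [hΦZ]
    exact ⟨(extChartAt 𝓘(ℝ, E) p).map_target h, (extChartAt 𝓘(ℝ, E) p).right_inv h⟩
  have hsymm : ∀ v ∈ Φ.source, SymplecticConnection.geodesicSymmetry Φ (Φ v) = Φ (-v) :=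
    fun v hv ↦ congrArg (fun w ↦ Φ (-w)) (Φ.left_inv hv)
  have hnhds : ∀ᶠ w in 𝓝 v, w ∈ Φ.source := Φ.open_source.mem_nhds hv
  have hs : MDifferentiableAt 𝓘(ℝ, E) 𝓘(ℝ, E)
      (SymplecticConnection.geodesicSymmetry Φ) (Φ v) := by
    have h1 : MDifferentiableAt 𝓘(ℝ, E) 𝓘(ℝ, E) Φ.symm (Φ v) :=
      Φ.symm.mdifferentiableAt (by simp) hq
    have h2 : MDifferentiableAt 𝓘(ℝ, E) 𝓘(ℝ, E) (fun w : E ↦ -w) (Φ.symm (Φ v)) :=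
      differentiableAt_id.neg.mdifferentiableAt
    have h3 : MDifferentiableAt 𝓘(ℝ, E) 𝓘(ℝ, E) Φ (-Φ.symm (Φ v)) :=
      Φ.mdifferentiableAt (by simp) (hΦ.neg_mem _ (Φ.map_target hq))
    exact h3.comp (Φ v) (h2.comp (Φ v) h1)
  have hE : ∀ w : E, SymplecticConnection.chartCoord p (Φ v) (mfderiv 𝓘(ℝ, E) 𝓘(ℝ, E) Φ v w) =
      fderiv ℝ (fun v ↦ (Z (1, v)).1) v w := fun w ↦ by
    have h := SymplecticConnection.chartCoord_mfderiv_comp_exp (p := p) (s := id) hv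
      mdifferentiableAt_id (hsrc v hv).1 (hnhds.mono fun w hw ↦ (hsrc w hw).2) w
    rwa [mfderiv_id] at h
  have hm : SymplecticConnection.geodesicSymmetry Φ (Φ v) ∈ (extChartAt 𝓘(ℝ, E) p).source := by
    rw [hsymm v hv]
    exact (hsrc _ (hΦ.neg_mem v hv)).1
  have hneg : ∀ w, fderiv ℝ (fun v ↦ (Z (1, -v)).1) v w =
      -fderiv ℝ (fun v ↦ (Z (1, v)).1) (-v) w := fun w ↦ by
    have h1 := (hZ.hasFDerivAt_slice (hball (hΦ.neg_mem v hv)) (t := 1)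
      (by norm_num)).fst.differentiableAt.hasFDerivAt
    have h2 := HasFDerivAt.comp (g := fun v ↦ (Z (1, v)).1) v h1 (hasFDerivAt_id v).neg
    have h3 : fderiv ℝ (fun v ↦ (Z (1, -v)).1) v = _ := h2.fderiv
    rw [h3]
    simp
  have hE' : ∀ w : E, SymplecticConnection.chartCoord p (SymplecticConnection.geodesicSymmetry Φ (Φ v))
      (mfderiv 𝓘(ℝ, E) 𝓘(ℝ, E) (SymplecticConnection.geodesicSymmetry Φ) (Φ v)
        (mfderiv 𝓘(ℝ, E) 𝓘(ℝ, E) Φ v w)) =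
      -fderiv ℝ (fun v ↦ (Z (1, v)).1) (-v) w := fun w ↦ by
    refine (SymplecticConnection.chartCoord_mfderiv_comp_exp hv hs hm
      (hnhds.mono fun w hw ↦ ?_) w).trans (hneg w)
    simp only [hsymm w hw]
    exact (hsrc _ (hΦ.neg_mem w hw)).2
  -- Every tangent vector at Φ v is the image of some w under the differential of exp_p. This
  -- reduces invariance under the symmetry to the identity at v and -v.
  obtain ⟨w, hw⟩ := hsurj v hv (SymplecticConnection.chartCoord p (Φ v) a)
  obtain ⟨w', hw'⟩ := hsurj v hv (SymplecticConnection.chartCoord p (Φ v) b)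
  obtain rfl : mfderiv 𝓘(ℝ, E) 𝓘(ℝ, E) Φ v w = a :=
    SymplecticConnection.chartCoord_injective (hsrc v hv).1 ((hE w).trans hw)
  obtain rfl : mfderiv 𝓘(ℝ, E) 𝓘(ℝ, E) Φ v w' = b :=
    SymplecticConnection.chartCoord_injective (hsrc v hv).1 ((hE w').trans hw')
  -- Both sides are passed to the chart at p, where the claim is `form_exp_even`.
  refine (SymplecticConnection.localForm_chartCoord hm _ _).symm.trans (Eq.trans ?_
    (SymplecticConnection.localForm_chartCoord (hsrc v hv).1 _ _))
  refine (congrArg₂ (fun a b ↦ SymplecticConnection.localForm p Ω _ a b) (hE' w) (hE' w')).trans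
    (Eq.trans ?_ (congrArg₂ (fun a b ↦ SymplecticConnection.localForm p Ω _ a b) (hE w) (hE w')).symm)
  simp only [hsymm v hv, (hsrc v hv).2, (hsrc _ (hΦ.neg_mem v hv)).2,
    ← hloc.form_exp_even hdim hZ (hball hv) w w', map_neg, neg_apply, neg_neg]
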